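/- **Setting.** Let $n\ge 1$ and observe the white noise model $dY(t)=f(t)\,dt+n^{-1/2}\,dW(t)$, $-\frac12\le t\le\frac12$, with $W$ a standard Brownian motion; the target is $f(0)$. Fix $0<\alpha\le 0.2$ and put $z_\alpha=\Phi^{-1}(1-\alpha)$, with $\Phi$ the standard normal distribution function, and $\sigma_j^2=2^{j-1}/n$. Let $F_m$ and $F_c$ be the classes of nondecreasing, respectively convex, functions on $[-\frac12,\frac12]$. For $M>1$ let $\Lambda(\beta,M)$ be the class of $f$ on $[-\frac12,\frac12]$ with $|f(y)-f(x)|\le M|y-x|^\beta$ for all $x,y$ if $0\le\beta\le1$, and with $|f^{(k)}(x)-f^{(k)}(y)|\le M|x-y|^{\beta-k}$ for all $x,y$ if $\beta>1$, where $k$ is the largest integer strictly less than $\beta$. An interval $[a,b]$ with $a>b$ is empty; $L(\mathrm{CI})=\max(b-a,0)$ is the length. For a class $F$ let $\mathcal I_\alpha(F)$ be the set of confidence intervals (measurable functions of $Y$) that cover $f(0)$ with probability at least $1-\alpha$ for every $f\in F$. *Monotone procedure.* For $j\ge2$ let $\delta_j^R=2^j(Y(2^{-j})-Y(0))$, $\delta_j^L=2^j(Y(0)-Y(-2^{-j}))$,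 $\xi_j=2^{j-1}(Y(2^{-j+1})-Y(2^{-j}))-2^{j-1}(Y(-2^{-j})-Y(-2^{-j+1}))$, $\hat j=\inf\{j\ge2:\xi_j\le\frac32z_\alpha\sigma_j\}$, and $$\mathrm{CI}_*^m=\bigl[\delta_{\hat j}^L-z_{\alpha/2}\sqrt2\,\sigma_{\hat j},\ \delta_{\hat j}^R+z_{\alpha/2}\sqrt2\,\sigma_{\hat j}\bigr].$$ *Convex procedure.* For $j\ge1$ let $\delta_j=2^{j-1}(Y(2^{-j})-Y(-2^{-j}))$, $\hat j=\inf\{j\ge1:\delta_j-\delta_{j+1}\le z_\alpha\sigma_j\}$, and $$\mathrm{CI}_*^c=\bigl[2\delta_{\hat j+1}-\delta_{\hat j}-z_{\alpha/12}\sqrt5\,\sigma_{\hat j},\ \delta_{\hat j+1}+z_{\alpha/12}\,\sigma_{\hat j+1}\bigr].$$ **Claim.** There are constants $C_1,D_1,C_2,D_2>0$ depending only on $\alpha$ such that the following hold. (i) For every $n\ge1$, $\mathrm{CI}_*^m\in\mathcal I_\alpha(F_m)$, and simultaneously for all $0\le\beta\le1$ and $1<M<\infty$, with $F=F_m\cap\Lambda(\beta,M)$,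 $$\sup_{f\in F}E_fL(\mathrm{CI}_*^m)\le C_1M^{1/(1+2\beta)}n^{-\beta/(1+2\beta)}\quad\text{and}\quad \sup_{f\in F}E_fL(\mathrm{CI}_*^m)\le D_1\inf_{\mathrm{CI}\in\mathcal I_\alpha(F)}\ \sup_{f\in F}E_fL(\mathrm{CI}).$$ (ii) For every $n\ge1$, $\mathrm{CI}_*^c\in\mathcal I_\alpha(F_c)$, and simultaneously for all $1\le\beta\le2$ and $1<M<\infty$, with $F=F_c\cap\Lambda(\beta,M)$, $$\sup_{f\in F}E_fL(\mathrm{CI}_*^c)\le C_2M^{1/(1+2\beta)}n^{-\beta/(1+2\beta)}\quad\text{and}\quad \sup_{f\in F}E_fL(\mathrm{CI}_*^c)\le D_2\inf_{\mathrm{CI}\in\mathcal I_\alpha(F)}\ \sup_{f\in F}E_fL(\mathrm{CI}).$$ In this sense both intervals, which do not depend on $\beta$ and $M$, are adaptive minimax over these classes. -/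

import Mathlib

open MeasureTheory ProbabilityTheory Set
open scoped ENNReal NNReal

noncomputable section

namespace WhiteNoiseCI

/-- The time interval `[-1/2, 1/2]`. -/
abbrev unitInt : Set ℝ := Icc (-(1 / 2) : ℝ) (1 / 2)

/-- Observed paths `(Y(t))`, `-1/2 ≤ t ≤ 1/2`, with the product sigma-algebra. -/
abbrev Path : Type := unitInt → ℝ

/-- The value of a path at the time `t`. It is only used at times in `[-1/2, 1/2]`
(other times are projected to the nearest end point). -/
def val (y : Path) (t : ℝ) : ℝ :=
  Set.IccExtend (by norm_num : (-(1 / 2) : ℝ) ≤ 1 / 2) y t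

/-! ### Function classes -/

/-- Functions that are nondecreasing on `[-1/2, 1/2]`. -/
def monoClass : Set (ℝ → ℝ) := {f | MonotoneOn f unitInt}

/-- Functions that are convex on `[-1/2, 1/2]`. -/
def convClass : Set (ℝ → ℝ) := {f | ConvexOn ℝ unitInt f}

/-- The largest natural number (strictly) less than `β`, for `0 < β`. -/
def lowerFloor (β : ℝ) : ℕ := ⌈β⌉₊ - 1

/-- The Lipschitz class `Λ(β, M)` on `[-1/2, 1/2]`; derivatives at the end points are one-sided. -/
def lipClass (β M : ℝ) : Set (ℝ → ℝ) :=
  {f | if β ≤ 1 then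
      ∀ x ∈ unitInt, ∀ y ∈ unitInt, |f y - f x| ≤ M * |y - x| ^ β
    else
      ContDiffOn ℝ (lowerFloor β) f unitInt ∧
      ∀ x ∈ unitInt, ∀ y ∈ unitInt,
        |iteratedDerivWithin (lowerFloor β) f unitInt x
          - iteratedDerivWithin (lowerFloor β) f unitInt y|
          ≤ M * |x - y| ^ (β - lowerFloor β)}

/-! ### The white noise model and confidence intervals -/

/-- The white noise observation `dY(t) = f(t) dt + n^{-1/2} dW(t)` on `[-1/2, 1/2]`, started from
`Y(-1/2) = 0`, where `W(t) = B(t + 1/2)` for a Brownian motion `B` with time set `[0, ∞)`. -/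
def whiteNoise {Ω : Type*} (n : ℝ) (B : ℝ≥0 → Ω → ℝ) (f : ℝ → ℝ) (ω : Ω) : Path := fun t =>
  (∫ s in (-(1 / 2) : ℝ)..(t : ℝ), f s) +
    (Real.sqrt n)⁻¹ * B ⟨(t : ℝ) + 1 / 2, by have := t.2.1; linarith⟩ ω

/-- An interval-valued statistic given by its lower and upper end points. -/
structure ConfInt where
  lower : Path → ℝ
  upper : Path → ℝ

/-- The interval; it is empty when the lower end point exceeds the upper one. -/
def ConfInt.toSet (CI : ConfInt) (y : Path) : Set ℝ := Icc (CI.lower y) (CI.upper y)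

/-- The length `max (upper - lower) 0`. -/
def ConfInt.length (CI : ConfInt) (y : Path) : ℝ≥0∞ := ENNReal.ofReal (CI.upper y - CI.lower y)

/-- The expected length at `f`. -/
def expLength {Ω : Type*} [MeasurableSpace Ω] (P : Measure Ω) (B : ℝ≥0 → Ω → ℝ) (n : ℝ)
    (CI : ConfInt) (f : ℝ → ℝ) : ℝ≥0∞ :=
  ∫⁻ ω, CI.length (whiteNoise n B f ω) ∂P

/-- The maximum expected length over the class `F`. -/
def maxExpLength {Ω : Type*} [MeasurableSpace Ω] (P : Measure Ω) (B : ℝ≥0 → Ω → ℝ) (n : ℝ)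
    (CI : ConfInt) (F : Set (ℝ → ℝ)) : ℝ≥0∞ :=
  ⨆ f ∈ F, expLength P B n CI f

/-- The confidence intervals for `f 0` with coverage probability at least `1 - α` for every
`f ∈ F`. -/
def guaranteed {Ω : Type*} [MeasurableSpace Ω] (P : Measure Ω) (B : ℝ≥0 → Ω → ℝ) (n α : ℝ)
    (F : Set (ℝ → ℝ)) : Set ConfInt :=
  {CI | Measurable CI.lower ∧ Measurable CI.upper ∧
    ∀ f ∈ F, ENNReal.ofReal (1 - α) ≤ P {ω | f 0 ∈ CI.toSet (whiteNoise n B f ω)}}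

/-- The minimax expected length over `F`, among intervals with guaranteed coverage over `F`. -/
def minimaxLength {Ω : Type*} [MeasurableSpace Ω] (P : Measure Ω) (B : ℝ≥0 → Ω → ℝ) (n α : ℝ)
    (F : Set (ℝ → ℝ)) : ℝ≥0∞ :=
  ⨅ CI ∈ guaranteed P B n α F, maxExpLength P B n CI F

/-! ### The procedures -/

/-- The standard normal quantile `z_α = Φ⁻¹(1 - α)`. -/
def zq (α : ℝ) : ℝ := sInf {x : ℝ | 1 - α ≤ cdf (gaussianReal 0 1) x}

/-- `σ_j = (2^{j-1} / n)^{1/2}`. -/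
def sig (n : ℝ) (j : ℕ) : ℝ := Real.sqrt ((2 : ℝ) ^ ((j : ℤ) - 1) / n)

/-- The dyadic time `2^{-j}`. -/
def dy (j : ℕ) : ℝ := (2 : ℝ) ^ (-(j : ℤ))

/-- `δ_j^R = 2^j (Y(2^{-j}) - Y(0))`. -/
def deltaR (y : Path) (j : ℕ) : ℝ := (2 : ℝ) ^ j * (val y (dy j) - val y 0)

/-- `δ_j^L = 2^j (Y(0) - Y(-2^{-j}))`. -/
def deltaL (y : Path) (j : ℕ) : ℝ := (2 : ℝ) ^ j * (val y 0 - val y (-dy j))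

/-- `ξ_j = 2^{j-1}(Y(2^{-j+1}) - Y(2^{-j})) - 2^{j-1}(Y(-2^{-j}) - Y(-2^{-j+1}))`. -/
def xi (y : Path) (j : ℕ) : ℝ :=
  (2 : ℝ) ^ ((j : ℤ) - 1) * (val y (2 * dy j) - val y (dy j))
    - (2 : ℝ) ^ ((j : ℤ) - 1) * (val y (-dy j) - val y (-(2 * dy j)))

/-- The interval `CI_j^m(α)`. -/
def monoCIj (n α : ℝ) (j : ℕ) : ConfInt where
  lower y := deltaL y j - zq (α / 2) * Real.sqrt 2 * sig n j
  upper y := deltaR y j + zq (α / 2) * Real.sqrt 2 * sig n j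

/-- The selected level, the smallest `j ≥ 2` with `ξ_j ≤ (3/2) z_α σ_j`
(`0` if there is none, which is an event of probability zero). -/
def monoJ (n α : ℝ) (y : Path) : ℕ :=
  sInf {j : ℕ | 2 ≤ j ∧ xi y j ≤ 3 / 2 * zq α * sig n j}

/-- The adaptive interval `CI_*^m`. -/
def monoCI (n α : ℝ) : ConfInt where
  lower y := (monoCIj n α (monoJ n α y)).lower y
  upper y := (monoCIj n α (monoJ n α y)).upper y

/-- `δ_j = 2^{j-1}(Y(2^{-j}) - Y(-2^{-j}))`. -/
def delta (y : Path) (j : ℕ) : ℝ :=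
  (2 : ℝ) ^ ((j : ℤ) - 1) * (val y (dy j) - val y (-dy j))

/-- The interval `CI_j^c(α)`. -/
def convCIj (n α : ℝ) (j : ℕ) : ConfInt where
  lower y := 2 * delta y (j + 1) - delta y j - zq (α / 2) * Real.sqrt 5 * sig n j
  upper y := delta y (j + 1) + zq (α / 2) * sig n (j + 1)

/-- The selected level, the smallest `j ≥ 1` with `T_j = δ_j - δ_{j+1} ≤ z_α σ_j`
(`0` if there is none, which is an event of probability zero). -/
def convJ (n α : ℝ) (y : Path) : ℕ :=
  sInf {j : ℕ | 1 ≤ j ∧ delta y j - delta y (j + 1) ≤ zq α * sig n j}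

/-- The adaptive interval `CI_*^c`; it uses the intervals `CI_j^c` at level `α / 6`. -/
def convCI (n α : ℝ) : ConfInt where
  lower y := (convCIj n (α / 6) (convJ n α y)).lower y
  upper y := (convCIj n (α / 6) (convJ n α y)).upper y

end WhiteNoiseCI

end

noncomputable section

namespace WhiteNoiseCI

open Filter Topology

/-! ### The Gaussian tail -/

/-! Both procedures run a sequence of Gaussian tests, one per dyadic level, and stop at the first
one that accepts. Each statistic is a mean plus a linear functional `noise B c` of the Brownian
motion. These functionals are jointly Gaussian, so independence reduces to a covariance computation
(`indepFun_noise`). The test statistics, ξ_j in the monotone case and T_j = δ_j - δ_{j+1} in the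
convex case, are uncorrelated across levels and have variance σ_j².

Length. As j grows the bias falls and σ_j rises. Let J be the first level at which the class-wide
bias bound 3M 2^{-jβ} is below the test threshold; balancing the two gives σ_J ≲ rate
(`exists_level`). From J on, each test continues with probability at most 1/2 (`measure_surv_le`)
while σ_j grows only by √2, so the sum of σ_j P(level j is reached) is O(σ_J) (`tsum_sig_mul_le`).
Acceptance at level j itself controls the length there by a multiple of σ_j plus a noise term
independent of the earlier tests, and `lintegral_le_of_sel` sums over levels.

Coverage, monotone case. Monotonicity gives δ_j^L and δ_j^R biases of the safe sign, and both depend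
only on increments over [-2^{-j}, 2^{-j}], which are disjoint from those of ξ_2, …, ξ_j.
Conditioning on stopping at j therefore does not change their law, and the error is α/2 + α/2
(`measure_sel_inter`).

Coverage, convex case. The end points are correlated with the tests, so a union bound is used.
Convexity at least halves the mean of T_j from each level to the next (`two_mul_meanT_succ_le`). Let
J be the first level with mean at most (3/5) z_α σ_J. The five levels J-2, …, J+2 can each miss with
probability α/6; stopping before J-2 costs at most α/30 (`measure_sel_conv_le`, `sum_gtail_le`),
stopping after J+2 at most 2α/15 (`measure_surv_conv_le`, `gtail_triple_le`). These add up to α.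

Lower bound. If n‖f - g‖² ≤ 1/10, then P_f(A) ≤ 1/4 + (10/9) P_g(A) for all events A
(`measure_shift_le`, a weak form of Cameron–Martin). An interval covering under both f and g then
contains both f(0) and g(0) with probability at least 1/4 under f, so its expected length is at
least |f(0) - g(0)|/4 (`le_minimaxLength`). Two shifted ramps, respectively two convex functions
that differ only near 0, make this gap of the order of the rate. -/

/-- The upper tail `P(N(0,1) > x)`. -/
def gtail (x : ℝ) : ℝ := (gaussianReal 0 1).real (Ioi x)

lemma gtail_nonneg (x : ℝ) : 0 ≤ gtail x := measureReal_nonneg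

lemma gtail_anti : Antitone gtail := fun _ _ h =>
  measureReal_mono (Ioi_subset_Ioi h)

lemma gtail_eq_integral (x : ℝ) : gtail x = ∫ u in Ioi x, gaussianPDFReal 0 1 u := by
  rw [gtail, Measure.real, gaussianReal_apply_eq_integral 0 one_ne_zero, ENNReal.toReal_ofReal]
  exact integral_nonneg fun u => gaussianPDFReal_nonneg _ _ _

lemma gtail_add_eq_integral (x y : ℝ) :
    gtail (x + y) = ∫ u in Ioi y, gaussianPDFReal (-x) 1 u := by
  have h : gaussianReal 0 1 (Ioi (x + y)) = gaussianReal (-x) 1 (Ioi y) := by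
    have h1 := gaussianReal_map_sub_const (μ := 0) (v := 1) x
    rw [zero_sub] at h1
    rw [← h1, Measure.map_apply (by fun_prop) measurableSet_Ioi]
    congr 1
    ext u
    simp only [mem_Ioi, mem_preimage]
    constructor <;> intro h <;> linarith
  rw [gtail, Measure.real, h, gaussianReal_apply_eq_integral _ one_ne_zero, ENNReal.toReal_ofReal]
  exact integral_nonneg fun u => gaussianPDFReal_nonneg _ _ _

/-- The density of N(-x,1) relative to N(0,1) at u is exp(-(xu + x²/2)), which for x ≥ 0 is largest
at the left end u = y of the half-line. -/
lemma gtail_add_le (x y : ℝ) (hx : 0 ≤ x) :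
    gtail (x + y) ≤ Real.exp (-(x * y + x ^ 2 / 2)) * gtail y := by
  rw [gtail_add_eq_integral, gtail_eq_integral, ← integral_const_mul]
  refine setIntegral_mono_on (integrable_gaussianPDFReal _ _).integrableOn
    ((integrable_gaussianPDFReal _ _).const_mul _).integrableOn measurableSet_Ioi fun u hu => ?_
  have hu' : y < u := hu
  simp only [gaussianPDFReal]
  rw [mul_left_comm, ← Real.exp_add]
  gcongr
  simp only [NNReal.coe_one]
  nlinarith

lemma compl_Ioi_real (x : ℝ) : (gaussianReal 0 1).real (Iic x) = 1 - gtail x := by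
  rw [← compl_Ioi, probReal_compl_eq_one_sub measurableSet_Ioi, gtail]

lemma gaussian_Iio_neg (x : ℝ) : (gaussianReal 0 1).real (Iio (-x)) = gtail x := by
  have h1 := gaussianReal_map_neg (μ := 0) (v := 1)
  rw [neg_zero] at h1
  rw [gtail]
  conv_rhs => rw [← h1]
  rw [map_measureReal_apply (by fun_prop) measurableSet_Ioi]
  congr 1
  ext u
  simp

lemma gtail_zero : gtail 0 = 1 / 2 := by
  have h := gaussian_Iio_neg 0
  have h0 := compl_Ioi_real 0
  have := nullSingletonClass_gaussianReal (μ := 0) (v := 1) one_ne_zero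
  have h2 : (gaussianReal 0 1).real (Iic (0 : ℝ)) = (gaussianReal 0 1).real (Iio (0 : ℝ)) :=
    measureReal_congr Iio_ae_eq_Iic.symm
  rw [neg_zero] at h
  linarith

lemma gtail_eq_half_sub {x : ℝ} :
    gtail x = 1 / 2 - ∫ u in (0 : ℝ)..x, gaussianPDFReal 0 1 u := by
  have h := intervalIntegral.integral_interval_add_Ioi' (μ := volume) (a := 0) (b := x)
    (integrable_gaussianPDFReal 0 1).intervalIntegrable
    (integrable_gaussianPDFReal 0 1).integrableOn
  rw [← gtail_eq_integral, ← gtail_eq_integral, gtail_zero] at h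
  linarith

lemma gaussianPDFReal_le (u : ℝ) : gaussianPDFReal 0 1 u ≤ 2 / 5 := by
  have h1 : (Real.sqrt (2 * Real.pi * (1 : ℝ≥0)))⁻¹ ≤ 2 / 5 := by
    have : (5 / 2 : ℝ) ≤ Real.sqrt (2 * Real.pi * (1 : ℝ≥0)) := by
      apply Real.le_sqrt_of_sq_le
      have := Real.pi_gt_d2
      simp only [NNReal.coe_one]
      nlinarith
    rw [inv_le_comm₀ (by linarith) (by norm_num)]
    linarith
  have h2 : Real.exp (-(u - 0) ^ 2 / (2 * (1 : ℝ≥0))) ≤ 1 := by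
    apply Real.exp_le_one_iff.2
    simp only [NNReal.coe_one]
    nlinarith [sq_nonneg u]
  calc gaussianPDFReal 0 1 u ≤ 2 / 5 * 1 := by
        rw [gaussianPDFReal]; gcongr
    _ = 2 / 5 := by norm_num

lemma half_sub_le_gtail {x : ℝ} (hx : 0 ≤ x) : 1 / 2 - 2 / 5 * x ≤ gtail x := by
  rw [gtail_eq_half_sub]
  have : ∫ u in (0 : ℝ)..x, gaussianPDFReal 0 1 u ≤ ∫ u in (0 : ℝ)..x, (2 / 5 : ℝ) :=
    intervalIntegral.integral_mono_on hx (integrable_gaussianPDFReal 0 1).intervalIntegrable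
      (by simp) fun u _ => gaussianPDFReal_le u
  simp at this
  linarith

/-- The tail is convex on [0, ∞), because the density decreases there; this is the chord between 0,
where the tail is 1/2, and z. -/
lemma gtail_mul_le {c z : ℝ} (hc0 : 0 ≤ c) (hc : c ≤ 1) (hz : 0 ≤ z) :
    gtail (c * z) ≤ (1 - c) / 2 + c * gtail z := by
  rw [gtail_eq_half_sub, gtail_eq_half_sub (x := z)]
  have h1 : c * ∫ u in (0 : ℝ)..z, gaussianPDFReal 0 1 u
      ≤ c * ∫ u in (0 : ℝ)..z, gaussianPDFReal 0 1 (c * u) := by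
    gcongr
    refine intervalIntegral.integral_mono_on hz
      (integrable_gaussianPDFReal 0 1).intervalIntegrable ?_ fun u hu => ?_
    · apply Continuous.intervalIntegrable
      unfold gaussianPDFReal
      fun_prop
    · simp only [gaussianPDFReal]
      gcongr
      simp only [sub_zero]
      exacts [mul_nonneg hc0 hu.1, by nlinarith [hu.1]]
  rw [intervalIntegral.mul_integral_comp_mul_left] at h1
  simp only [mul_zero] at h1
  linarith

/-- For independent standard normals X, Y the quadrant {X > a, Y > b} lies in the half-plane {aX +
bY > r²}, r² = a² + b², whose probability is the one-dimensional tail at r ≥ c. -/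
lemma gtail_mul_gtail_le {a b c : ℝ} (ha : 0 < a) (hb : 0 ≤ b) (hc : c ^ 2 ≤ a ^ 2 + b ^ 2) :
    gtail a * gtail b ≤ gtail c := by
  set γ := gaussianReal 0 1
  set r := Real.sqrt (a ^ 2 + b ^ 2) with hr
  have hr0 : 0 < r := Real.sqrt_pos.2 (by positivity)
  have hr2 : r ^ 2 = a ^ 2 + b ^ 2 := Real.sq_sqrt (by positivity)
  have hX : HasLaw (Prod.fst : ℝ × ℝ → ℝ) γ (γ.prod γ) :=
    measurePreserving_fst.hasLaw
  have hY : HasLaw (Prod.snd : ℝ × ℝ → ℝ) γ (γ.prod γ) :=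
    measurePreserving_snd.hasLaw
  have hXY : IndepFun (fun p : ℝ × ℝ => a / r * p.1) (fun p : ℝ × ℝ => b / r * p.2) (γ.prod γ) :=
    indepFun_prod (X := fun x : ℝ => a / r * x) (Y := fun x : ℝ => b / r * x)
      (by fun_prop) (by fun_prop)
  have hsum := gaussianReal_add_gaussianReal_of_indepFun hXY
    (gaussianReal_const_mul hX (a / r)).map_eq (gaussianReal_const_mul hY (b / r)).map_eq
  have hv : (.mk ((a / r) ^ 2) (sq_nonneg _) * 1 + .mk ((b / r) ^ 2) (sq_nonneg _) * 1 : ℝ≥0) = 1 := by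
    ext
    simp only [mul_one, NNReal.coe_add, NNReal.coe_mk, NNReal.coe_one]
    field_simp
    linarith
  rw [hv] at hsum
  simp only [mul_zero, add_zero] at hsum
  have hcr : c ≤ r := Real.le_sqrt_of_sq_le hc
  calc gtail a * gtail b = (γ.prod γ).real (Ioi a ×ˢ Ioi b) := by
        rw [measureReal_prod_prod]; rfl
    _ ≤ (γ.prod γ).real (((fun p : ℝ × ℝ => a / r * p.1) + fun p : ℝ × ℝ => b / r * p.2) ⁻¹'
          (Ioi r)) := by
        refine measureReal_mono ?_
        rintro ⟨x, y⟩ ⟨hx, hy⟩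
        simp only [mem_Ioi, mem_preimage, Pi.add_apply] at hx hy ⊢
        have h1 : a * a + b * b < a * x + b * y := by nlinarith
        have : r < (a * x + b * y) / r := by rw [lt_div_iff₀ hr0]; nlinarith
        calc r < (a * x + b * y) / r := this
          _ = a / r * x + b / r * y := by ring
    _ = gtail r := by
        rw [← map_measureReal_apply (by fun_prop) measurableSet_Ioi, hsum]; rfl
    _ ≤ gtail c := gtail_anti hcr

/-- Right continuity of the distribution function makes the infimum defining the quantile attained.
-/
lemma gtail_zq_le {α : ℝ} (hα : 0 < α) : gtail (zq α) ≤ α := by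
  set S := {x : ℝ | 1 - α ≤ cdf (gaussianReal 0 1) x} with hS
  have hne : S.Nonempty := by
    have := (tendsto_cdf_atTop (gaussianReal 0 1)).eventually (lt_mem_nhds (by linarith : 1 - α < 1))
    obtain ⟨x, hx⟩ := this.exists
    exact ⟨x, hx.le⟩
  have h1 : 1 - α ≤ cdf (gaussianReal 0 1) (zq α) := by
    have hrc := ((cdf (gaussianReal 0 1)).right_continuous (zq α)).mono Ioi_subset_Ici_self
    refine ge_of_tendsto hrc ?_
    filter_upwards [self_mem_nhdsWithin] with y hy
    obtain ⟨s, hs, hsy⟩ := exists_lt_of_csInf_lt hne hy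
    exact le_trans hs (monotone_cdf _ hsy.le)
  rw [cdf_eq_real, compl_Ioi_real] at h1
  linarith

/-- The normal density is at most 2/5. For α ≤ 1/5 this gives z_α ≥ 3/4, the only numerical lower
bound on the quantile that the coverage proof needs. -/
lemma half_sub_le_zq {α : ℝ} (hα : 0 < α) (hα1 : α < 1 / 2) : 5 / 4 - 5 / 2 * α ≤ zq α := by
  have h := gtail_zq_le hα
  rcases le_total 0 (zq α) with h0 | h0
  · have := half_sub_le_gtail h0
    linarith
  · have := gtail_anti h0
    rw [gtail_zero] at this
    linarith

lemma zq_pos {α : ℝ} (hα : 0 < α) (hα1 : α < 1 / 2) : 0 < zq α := by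
  have := half_sub_le_zq hα hα1
  linarith

/-- Bounds the chance that the convex procedure passes three consecutive levels of small bias; the
three factors are the relative margins at J, J+1, J+2. -/
lemma gtail_triple_le {α z : ℝ} (hα' : α ≤ 1 / 5) (hz : 0 < z) (h : gtail z ≤ α) :
    gtail (2 / 5 * z) * gtail (1969 / 2500 * z) * gtail (37 / 40 * z) ≤ 2 / 15 * α := by
  have h1 := gtail_mul_le (c := 2 / 5) (by norm_num) (by norm_num) hz.le
  have h2 := gtail_mul_le (c := 1969 / 2500) (by norm_num) (by norm_num) hz.le
  have h3 := gtail_mul_le (c := 37 / 40) (by norm_num) (by norm_num) hz.le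
  have p1 := gtail_nonneg (2 / 5 * z)
  have p2 := gtail_nonneg (1969 / 2500 * z)
  have p3 := gtail_nonneg (37 / 40 * z)
  have hα0 : 0 ≤ α := (gtail_nonneg z).trans h
  -- For small α the outer factors combine to at most α, since (2/5)² + (37/40)² ≥ 1, and the chord
  -- bound makes the middle one at most 2/15. For larger α chord bounds on all three factors
  -- suffice, leaving a cubic inequality on [3/100, 1/5].
  rcases le_total α (3 / 100) with hs | hs
  · have h4 : gtail (2 / 5 * z) * gtail (37 / 40 * z) ≤ gtail z :=
      gtail_mul_gtail_le (by positivity) (by positivity) (by nlinarith [sq_nonneg z])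
    calc gtail (2 / 5 * z) * gtail (1969 / 2500 * z) * gtail (37 / 40 * z)
        = (gtail (2 / 5 * z) * gtail (37 / 40 * z)) * gtail (1969 / 2500 * z) := by ring
      _ ≤ α * (2 / 15) := by
          gcongr
          · exact h4.trans h
          · linarith
      _ = 2 / 15 * α := by ring
  · calc gtail (2 / 5 * z) * gtail (1969 / 2500 * z) * gtail (37 / 40 * z)
        ≤ (3 / 10 + 2 / 5 * α) * (531 / 5000 + 1969 / 2500 * α) * (3 / 80 + 37 / 40 * α) := by
          gcongr
          · linarith
          · linarith
          · linarith
      _ ≤ 2 / 15 * α := by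
          have h5 := mul_nonneg (sub_nonneg.2 hs) (sub_nonneg.2 hα')
          have h6 := mul_nonneg hα0 h5
          nlinarith

/-- Total probability of stopping much too early in the convex procedure. Each tail is compared with
the tail at z by `gtail_add_le`, giving at most (α/35) 8^{-m}, and (1/35)(8/7) ≤ 1/30. -/
lemma sum_gtail_le {α z : ℝ} (hα : 0 ≤ α) (hz : 3 / 4 ≤ z) (h : gtail z ≤ α) (N : ℕ) :
    ∑ m ∈ Finset.range N, gtail ((24 / 5 * 2 ^ m - 1) * z) ≤ α / 30 := by
  have he1 : (35 : ℝ) ≤ Real.exp (189 / 50) := by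
    have h1 : Real.exp (189 / 50) = Real.exp 1 ^ 3 * Real.exp (39 / 50) := by
      rw [← Real.exp_nat_mul, ← Real.exp_add]; norm_num
    have h2 := Real.exp_one_gt_d9
    have h3 := Real.add_one_le_exp (39 / 50 : ℝ)
    rw [h1]
    calc (35 : ℝ) ≤ 2.7182818283 ^ 3 * (39 / 50 + 1) := by norm_num
      _ ≤ _ := by gcongr
  have he2 : (8 : ℝ) ≤ Real.exp (27 / 10) := by
    have h1 : Real.exp (27 / 10) = Real.exp 1 ^ 2 * Real.exp (7 / 10) := by
      rw [← Real.exp_nat_mul, ← Real.exp_add]; norm_num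
    have h2 := Real.exp_one_gt_d9
    have h3 := Real.add_one_le_exp (7 / 10 : ℝ)
    rw [h1]
    calc (8 : ℝ) ≤ 2.7182818283 ^ 2 * (7 / 10 + 1) := by norm_num
      _ ≤ _ := by gcongr
  have key : ∀ m : ℕ, gtail ((24 / 5 * 2 ^ m - 1) * z) ≤ (1 / 35 * α) * (1 / 8) ^ m := by
    intro m
    have hb : (1 : ℝ) + m ≤ 2 ^ m := by
      have := one_add_mul_le_pow (a := (1 : ℝ)) (by norm_num) m
      norm_num at this
      linarith
    have hm0 : (0 : ℝ) ≤ m := Nat.cast_nonneg m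
    set p : ℝ := 2 ^ m
    have hx : 0 ≤ (24 / 5 * p - 2) * z := mul_nonneg (by linarith) (by linarith)
    have h1 := gtail_add_le ((24 / 5 * p - 2) * z) z hx
    have h2 : (24 / 5 * p - 2) * z + z = (24 / 5 * p - 1) * z := by ring
    rw [h2] at h1
    refine h1.trans ?_
    -- With w = (24/5) 2^m - 2 ≥ 14/5 + (24/5) m, the exponent is (w + w²/2) z², and z² ≥ 9/16 gives
    -- these constants.
    have hexp : 189 / 50 + m * (27 / 10)
        ≤ (24 / 5 * p - 2) * z * z + ((24 / 5 * p - 2) * z) ^ 2 / 2 := by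
      have hzz : (9 / 16 : ℝ) ≤ z ^ 2 := by nlinarith
      have hw : 14 / 5 + 24 / 5 * (m : ℝ) ≤ 24 / 5 * p - 2 := by linarith
      set w := 24 / 5 * p - 2
      have hw2 : (14 / 5 : ℝ) ^ 2 ≤ w ^ 2 := by nlinarith
      have : (14 / 5 + 24 / 5 * (m : ℝ) + (14 / 5) ^ 2 / 2) * (9 / 16) ≤ (w + w ^ 2 / 2) * z ^ 2 := by
        gcongr
        nlinarith
      nlinarith
    calc Real.exp (-((24 / 5 * p - 2) * z * z + ((24 / 5 * p - 2) * z) ^ 2 / 2)) * gtail z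
        ≤ Real.exp (-(189 / 50 + m * (27 / 10))) * α := by
          gcongr
          exact gtail_nonneg z
      _ = (Real.exp (189 / 50))⁻¹ * α * ((Real.exp (27 / 10))⁻¹) ^ m := by
          rw [neg_add, Real.exp_add, Real.exp_neg, Real.exp_neg, Real.exp_nat_mul]
          ring
      _ ≤ (1 / 35 * α) * (1 / 8) ^ m := by
          rw [one_div, one_div]
          gcongr
  calc ∑ m ∈ Finset.range N, gtail ((24 / 5 * 2 ^ m - 1) * z)
      ≤ ∑ m ∈ Finset.range N, (1 / 35 * α) * (1 / 8) ^ m := Finset.sum_le_sum fun m _ => key m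
    _ = (1 / 35 * α) * ∑ m ∈ Finset.range N, (1 / 8 : ℝ) ^ m := by rw [Finset.mul_sum]
    _ ≤ (1 / 35 * α) * (8 / 7) := by
        gcongr
        rw [geom_sum_eq (by norm_num)]
        have : (0 : ℝ) ≤ (1 / 8) ^ N := by positivity
        rw [div_le_iff_of_neg (by norm_num)]
        linarith
    _ ≤ α / 30 := by linarith

section Law

variable {Ω : Type*} [MeasurableSpace Ω] {P : Measure Ω}

lemma measure_gt_of_hasLaw {X : Ω → ℝ} {v : ℝ≥0} {s : ℝ} (hs : 0 < s) (hv : (v : ℝ) = s ^ 2)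
    (hX : HasLaw X (gaussianReal 0 v) P) (x : ℝ) :
    P {ω | s * x < X ω} = ENNReal.ofReal (gtail x) := by
  have h := gaussianReal_const_mul hX s⁻¹
  have hv1 : (.mk (s⁻¹ ^ 2) (sq_nonneg _) * v : ℝ≥0) = 1 := by
    ext
    simp only [NNReal.coe_mul, NNReal.coe_mk, NNReal.coe_one, hv]
    field_simp
  rw [hv1, mul_zero] at h
  have h2 := h.measure_eq (p := fun y => x < y) measurableSet_Ioi
  have h3 : {ω | s * x < X ω} = {ω | x < s⁻¹ * X ω} := by
    ext ω
    simp only [mem_ofPred_eq]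
    rw [inv_mul_eq_div, lt_div_iff₀ hs, mul_comm]
  rw [h3, h2, gtail, ofReal_measureReal]
  rfl

lemma measure_lt_of_hasLaw {X : Ω → ℝ} {v : ℝ≥0} {s : ℝ} (hs : 0 < s) (hv : (v : ℝ) = s ^ 2)
    (hX : HasLaw X (gaussianReal 0 v) P) (x : ℝ) :
    P {ω | X ω < -(s * x)} = ENNReal.ofReal (gtail x) := by
  have h := gaussianReal_neg hX
  rw [neg_zero] at h
  rw [← measure_gt_of_hasLaw hs hv h x]
  congr 1
  ext ω
  simp [lt_neg]

lemma lintegral_abs_le_of_hasLaw {X : Ω → ℝ} {v : ℝ≥0} {s : ℝ} (hs : 0 ≤ s) (hv : (v : ℝ) = s ^ 2)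
    (hX : HasLaw X (gaussianReal 0 v) P) :
    ∫⁻ ω, ENNReal.ofReal |X ω| ∂P ≤ ENNReal.ofReal s := by
  have : IsProbabilityMeasure P := hX.isProbabilityMeasure
  have hL : MemLp X 2 P := hX.hasGaussianLaw.memLp_two
  have h0 : ∫ ω, X ω ∂P = 0 := by rw [hX.integral_eq, integral_id_gaussianReal]
  have h1 : eLpNorm X 2 P = ENNReal.ofReal s := by
    have hvar : Var[X; P] = s ^ 2 := by rw [hX.variance_eq, variance_id_gaussianReal, hv]
    rw [variance_eq_sub hL, h0] at hvar
    rw [hL.eLpNorm_eq_integral_rpow_norm (by norm_num) (by norm_num)]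
    congr 1
    simp only [ENNReal.toReal_ofNat, Real.norm_eq_abs, Real.rpow_ofNat, sq_abs]
    simp only [Pi.pow_apply] at hvar
    rw [show ∫ ω, X ω ^ 2 ∂P = s ^ 2 by linarith, ← one_div, ← Real.sqrt_eq_rpow,
      Real.sqrt_sq hs]
  calc ∫⁻ ω, ENNReal.ofReal |X ω| ∂P = eLpNorm X 1 P := by
        rw [eLpNorm_one_eq_lintegral_enorm]
        simp [Real.enorm_eq_ofReal_abs]
    _ ≤ eLpNorm X 2 P := eLpNorm_le_eLpNorm_of_exponent_le (by norm_num) hL.1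
    _ = ENNReal.ofReal s := h1

end Law

/-! ### Linear functionals of the Brownian motion -/

section Noise

variable {Ω : Type*} {mΩ : MeasurableSpace Ω} {P : Measure Ω} {B : ℝ≥0 → Ω → ℝ}

/-- The finite linear combinations of the values of the process `B`. -/
def noise (B : ℝ≥0 → Ω → ℝ) : (ℝ≥0 →₀ ℝ) →ₗ[ℝ] (Ω → ℝ) := Finsupp.linearCombination ℝ B

lemma noise_apply (c : ℝ≥0 →₀ ℝ) (ω : Ω) : noise B c ω = ∑ t ∈ c.support, c t * B t ω := by
  simp [noise, Finsupp.linearCombination_apply, Finsupp.sum]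

lemma noise_single (t : ℝ≥0) : noise B (Finsupp.single t 1) = B t := by
  simp [noise]

lemma measurable_noise (hB : ∀ t, Measurable (B t)) (c : ℝ≥0 →₀ ℝ) : Measurable (noise B c) := by
  have : noise B c = fun ω => ∑ t ∈ c.support, c t * B t ω := funext fun ω => noise_apply c ω
  rw [this]
  exact Finset.measurable_sum _ fun t _ => (hB t).const_mul _

lemma isGaussianProcess_noise (hP : IsPreBrownianReal B P) :
    IsGaussianProcess (fun c : ℝ≥0 →₀ ℝ => noise B c) P := by
  refine hP.isGaussianProcess.of_isGaussianProcess fun c => ⟨c.support,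
    ∑ t : c.support, c t • ContinuousLinearMap.proj t, fun ω => ?_⟩
  rw [noise_apply, ← Finset.sum_coe_sort]
  simp

lemma memLp_noise (hP : IsPreBrownianReal B P) (c : ℝ≥0 →₀ ℝ) : MemLp (noise B c) 2 P :=
  ((isGaussianProcess_noise hP).hasGaussianLaw_eval c).memLp_two

lemma integral_noise (hP : IsPreBrownianReal B P) (c : ℝ≥0 →₀ ℝ) : ∫ ω, noise B c ω ∂P = 0 := by
  simp_rw [noise_apply]
  rw [integral_finsetSum _ fun t _ => (hP.integrable_eval t).const_mul _]
  refine Finset.sum_eq_zero fun t _ => ?_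
  rw [integral_const_mul, hP.integral_eval, mul_zero]

lemma hasLaw_noise (hP : IsPreBrownianReal B P) (c : ℝ≥0 →₀ ℝ) :
    HasLaw (noise B c) (gaussianReal 0 (cov[noise B c, noise B c; P]).toNNReal) P := by
  have h := (isGaussianProcess_noise hP).hasGaussianLaw_eval c
  refine ⟨h.aemeasurable, ?_⟩
  rw [h.map_eq_gaussianReal, integral_noise hP, covariance_self h.aemeasurable]

lemma cov_noise_sub_left (hP : IsPreBrownianReal B P) (c c' d : ℝ≥0 →₀ ℝ) :
    cov[noise B (c - c'), noise B d; P]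
      = cov[noise B c, noise B d; P] - cov[noise B c', noise B d; P] := by
  have := hP.isGaussianProcess.isProbabilityMeasure
  rw [map_sub, covariance_sub_left (memLp_noise hP _) (memLp_noise hP _) (memLp_noise hP _)]

lemma cov_noise_sub_right (hP : IsPreBrownianReal B P) (c d d' : ℝ≥0 →₀ ℝ) :
    cov[noise B c, noise B (d - d'); P]
      = cov[noise B c, noise B d; P] - cov[noise B c, noise B d'; P] := by
  have := hP.isGaussianProcess.isProbabilityMeasure
  rw [map_sub, covariance_sub_right (memLp_noise hP _) (memLp_noise hP _) (memLp_noise hP _)]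

lemma cov_noise_smul_left (a : ℝ) (c d : ℝ≥0 →₀ ℝ) :
    cov[noise B (a • c), noise B d; P] = a * cov[noise B c, noise B d; P] := by
  rw [map_smul, covariance_smul_left]

lemma cov_noise_smul_right (a : ℝ) (c d : ℝ≥0 →₀ ℝ) :
    cov[noise B c, noise B (a • d); P] = a * cov[noise B c, noise B d; P] := by
  rw [map_smul, covariance_smul_right]

/-- All finite linear combinations of the process are jointly Gaussian, so uncorrelated families are
independent. All uses of independence in the file rest on this. -/
lemma indepFun_noise (hB : ∀ t, Measurable (B t)) (hP : IsPreBrownianReal B P) {S T : Type*}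
    (c : S → ℝ≥0 →₀ ℝ) (d : T → ℝ≥0 →₀ ℝ)
    (h : ∀ s t, cov[noise B (c s), noise B (d t); P] = 0) :
    IndepFun (fun ω s => noise B (c s) ω) (fun ω t => noise B (d t) ω) P := by
  refine IsGaussianProcess.indepFun_of_covariance_eq_zero ?_
    (fun s => (measurable_noise hB _).aemeasurable) (fun t => (measurable_noise hB _).aemeasurable) h
  have := (isGaussianProcess_noise hP).comp_right (Sum.elim c d)
  convert! this using 1
  ext (s | t) ω <;> rfl

/-- The Brownian time that belongs to the time `t ∈ [-1/2, 1/2]`. -/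
def tm (t : ℝ) : ℝ≥0 := (t + 1 / 2).toNNReal

/-- The increment functional between the times `s` and `t`. -/
def inc (s t : ℝ) : ℝ≥0 →₀ ℝ := Finsupp.single (tm t) 1 - Finsupp.single (tm s) 1

lemma noise_inc (s t : ℝ) (ω : Ω) : noise B (inc s t) ω = B (tm t) ω - B (tm s) ω := by
  rw [inc, map_sub, noise_single, noise_single]; rfl

lemma cov_inc (hP : IsPreBrownianReal B P) {s t u v : ℝ} (hs : -(1 / 2) ≤ s) (ht : -(1 / 2) ≤ t)
    (hu : -(1 / 2) ≤ u) (hv : -(1 / 2) ≤ v) :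
    cov[noise B (inc s t), noise B (inc u v); P] = min t v - min t u - min s v + min s u := by
  have hmin : ∀ x y : ℝ, -(1 / 2) ≤ x → -(1 / 2) ≤ y →
      ((min (tm x) (tm y) : ℝ≥0) : ℝ) = min x y + 1 / 2 := by
    intro x y hx hy
    rw [tm, tm, NNReal.coe_min, Real.coe_toNNReal _ (by linarith), Real.coe_toNNReal _ (by linarith),
      min_add_add_right]
  rw [inc, inc, cov_noise_sub_left hP, cov_noise_sub_right hP, cov_noise_sub_right hP]
  simp only [noise_single, hP.covariance_eval]
  rw [hmin _ _ ht hv, hmin _ _ ht hu, hmin _ _ hs hv, hmin _ _ hs hu]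
  ring

lemma cov_inc_disjoint (hP : IsPreBrownianReal B P) {s t u v : ℝ} (hs : -(1 / 2) ≤ s) (hst : s ≤ t)
    (htu : t ≤ u) (huv : u ≤ v) :
    cov[noise B (inc s t), noise B (inc u v); P] = 0 := by
  rw [cov_inc hP hs (by linarith) (by linarith) (by linarith), min_eq_left (by linarith),
    min_eq_left htu, min_eq_left (by linarith), min_eq_left (by linarith)]
  ring

lemma cov_inc_disjoint' (hP : IsPreBrownianReal B P) {s t u v : ℝ} (hs : -(1 / 2) ≤ s) (hst : s ≤ t)
    (htu : t ≤ u) (huv : u ≤ v) :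
    cov[noise B (inc u v), noise B (inc s t); P] = 0 := by
  rw [covariance_comm, cov_inc_disjoint hP hs hst htu huv]

lemma cov_inc_self (hP : IsPreBrownianReal B P) {s t : ℝ} (hs : -(1 / 2) ≤ s) (hst : s ≤ t) :
    cov[noise B (inc s t), noise B (inc s t); P] = t - s := by
  rw [cov_inc hP hs (by linarith) hs (by linarith), min_self, min_self, min_eq_right hst,
    min_eq_left hst]
  ring

lemma measure_noise_gt (hP : IsPreBrownianReal B P) {c : ℝ≥0 →₀ ℝ} {s : ℝ} (hs : 0 < s)
    (hc : cov[noise B c, noise B c; P] = s ^ 2) (x : ℝ) :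
    P {ω | s * x < noise B c ω} = ENNReal.ofReal (gtail x) :=
  measure_gt_of_hasLaw hs (by rw [hc, Real.coe_toNNReal _ (by positivity)]) (hasLaw_noise hP c) x

lemma measure_noise_lt (hP : IsPreBrownianReal B P) {c : ℝ≥0 →₀ ℝ} {s : ℝ} (hs : 0 < s)
    (hc : cov[noise B c, noise B c; P] = s ^ 2) (x : ℝ) :
    P {ω | noise B c ω < -(s * x)} = ENNReal.ofReal (gtail x) :=
  measure_lt_of_hasLaw hs (by rw [hc, Real.coe_toNNReal _ (by positivity)]) (hasLaw_noise hP c) x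

lemma lintegral_abs_noise_le (hP : IsPreBrownianReal B P) {c : ℝ≥0 →₀ ℝ} {s : ℝ} (hs : 0 ≤ s)
    (hc : cov[noise B c, noise B c; P] = s ^ 2) :
    ∫⁻ ω, ENNReal.ofReal |noise B c ω| ∂P ≤ ENNReal.ofReal s :=
  lintegral_abs_le_of_hasLaw hs (by rw [hc, Real.coe_toNNReal _ (by positivity)]) (hasLaw_noise hP c)

lemma val_apply (y : Path) {t : ℝ} (ht : t ∈ unitInt) : val y t = y ⟨t, ht⟩ :=
  Set.IccExtend_of_mem _ _ ht

lemma val_whiteNoise (n : ℝ) (B : ℝ≥0 → Ω → ℝ) (f : ℝ → ℝ) (ω : Ω) {t : ℝ} (ht : t ∈ unitInt) :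
    val (whiteNoise n B f ω) t
      = (∫ s in (-(1 / 2) : ℝ)..t, f s) + (Real.sqrt n)⁻¹ * B (tm t) ω := by
  rw [val_apply _ ht, whiteNoise]
  congr 3
  ext
  rw [tm, Real.coe_toNNReal _ (by have := ht.1; linarith)]
  rfl

lemma val_whiteNoise_sub (n : ℝ) (B : ℝ≥0 → Ω → ℝ) {f : ℝ → ℝ} (ω : Ω)
    (hf : IntervalIntegrable f volume (-(1 / 2)) (1 / 2)) {s t : ℝ}
    (hs : s ∈ unitInt) (ht : t ∈ unitInt) :
    val (whiteNoise n B f ω) t - val (whiteNoise n B f ω) s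
      = (∫ x in s..t, f x) + (Real.sqrt n)⁻¹ * noise B (inc s t) ω := by
  rw [val_whiteNoise n B f ω hs, val_whiteNoise n B f ω ht, noise_inc]
  have hsub : ∀ u ∈ unitInt, IntervalIntegrable f volume (-(1 / 2)) u := fun u hu =>
    hf.mono_set (by
      rw [uIcc_of_le hu.1, uIcc_of_le (by norm_num)]
      exact Icc_subset_Icc_right hu.2)
  have := intervalIntegral.integral_interval_sub_left (hsub t ht) (hsub s hs)
  linear_combination this

lemma measurable_val (t : ℝ) : Measurable fun y : Path => val y t := measurable_pi_apply _

lemma measurable_whiteNoise (n : ℝ) (hB : ∀ t, Measurable (B t)) (f : ℝ → ℝ) :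
    Measurable (whiteNoise n B f) :=
  measurable_pi_lambda _ fun _ => (measurable_const.add ((hB _).const_mul _))

lemma setLIntegral_eq_of_indepFun {E F : Type*} [MeasurableSpace E] [MeasurableSpace F]
    {X : Ω → E} {Y : Ω → F} (hX : Measurable X) (hY : Measurable Y) (h : IndepFun X Y P)
    {s : Set E} (hs : MeasurableSet s) {g : F → ℝ≥0∞} (hg : Measurable g) :
    ∫⁻ ω in X ⁻¹' s, g (Y ω) ∂P = P (X ⁻¹' s) * ∫⁻ ω, g (Y ω) ∂P := by
  have h1 := lintegral_mul_eq_lintegral_mul_lintegral_of_indepFun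
    ((measurable_one.indicator hs : Measurable (s.indicator (1 : E → ℝ≥0∞))).comp hX)
    (hg.comp hY) (h.comp (measurable_one.indicator hs) hg)
  have h2 : ∫⁻ ω, (s.indicator (1 : E → ℝ≥0∞) ∘ X) ω ∂P = P (X ⁻¹' s) := by
    rw [← lintegral_indicator_one (hX hs)]
    rfl
  rw [h2] at h1
  rw [← lintegral_indicator (hX hs)]
  refine Eq.trans ?_ h1
  congr 1
  ext ω
  by_cases hω : X ω ∈ s <;> simp [hω, indicator]

end Noise

/-! ### Translates of Brownian motion -/

section Shift

/-- Dividing by the left side leaves 1 ≤ e^{-v/2} (E/4 + (10/9)/E) with E = e^{x - v}. By the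
arithmetic–geometric mean the bracket is at least 20/19, and e^{-v/2} ≥ 19/20. -/
lemma gaussianPDFReal_shift_le {v : ℝ≥0} (hv : v ≠ 0) (hv' : v ≤ 1 / 10) (x : ℝ) :
    gaussianPDFReal v v x
      ≤ 1 / 4 * gaussianPDFReal (2 * v) v x + 10 / 9 * gaussianPDFReal 0 v x := by
  have hv0 : (0 : ℝ) < v := by positivity
  have hv1 : (v : ℝ) ≤ 1 / 10 := by exact_mod_cast hv'
  have e1 : -(x - 2 * (v : ℝ)) ^ 2 / (2 * v) = -(x - v) ^ 2 / (2 * v) + ((x - v) + -(v / 2)) := by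
    field_simp; ring
  have e2 : -(x - 0) ^ 2 / (2 * (v : ℝ)) = -(x - v) ^ 2 / (2 * v) + (-(x - v) + -(v / 2)) := by
    field_simp; ring
  simp only [gaussianPDFReal]
  rw [e1, e2]
  simp only [Real.exp_add]
  rw [Real.exp_neg (x - v)]
  set E := Real.exp (x - v) with hE
  have hE0 : 0 < E := Real.exp_pos _
  have hd : 19 / 20 ≤ Real.exp (-((v : ℝ) / 2)) := by
    have := Real.add_one_le_exp (-((v : ℝ) / 2))
    linarith
  set d := Real.exp (-((v : ℝ) / 2))
  have key : 1 ≤ 1 / 4 * (E * d) + 10 / 9 * (E⁻¹ * d) := by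
    have h1 : 20 / 19 ≤ 1 / 4 * E + 10 / 9 * E⁻¹ := by
      have : 0 ≤ (1 / 4 * E + 10 / 9 * E⁻¹ - 20 / 19) * E := by
        have : (1 / 4 * E + 10 / 9 * E⁻¹ - 20 / 19) * E = 1 / 4 * E ^ 2 + 10 / 9 - 20 / 19 * E := by
          field_simp
        rw [this]
        nlinarith [sq_nonneg (E - 40 / 19)]
      have := nonneg_of_mul_nonneg_left this hE0
      linarith
    calc (1 : ℝ) = 20 / 19 * (19 / 20) := by norm_num
      _ ≤ (1 / 4 * E + 10 / 9 * E⁻¹) * d := by gcongr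
      _ = _ := by ring
  have hp : 0 ≤ (Real.sqrt (2 * Real.pi * v))⁻¹ * Real.exp (-(x - v) ^ 2 / (2 * v)) := by positivity
  nlinarith [mul_le_mul_of_nonneg_left key hp]

lemma gaussianReal_shift_le {v : ℝ≥0} (hv : v ≠ 0) (hv' : v ≤ 1 / 10) (A : Set ℝ) :
    gaussianReal v v A ≤ 1 / 4 + 10 / 9 * gaussianReal 0 v A := by
  have h94 : ENNReal.ofReal (10 / 9) = 10 / 9 := by
    rw [ENNReal.ofReal_div_of_pos (by norm_num)]; norm_num
  have h14 : ENNReal.ofReal (1 / 4) = 1 / 4 := by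
    rw [ENNReal.ofReal_div_of_pos (by norm_num)]; norm_num
  calc gaussianReal v v A = ∫⁻ x in A, gaussianPDF v v x := gaussianReal_apply _ hv A
    _ ≤ ∫⁻ x in A, (1 / 4 * gaussianPDF (2 * v) v x + 10 / 9 * gaussianPDF 0 v x) := by
        refine lintegral_mono fun x => ?_
        simp only [gaussianPDF]
        rw [← h94, ← h14, ← ENNReal.ofReal_mul (by norm_num), ← ENNReal.ofReal_mul (by norm_num),
          ← ENNReal.ofReal_add (mul_nonneg (by norm_num) (gaussianPDFReal_nonneg _ _ _))
            (mul_nonneg (by norm_num) (gaussianPDFReal_nonneg _ _ _))]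
        exact ENNReal.ofReal_le_ofReal (gaussianPDFReal_shift_le hv hv' x)
    _ = 1 / 4 * gaussianReal (2 * v) v A + 10 / 9 * gaussianReal 0 v A := by
        rw [gaussianReal_apply _ hv A, gaussianReal_apply _ hv A,
          lintegral_add_left ((measurable_gaussianPDF _ _).const_mul _),
          lintegral_const_mul _ (measurable_gaussianPDF _ _),
          lintegral_const_mul _ (measurable_gaussianPDF _ _)]
    _ ≤ 1 / 4 + 10 / 9 * gaussianReal 0 v A := by
        gcongr
        calc (1 / 4 : ℝ≥0∞) * gaussianReal (2 * v) v A ≤ 1 / 4 * 1 := by gcongr; exact prob_le_one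
          _ = 1 / 4 := mul_one _

variable {Ω : Type*} {mΩ : MeasurableSpace Ω} {P : Measure Ω} {B : ℝ≥0 → Ω → ℝ}
variable {E : Type*} [NormedAddCommGroup E] [InnerProductSpace ℝ E] {e : ℝ≥0 → E}

lemma cov_noise_eq_inner (hP : IsPreBrownianReal B P)
    (he : ∀ s t, inner ℝ (e s) (e t) = ((min s t : ℝ≥0) : ℝ)) (c d : ℝ≥0 →₀ ℝ) :
    cov[noise B c, noise B d; P]
      = inner ℝ (Finsupp.linearCombination ℝ e c) (Finsupp.linearCombination ℝ e d) := by
  have := hP.isGaussianProcess.isProbabilityMeasure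
  have hL : ∀ t, MemLp (B t) 2 P := fun t => (hP.isGaussianProcess.hasGaussianLaw_eval t).memLp_two
  have h1 : ∀ c : ℝ≥0 →₀ ℝ, noise B c = fun ω => ∑ t ∈ c.support, c t * B t ω := fun c =>
    funext fun ω => noise_apply c ω
  rw [h1 c, h1 d, covariance_fun_sum_fun_sum' (fun t _ => (hL t).const_mul _)
    (fun t _ => (hL t).const_mul _)]
  simp only [Finsupp.linearCombination_apply, Finsupp.sum, sum_inner, inner_sum,
    covariance_const_mul_left, covariance_const_mul_right, real_inner_smul_left,
    real_inner_smul_right, he, hP.covariance_eval]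
  rw [Finset.sum_comm]

/-- Only the projection G of h onto the span of the e_t, t ∈ I, is visible. Translating by it moves
a single Gaussian coordinate Z of variance v = ‖G‖² by v and leaves the part independent of Z
unchanged, so the one-dimensional bound applies fibrewise. -/
lemma measure_shift_le_of_finset (hB : ∀ t, Measurable (B t)) (hP : IsPreBrownianReal B P)
    (he : ∀ s t, inner ℝ (e s) (e t) = ((min s t : ℝ≥0) : ℝ)) {h : E} (hh : ‖h‖ ^ 2 ≤ 1 / 10)
    (I : Finset ℝ≥0) {S : Set (I → ℝ)} (hS : MeasurableSet S) :
    P {ω | (fun t : I => B t ω + inner ℝ (e t) h) ∈ S}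
      ≤ 1 / 4 + 10 / 9 * P {ω | (fun t : I => B t ω) ∈ S} := by
  have hprob := hP.isGaussianProcess.isProbabilityMeasure
  set K : Submodule ℝ E := Submodule.span ℝ (e '' (I : Set ℝ≥0)) with hK
  have hfin : FiniteDimensional ℝ K := FiniteDimensional.span_of_finite ℝ (I.finite_toSet.image e)
  set G := K.starProjection h with hG
  have hGK : G ∈ K := K.starProjection_apply_mem h
  obtain ⟨c, -, hc⟩ := (Finsupp.mem_span_image_iff_linearCombination ℝ).1 hGK
  have hin : ∀ t : I, inner ℝ (e t) h = inner ℝ (e t) G := by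
    intro t
    have ht : e t ∈ K := Submodule.subset_span ⟨t, t.2, rfl⟩
    have := K.starProjection_inner_eq_zero h (e t) ht
    rw [inner_sub_left, sub_eq_zero] at this
    rw [real_inner_comm, this, real_inner_comm]
  have hGn : ‖G‖ ^ 2 ≤ 1 / 10 := by
    have : ‖G‖ ≤ ‖h‖ := K.norm_starProjection_apply_le h
    exact (pow_le_pow_left₀ (norm_nonneg _) this 2).trans hh
  have hcc : cov[noise B c, noise B c; P] = ‖G‖ ^ 2 := by
    rw [cov_noise_eq_inner hP he, hc, real_inner_self_eq_norm_sq]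
  have hct : ∀ t, cov[noise B (Finsupp.single t 1), noise B c; P] = inner ℝ (e t) G := by
    intro t
    rw [cov_noise_eq_inner hP he, hc]
    simp
  rcases eq_or_ne G 0 with h0 | h0
  · simp only [hin, h0, inner_zero_right, add_zero]
    calc P {ω | (fun t : I => B t ω) ∈ S} = 1 * P {ω | (fun t : I => B t ω) ∈ S} := (one_mul _).symm
      _ ≤ 10 / 9 * P {ω | (fun t : I => B t ω) ∈ S} := by
          gcongr
          rw [ENNReal.le_div_iff_mul_le (by norm_num) (by norm_num)]
          norm_num
      _ ≤ _ := le_add_self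
  set v : ℝ≥0 := (‖G‖ ^ 2).toNNReal with hv
  have hvG : (v : ℝ) = ‖G‖ ^ 2 := Real.coe_toNNReal _ (by positivity)
  have hv0 : v ≠ 0 := by
    rw [← NNReal.coe_ne_zero, hvG]; positivity
  have hv1 : v ≤ 1 / 10 := by rw [← NNReal.coe_le_coe, hvG]; exact_mod_cast hGn
  have hZ : HasLaw (noise B c) (gaussianReal 0 v) P := by
    have := hasLaw_noise hP c
    rwa [hcc] at this
  -- The regression residual of B_t on Z = `noise B c`; it is uncorrelated with Z because cov(B_t,
  -- Z) = ⟨e_t, G⟩ and Var Z = v.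
  set r : I → ℝ≥0 →₀ ℝ := fun t => Finsupp.single (t : ℝ≥0) 1 - (inner ℝ (e t) G / v) • c with hr
  set R : Ω → I → ℝ := fun ω t => noise B (r t) ω with hR
  have hRm : Measurable R := measurable_pi_lambda _ fun t => measurable_noise hB _
  have hZm : Measurable (noise B c) := measurable_noise hB c
  have hind : IndepFun R (noise B c) P := by
    have h1 := indepFun_noise hB hP r (fun _ : Unit => c) fun t _ => by
      rw [hr, cov_noise_sub_left hP, cov_noise_smul_left, hct, hcc, ← hvG]
      field_simp
      ring
    exact h1.comp (φ := id) (ψ := fun z : Unit → ℝ => z ()) measurable_id (measurable_pi_apply _)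
  have hdec : ∀ (t : I) ω, B t ω = R ω t + inner ℝ (e t) G / v * noise B c ω := by
    intro t ω
    change _ = noise B (Finsupp.single (t : ℝ≥0) 1 - (inner ℝ (e t) G / v) • c) ω + _
    rw [map_sub, map_smul, noise_single]
    simp
  set A : Set ((I → ℝ) × ℝ) := {p | (fun t : I => p.1 t + inner ℝ (e t) G / v * p.2) ∈ S} with hA
  have hAm : MeasurableSet A := by
    refine measurableSet_preimage (f := fun p : (I → ℝ) × ℝ =>
      (fun t : I => p.1 t + inner ℝ (e t) G / v * p.2)) ?_ hS
    exact measurable_pi_lambda _ fun t => by fun_prop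
  have e1 : {ω | (fun t : I => B t ω) ∈ S} = (fun ω => (R ω, noise B c ω)) ⁻¹' A := by
    ext ω
    simp only [hA, mem_ofPred_eq, mem_preimage]
    simp_rw [← hdec]
  have e2 : {ω | (fun t : I => B t ω + inner ℝ (e t) h) ∈ S}
      = (fun ω => (R ω, noise B c ω + v)) ⁻¹' A := by
    ext ω
    simp only [hA, mem_ofPred_eq, mem_preimage]
    have : ∀ t : I, R ω t + inner ℝ (e t) G / v * (noise B c ω + v) = B t ω + inner ℝ (e t) h := by
      intro t
      rw [hdec, hin]
      have : (v : ℝ) ≠ 0 := by exact_mod_cast hv0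
      field_simp
      ring
    simp_rw [this]
  have m1 : P.map (fun ω => (R ω, noise B c ω)) = (P.map R).prod (gaussianReal 0 v) := by
    rw [(indepFun_iff_map_prod_eq_prod_map_map hRm.aemeasurable hZm.aemeasurable).1 hind, hZ.map_eq]
  have m2 : P.map (fun ω => (R ω, noise B c ω + v)) = (P.map R).prod (gaussianReal v v) := by
    have hi2 : IndepFun R (fun ω => noise B c ω + v) P :=
      hind.comp (φ := id) (ψ := fun z : ℝ => z + v) measurable_id (by fun_prop)
    have h2 := gaussianReal_add_const hZ (v : ℝ)
    rw [zero_add] at h2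
    rw [(indepFun_iff_map_prod_eq_prod_map_map hRm.aemeasurable
      (hZm.add_const _).aemeasurable).1 hi2, h2.map_eq]
  have hRp : IsProbabilityMeasure (P.map R) := Measure.isProbabilityMeasure_map hRm.aemeasurable
  rw [e1, e2, ← Measure.map_apply (hRm.prodMk hZm) hAm,
    ← Measure.map_apply (hRm.prodMk (hZm.add_const _)) hAm, m1, m2, Measure.prod_apply hAm,
    Measure.prod_apply hAm]
  calc ∫⁻ x, gaussianReal v v (Prod.mk x ⁻¹' A) ∂P.map R
      ≤ ∫⁻ x, (1 / 4 + 10 / 9 * gaussianReal 0 v (Prod.mk x ⁻¹' A)) ∂P.map R :=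
        lintegral_mono fun x => gaussianReal_shift_le hv0 hv1 _
    _ = 1 / 4 + 10 / 9 * ∫⁻ x, gaussianReal 0 v (Prod.mk x ⁻¹' A) ∂P.map R := by
        rw [lintegral_add_left measurable_const, lintegral_const_mul _
          (measurable_measure_prodMk_left hAm)]
        simp

/-- The bound passes from cylinders to all measurable sets by approximation in symmetric difference.
-/
lemma measure_shift_le (hB : ∀ t, Measurable (B t)) (hP : IsPreBrownianReal B P)
    (he : ∀ s t, inner ℝ (e s) (e t) = ((min s t : ℝ≥0) : ℝ)) {h : E} (hh : ‖h‖ ^ 2 ≤ 1 / 10)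
    {S : Set (ℝ≥0 → ℝ)} (hS : MeasurableSet S) :
    P {ω | (fun t => B t ω + inner ℝ (e t) h) ∈ S}
      ≤ 1 / 4 + 10 / 9 * P {ω | (fun t => B t ω) ∈ S} := by
  have hprob := hP.isGaussianProcess.isProbabilityMeasure
  have hm1 : Measurable fun ω t => B t ω := measurable_pi_lambda _ hB
  have hm2 : Measurable fun ω t => B t ω + inner ℝ (e t) h :=
    measurable_pi_lambda _ fun t => (hB t).add_const _
  set μ := P.map fun ω t => B t ω with hμ
  set ν := P.map fun ω t => B t ω + inner ℝ (e t) h with hν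
  have hμp : IsProbabilityMeasure μ := Measure.isProbabilityMeasure_map hm1.aemeasurable
  have hνp : IsProbabilityMeasure ν := Measure.isProbabilityMeasure_map hm2.aemeasurable
  have hcyl : ∀ T ∈ measurableCylinders (fun _ : ℝ≥0 => ℝ), ν T ≤ 1 / 4 + 10 / 9 * μ T := by
    intro T hT
    have hTm : MeasurableSet T := MeasurableSet.of_mem_measurableCylinders hT
    obtain ⟨I, S', hS', rfl⟩ := (mem_measurableCylinders T).1 hT
    rw [hν, hμ, Measure.map_apply hm2 hTm, Measure.map_apply hm1 hTm]
    exact measure_shift_le_of_finset hB hP he hh I hS'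
  have hmain : ν S ≤ 1 / 4 + 10 / 9 * μ S := by
    have h109 : (10 / 9 : ℝ≥0∞) ≠ ∞ := ENNReal.div_ne_top (by norm_num) (by norm_num)
    refine ENNReal.le_of_forall_pos_le_add fun ε hε _ => ?_
    -- The approximation is made for the sum μ + ν, so that one cylinder is close to S under both
    -- laws.
    obtain ⟨T, hT, hTS⟩ := exists_measure_symmDiff_lt_of_generateFrom_isSetRing (μ := μ + ν)
      isSetRing_measurableCylinders
      ⟨{univ}, by simp, by simpa using univ_mem_measurableCylinders (fun _ : ℝ≥0 => ℝ), by simp⟩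
      generateFrom_measurableCylinders.symm hS
      (ε := ENNReal.ofReal (ε / 4)) (by simpa using hε)
    have hdμ : μ (symmDiff T S) ≤ ENNReal.ofReal (ε / 4) :=
      (Measure.le_iff'.1 (Measure.le_add_right le_rfl) _).trans hTS.le
    have hdν : ν (symmDiff T S) ≤ ENNReal.ofReal (ε / 4) :=
      (Measure.le_iff'.1 (Measure.le_add_left le_rfl) _).trans hTS.le
    have h1 : ν S ≤ ν T + ENNReal.ofReal (ε / 4) := by
      calc ν S ≤ ν (T ∪ symmDiff T S) := measure_mono (by
            intro x hx
            by_cases hxT : x ∈ T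
            · exact Or.inl hxT
            · exact Or.inr (Or.inr ⟨hx, hxT⟩))
        _ ≤ ν T + ν (symmDiff T S) := measure_union_le _ _
        _ ≤ _ := by gcongr
    have h2 : μ T ≤ μ S + ENNReal.ofReal (ε / 4) := by
      calc μ T ≤ μ (S ∪ symmDiff T S) := measure_mono (by
            intro x hx
            by_cases hxS : x ∈ S
            · exact Or.inl hxS
            · exact Or.inr (Or.inl ⟨hx, hxS⟩))
        _ ≤ μ S + μ (symmDiff T S) := measure_union_le _ _
        _ ≤ _ := by gcongr
    have h3 : (10 / 9 : ℝ≥0∞) = ENNReal.ofReal (10 / 9) := by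
      rw [ENNReal.ofReal_div_of_pos (by norm_num)]; norm_num
    calc ν S ≤ ν T + ENNReal.ofReal (ε / 4) := h1
      _ ≤ (1 / 4 + 10 / 9 * (μ S + ENNReal.ofReal (ε / 4))) + ENNReal.ofReal (ε / 4) := by
          gcongr
          exact (hcyl T hT).trans (by gcongr)
      _ = 1 / 4 + 10 / 9 * μ S + (10 / 9 * ENNReal.ofReal (ε / 4) + ENNReal.ofReal (ε / 4)) := by
          ring
      _ ≤ 1 / 4 + 10 / 9 * μ S + ε := by
          gcongr
          have hε0 : (0 : ℝ) ≤ ε := ε.2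
          rw [h3, ← ENNReal.ofReal_mul (by norm_num), ← ENNReal.ofReal_add (by positivity)
            (by positivity), ← ENNReal.ofReal_coe_nnreal]
          exact ENNReal.ofReal_le_ofReal (by linarith)
  rw [hν, hμ, Measure.map_apply hm2 hS, Measure.map_apply hm1 hS] at hmain
  exact hmain

end Shift

/-! ### The two-point lower bound -/

section TwoPoint

variable {Ω : Type*} {mΩ : MeasurableSpace Ω} {P : Measure Ω} {B : ℝ≥0 → Ω → ℝ}

/-- The indicator function of `(-1/2, t - 1/2]` as an element of `L²(ℝ)`. -/
def stepL2 (t : ℝ≥0) : Lp ℝ 2 (volume : Measure ℝ) :=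
  indicatorConstLp 2 (measurableSet_Ioc : MeasurableSet (Ioc (-(1 / 2) : ℝ) (t - 1 / 2)))
    measure_Ioc_lt_top.ne 1

lemma inner_stepL2 (s t : ℝ≥0) : inner ℝ (stepL2 s) (stepL2 t) = ((min s t : ℝ≥0) : ℝ) := by
  rw [stepL2, stepL2, L2.real_inner_indicatorConstLp_one_indicatorConstLp_one measurableSet_Ioc
    measurableSet_Ioc measure_Ioc_lt_top.ne measure_Ioc_lt_top.ne, Ioc_inter_Ioc,
    max_self, min_sub_sub_right, Real.volume_real_Ioc_of_le, NNReal.coe_min]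
  · ring
  · have : (0 : ℝ) ≤ min (s : ℝ) t := le_min s.2 t.2
    linarith

/-- Changing g to f translates the Brownian motion by t ↦ ⟨`stepL2 t`, √n (f - g)⟩ in L², a shift of
squared norm n ∫ (f - g)² ≤ n A² (2w). -/
lemma measure_whiteNoise_le (hB : ∀ t, Measurable (B t)) (hP : IsPreBrownianReal B P) {n : ℝ}
    (hn : 0 < n) {f g : ℝ → ℝ} (hf : Continuous f) (hg : Continuous g) {A w : ℝ}
    (hw : 0 ≤ w) (hA : ∀ x, |f x - g x| ≤ A) (hfg : ∀ x, w < |x| → f x = g x)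
    (hs : n * (A ^ 2 * (2 * w)) ≤ 1 / 10) {S : Set Path} (hS : MeasurableSet S) :
    P {ω | whiteNoise n B f ω ∈ S} ≤ 1 / 4 + 10 / 9 * P {ω | whiteNoise n B g ω ∈ S} := by
  set k : ℝ → ℝ := fun x => Real.sqrt n * (f x - g x) with hk
  have hkc : Continuous k := by fun_prop
  have hks : HasCompactSupport k := by
    refine HasCompactSupport.intro (isCompact_Icc (a := -w) (b := w)) fun x hx => ?_
    have : w < |x| := by
      by_contra! hcon
      exact hx (abs_le.1 hcon)
    simp [hk, hfg x this]
  have hkL : MemLp k 2 volume := hkc.memLp_of_hasCompactSupport hks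
  set h : Lp ℝ 2 (volume : Measure ℝ) := hkL.toLp k
  have hsn : 0 < Real.sqrt n := Real.sqrt_pos.2 hn
  have hh : ‖h‖ ^ 2 ≤ 1 / 10 := by
    rw [← real_inner_self_eq_norm_sq, L2.inner_def]
    have h1 : ∫ x, inner ℝ (h x) (h x) = ∫ x, k x ^ 2 := by
      refine integral_congr_ae ?_
      filter_upwards [hkL.coeFn_toLp] with x hx
      rw [hx]
      simp [pow_two]
    have h2 : ∫ x, k x ^ 2 ≤ ∫ x, (Icc (-w) w).indicator (fun _ => n * A ^ 2) x := by
      refine integral_mono_of_nonneg (ae_of_all _ fun x => by positivity)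
        ((integrable_indicator_iff measurableSet_Icc).2
          continuousOn_const.integrableOn_Icc) (ae_of_all _ fun x => ?_)
      by_cases hx : x ∈ Icc (-w) w
      · simp only [hx, indicator_of_mem, hk]
        rw [mul_pow, Real.sq_sqrt hn.le]
        refine mul_le_mul_of_nonneg_left ?_ hn.le
        rw [← sq_abs]
        exact pow_le_pow_left₀ (abs_nonneg _) (hA x) 2
      · have : w < |x| := by
          by_contra! hcon
          exact hx (abs_le.1 hcon)
        simp [hk, hfg x this, hx]
    rw [h1]
    refine h2.trans (le_trans (le_of_eq ?_) hs)
    rw [integral_indicator measurableSet_Icc, setIntegral_const, Real.volume_real_Icc_of_le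
      (by linarith)]
    simp only [smul_eq_mul]
    ring
  set Φ : (ℝ≥0 → ℝ) → Path := fun b t => (∫ s in (-(1 / 2) : ℝ)..(t : ℝ), g s) +
    (Real.sqrt n)⁻¹ * b ⟨(t : ℝ) + 1 / 2, by have := t.2.1; linarith⟩ with hΦ
  have hΦm : Measurable Φ := measurable_pi_lambda _ fun t =>
    measurable_const.add ((measurable_pi_apply _).const_mul _)
  have hin : ∀ t : ℝ≥0, inner ℝ (stepL2 t) h
      = Real.sqrt n * ((∫ s in (-(1 / 2) : ℝ)..((t : ℝ) - 1 / 2), f s)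
        - ∫ s in (-(1 / 2) : ℝ)..((t : ℝ) - 1 / 2), g s) := by
    intro t
    rw [stepL2, L2.inner_indicatorConstLp_one, setIntegral_congr_ae (g := k) measurableSet_Ioc
      (hkL.coeFn_toLp.mono fun x hx _ => hx), ← intervalIntegral.integral_of_le
      (by have : (0 : ℝ) ≤ t := t.2; linarith), hk, intervalIntegral.integral_const_mul,
      intervalIntegral.integral_sub (hf.intervalIntegrable _ _) (hg.intervalIntegrable _ _)]
  have e1 : ∀ ω, whiteNoise n B f ω = Φ fun t => B t ω + inner ℝ (stepL2 t) h := by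
    intro ω
    ext t
    set τ : ℝ≥0 := ⟨(t : ℝ) + 1 / 2, by have := t.2.1; linarith⟩ with hτ
    have hτ1 : (τ : ℝ) - 1 / 2 = t := by
      change (t : ℝ) + 1 / 2 - 1 / 2 = t
      ring
    have h5 := hin τ
    rw [hτ1] at h5
    change (∫ s in (-(1 / 2) : ℝ)..(t : ℝ), f s) + (Real.sqrt n)⁻¹ * B τ ω
      = (∫ s in (-(1 / 2) : ℝ)..(t : ℝ), g s) + (Real.sqrt n)⁻¹ * (B τ ω + inner ℝ (stepL2 τ) h)
    rw [h5]
    field_simp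
    ring
  have e2 : ∀ ω, whiteNoise n B g ω = Φ fun t => B t ω := fun ω => rfl
  simp_rw [e1, e2]
  exact measure_shift_le hB hP inner_stepL2 hh (hΦm hS)

/-- Under f the interval misses f(0) with probability at most 1/5, and misses g(0) with probability
at most 1/4 + (10/9)(1/5) = 17/36. With probability at least 1/4 it contains both points and is as
long as their distance. -/
lemma le_minimaxLength (hB : ∀ t, Measurable (B t)) (hP : IsPreBrownianReal B P) {n : ℝ}
    (hn : 0 < n) {f g : ℝ → ℝ} (hf : Continuous f) (hg : Continuous g) {A w : ℝ}
    (hw : 0 ≤ w) (hA : ∀ x, |f x - g x| ≤ A) (hfg : ∀ x, w < |x| → f x = g x)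
    (hs : n * (A ^ 2 * (2 * w)) ≤ 1 / 10) {α : ℝ} (hα : α ≤ 1 / 5) {F : Set (ℝ → ℝ)}
    (hfF : f ∈ F) (hgF : g ∈ F) :
    ENNReal.ofReal (|f 0 - g 0| / 4) ≤ minimaxLength P B n α F := by
  have hprob := hP.isGaussianProcess.isProbabilityMeasure
  refine le_iInf₂ fun CI hCI => ?_
  obtain ⟨hl, hu, hcov⟩ := hCI
  have hmeas : ∀ a : ℝ, MeasurableSet {y | a ∈ CI.toSet y} := fun a =>
    (measurableSet_le hl measurable_const).inter (measurableSet_le measurable_const hu)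
  have hmiss : ∀ k ∈ F, P {ω | k 0 ∉ CI.toSet (whiteNoise n B k ω)} ≤ ENNReal.ofReal (1 / 5) := by
    intro k hk
    have h1 : {ω | k 0 ∉ CI.toSet (whiteNoise n B k ω)}
        = {ω | k 0 ∈ CI.toSet (whiteNoise n B k ω)}ᶜ := rfl
    have h2 : MeasurableSet {ω | k 0 ∈ CI.toSet (whiteNoise n B k ω)} :=
      measurable_whiteNoise n hB k (hmeas (k 0))
    rw [h1, prob_compl_eq_one_sub h2]
    refine tsub_le_iff_right.2 ?_
    calc (1 : ℝ≥0∞) = ENNReal.ofReal (1 / 5 + 4 / 5) := by norm_num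
      _ = ENNReal.ofReal (1 / 5) + ENNReal.ofReal (4 / 5) :=
          ENNReal.ofReal_add (by norm_num) (by norm_num)
      _ ≤ ENNReal.ofReal (1 / 5) + ENNReal.ofReal (1 - α) := by gcongr; linarith
      _ ≤ _ := by gcongr; exact hcov k hk
  have hmg : P {ω | g 0 ∉ CI.toSet (whiteNoise n B f ω)} ≤ ENNReal.ofReal (17 / 36) := by
    refine (measure_whiteNoise_le hB hP hn hf hg hw hA hfg hs (S := {y | g 0 ∉ CI.toSet y})
      (hmeas (g 0)).compl).trans ?_
    have h3 : (10 / 9 : ℝ≥0∞) = ENNReal.ofReal (10 / 9) := by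
      rw [ENNReal.ofReal_div_of_pos (by norm_num)]; norm_num
    have h4 : (1 / 4 : ℝ≥0∞) = ENNReal.ofReal (1 / 4) := by
      rw [ENNReal.ofReal_div_of_pos (by norm_num)]; norm_num
    calc 1 / 4 + 10 / 9 * P {ω | whiteNoise n B g ω ∈ {y | g 0 ∉ CI.toSet y}}
        ≤ ENNReal.ofReal (1 / 4) + ENNReal.ofReal (10 / 9) * ENNReal.ofReal (1 / 5) := by
          rw [h3, h4]
          gcongr
          exact hmiss g hgF
      _ = ENNReal.ofReal (17 / 36) := by
          rw [← ENNReal.ofReal_mul (by norm_num), ← ENNReal.ofReal_add (by norm_num) (by norm_num)]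
          norm_num
  set good := {ω | f 0 ∈ CI.toSet (whiteNoise n B f ω)} ∩ {ω | g 0 ∈ CI.toSet (whiteNoise n B f ω)}
    with hgood
  have hgm : MeasurableSet good :=
    (measurable_whiteNoise n hB f (hmeas (f 0))).inter (measurable_whiteNoise n hB f (hmeas (g 0)))
  have hPg : ENNReal.ofReal (1 / 4) ≤ P good := by
    have h1 : P goodᶜ ≤ ENNReal.ofReal (3 / 4) := by
      rw [hgood, compl_inter]
      calc _ ≤ P {ω | f 0 ∉ CI.toSet (whiteNoise n B f ω)}
            + P {ω | g 0 ∉ CI.toSet (whiteNoise n B f ω)} := measure_union_le _ _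
        _ ≤ ENNReal.ofReal (1 / 5) + ENNReal.ofReal (17 / 36) := by gcongr; exact hmiss f hfF
        _ = ENNReal.ofReal (1 / 5 + 17 / 36) :=
            (ENNReal.ofReal_add (by norm_num) (by norm_num)).symm
        _ ≤ _ := ENNReal.ofReal_le_ofReal (by norm_num)
    rw [prob_compl_eq_one_sub hgm, tsub_le_iff_right] at h1
    have h2 : ENNReal.ofReal (3 / 4) + ENNReal.ofReal (1 / 4) = 1 := by
      rw [← ENNReal.ofReal_add (by norm_num) (by norm_num)]; norm_num
    rw [← h2] at h1
    exact (ENNReal.add_le_add_iff_left ENNReal.ofReal_ne_top).1 h1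
  calc ENNReal.ofReal (|f 0 - g 0| / 4) = ENNReal.ofReal |f 0 - g 0| * ENNReal.ofReal (1 / 4) := by
        rw [← ENNReal.ofReal_mul (abs_nonneg _)]; congr 1; ring
    _ ≤ ENNReal.ofReal |f 0 - g 0| * P good := by gcongr
    _ = ∫⁻ _ in good, ENNReal.ofReal |f 0 - g 0| ∂P := by rw [setLIntegral_const]
    _ ≤ ∫⁻ ω in good, CI.length (whiteNoise n B f ω) ∂P := by
        refine setLIntegral_mono' hgm fun ω hω => ENNReal.ofReal_le_ofReal ?_
        obtain ⟨⟨h1, h2⟩, h3, h4⟩ := hω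
        rw [abs_le]
        constructor <;> linarith
    _ ≤ ∫⁻ ω, CI.length (whiteNoise n B f ω) ∂P := setLIntegral_le_lintegral _ _
    _ ≤ maxExpLength P B n CI F := le_iSup₂ (f := fun k _ => expLength P B n CI k) f hfF

end TwoPoint

/-! ### Lower bounds for the minimax length -/

/-- The minimax rate `M^{1/(1+2β)} n^{-β/(1+2β)}`. -/
def rate (β M n : ℝ) : ℝ := M ^ (1 / (1 + 2 * β)) * n ^ (-(β / (1 + 2 * β)))

/-- A perturbation of height M h^β and width h has squared signal-to-noise ratio of order n (M h^β)²
h. Fixing this at κ gives M h^β = κ^{β/(1+2β)} · rate, and κ ≤ 1 removes the exponent. -/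
lemma exists_bandwidth {β M n κ : ℝ} (hβ : 0 ≤ β) (hM : 0 < M) (hn : 0 < n) (hκ : 0 < κ)
    (hκ1 : κ ≤ 1) :
    ∃ h : ℝ, 0 < h ∧ n * (M * h ^ β) ^ 2 * h = κ ∧ κ * rate β M n ≤ M * h ^ β := by
  have hq : 0 < κ / (n * M ^ 2) := by positivity
  have hd : 0 < 1 + 2 * β := by linarith
  refine ⟨(κ / (n * M ^ 2)) ^ (1 / (1 + 2 * β)), by positivity, ?_, ?_⟩
  · set h := (κ / (n * M ^ 2)) ^ (1 / (1 + 2 * β)) with hh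
    have hh0 : 0 < h := by positivity
    have h1 : h ^ (1 + 2 * β) = κ / (n * M ^ 2) := by
      rw [hh, ← Real.rpow_mul hq.le, one_div, inv_mul_cancel₀ hd.ne', Real.rpow_one]
    have h2 : (h ^ β) ^ 2 * h = h ^ (1 + 2 * β) := by
      rw [Real.rpow_add hh0, Real.rpow_one, mul_comm 2 β, Real.rpow_mul hh0.le, Real.rpow_two]
      ring
    calc n * (M * h ^ β) ^ 2 * h = n * M ^ 2 * ((h ^ β) ^ 2 * h) := by ring
      _ = κ := by rw [h2, h1]; field_simp
  · have h1 : ((κ / (n * M ^ 2)) ^ (1 / (1 + 2 * β))) ^ β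
        = κ ^ (β / (1 + 2 * β)) * (n ^ (-(β / (1 + 2 * β))) * M ^ (-(2 * β / (1 + 2 * β)))) := by
      rw [← Real.rpow_mul hq.le, one_div_mul_eq_div, Real.div_rpow hκ.le (by positivity),
        Real.mul_rpow hn.le (by positivity), ← Real.rpow_two, ← Real.rpow_mul hM.le,
        Real.rpow_neg hn.le, Real.rpow_neg hM.le, mul_div_assoc, div_eq_mul_inv, mul_inv]
    have h2 : M * M ^ (-(2 * β / (1 + 2 * β))) = M ^ (1 / (1 + 2 * β)) := by
      nth_rewrite 1 [← Real.rpow_one M]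
      rw [← Real.rpow_add hM]
      congr 1
      field_simp
      ring
    have h3 : κ ≤ κ ^ (β / (1 + 2 * β)) := by
      nth_rewrite 1 [← Real.rpow_one κ]
      refine Real.rpow_le_rpow_of_exponent_ge hκ hκ1 ?_
      rw [div_le_one hd]; linarith
    rw [h1, rate]
    calc κ * (M ^ (1 / (1 + 2 * β)) * n ^ (-(β / (1 + 2 * β))))
        ≤ κ ^ (β / (1 + 2 * β)) * (M ^ (1 / (1 + 2 * β)) * n ^ (-(β / (1 + 2 * β)))) := by gcongr
      _ = _ := by rw [← h2]; ring

/-! ### Two-point pair for the monotone class: shifted ramps. -/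

section Monotone

/-- The truncation of `u` to `[0, 1]`. -/
def clip (u : ℝ) : ℝ := max 0 (min u 1)

lemma continuous_clip : Continuous clip := by unfold clip; fun_prop

lemma clip_mono : Monotone clip := fun _ _ h => max_le_max le_rfl (min_le_min h le_rfl)

lemma clip_nonneg (u : ℝ) : 0 ≤ clip u := le_max_left _ _

lemma clip_le_one (u : ℝ) : clip u ≤ 1 := max_le zero_le_one (min_le_right _ _)

lemma abs_clip_sub_le_one (u v : ℝ) : |clip u - clip v| ≤ 1 :=
  abs_le.2 ⟨by linarith [clip_nonneg u, clip_le_one v], by linarith [clip_nonneg v, clip_le_one u]⟩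

lemma abs_clip_sub_le (u v : ℝ) : |clip u - clip v| ≤ |u - v| := by
  have h : ∀ u v : ℝ, u ≤ v → clip v - clip u ≤ v - u := fun u v huv => by
    simp only [clip, max_def, min_def]
    split_ifs <;> linarith
  rcases le_total u v with huv | huv
  · rw [abs_sub_comm, abs_sub_comm u, abs_of_nonneg (sub_nonneg.2 (clip_mono huv)),
      abs_of_nonneg (sub_nonneg.2 huv)]
    exact h u v huv
  · rw [abs_of_nonneg (sub_nonneg.2 (clip_mono huv)), abs_of_nonneg (sub_nonneg.2 huv)]
    exact h v u huv

lemma clip_of_one_le {u : ℝ} (h : 1 ≤ u) : clip u = 1 := by simp [clip, h]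

lemma clip_of_nonpos {u : ℝ} (h : u ≤ 0) : clip u = 0 := by
  rw [clip, max_eq_left]
  exact (min_le_left _ _).trans h

lemma abs_clip_sub_le_rpow {β : ℝ} (hβ : 0 ≤ β) (hβ1 : β ≤ 1) (u v : ℝ) :
    |clip u - clip v| ≤ |u - v| ^ β := by
  rcases le_total 1 |u - v| with h | h
  · exact (abs_clip_sub_le_one u v).trans (Real.one_le_rpow h hβ)
  · refine (abs_clip_sub_le u v).trans ?_
    rcases eq_or_ne (u - v) 0 with h0 | h0
    · rw [h0, abs_zero]; positivity
    · nth_rewrite 1 [← Real.rpow_one |u - v|]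
      exact Real.rpow_le_rpow_of_exponent_ge (abs_pos.2 h0) h hβ1

lemma ramp_mem {β M h : ℝ} (hβ : 0 ≤ β) (hβ1 : β ≤ 1) (hM : 0 < M) (hh : 0 < h) (a : ℝ) :
    (fun x => M * h ^ β * clip (x / h + a)) ∈ monoClass ∩ lipClass β M := by
  constructor
  · intro x _ y _ hxy
    have : clip (x / h + a) ≤ clip (y / h + a) := clip_mono (by gcongr)
    simp only
    gcongr
  · rw [lipClass, mem_ofPred_eq, if_pos hβ1]
    intro x _ y _
    rw [← mul_sub, abs_mul, abs_of_pos (by positivity : 0 < M * h ^ β), mul_assoc]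
    gcongr
    calc h ^ β * |clip (y / h + a) - clip (x / h + a)|
        ≤ h ^ β * |y / h + a - (x / h + a)| ^ β := by
          gcongr
          exact abs_clip_sub_le_rpow hβ hβ1 _ _
      _ = |y - x| ^ β := by
          rw [← Real.mul_rpow hh.le (abs_nonneg _)]
          congr 1
          nth_rewrite 1 [← abs_of_pos hh]
          rw [← abs_mul]
          congr 1
          field_simp
          ring

lemma le_minimaxLength_mono {Ω : Type*} {mΩ : MeasurableSpace Ω} {P : Measure Ω}
    {B : ℝ≥0 → Ω → ℝ} (hB : ∀ t, Measurable (B t)) (hP : IsPreBrownianReal B P)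
    {n α β M : ℝ} (hn : 0 < n) (hα : α ≤ 1 / 5) (hβ : 0 ≤ β) (hβ1 : β ≤ 1) (hM : 0 < M) :
    ENNReal.ofReal (rate β M n / 80) ≤ minimaxLength P B n α (monoClass ∩ lipClass β M) := by
  -- The two ramps differ by at most A on [-h, h] and by exactly A at 0, so n A² (2h) = 2κ has to be
  -- at most 1/10.
  obtain ⟨h, hh, h1, h2⟩ := exists_bandwidth (κ := 1 / 20) hβ hM hn (by norm_num) (by norm_num)
  set A := M * h ^ β with hA
  have hA0 : 0 < A := by positivity
  have hmain := le_minimaxLength (α := α) hB hP hn (f := fun x => A * clip (x / h + 0))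
    (g := fun x => A * clip (x / h + 1)) (A := A) (w := h)
    (continuous_const.mul (continuous_clip.comp (by fun_prop)))
    (continuous_const.mul (continuous_clip.comp (by fun_prop))) hh.le
    (fun x => by
      rw [← mul_sub, abs_mul, abs_of_pos hA0]
      exact mul_le_of_le_one_right hA0.le (abs_clip_sub_le_one _ _))
    (fun x hx => by
      rcases lt_abs.1 hx with hx | hx
      · have : 1 ≤ x / h := by rw [le_div_iff₀ hh]; linarith
        rw [clip_of_one_le (by linarith), clip_of_one_le (by linarith)]
      · have : x / h ≤ -1 := by rw [div_le_iff₀ hh]; linarith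
        rw [clip_of_nonpos (by linarith), clip_of_nonpos (by linarith)])
    (by nlinarith) hα (ramp_mem hβ hβ1 hM hh 0) (ramp_mem hβ hβ1 hM hh 1)
  refine le_trans (ENNReal.ofReal_le_ofReal ?_) hmain
  simp only [zero_div, zero_add]
  rw [clip_of_nonpos le_rfl, clip_of_one_le le_rfl, mul_zero, mul_one, zero_sub, abs_neg,
    abs_of_pos hA0]
  linarith

end Monotone

/-! ### Two-point pair for the convex class: quadratic splines with equal tails. -/

section Convex

/-- The convex function `u ↦ (u⁺)² / 2`. -/
def halfSq (u : ℝ) : ℝ := (max u 0) ^ 2 / 2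

lemma halfSq_of_nonneg {u : ℝ} (h : 0 ≤ u) : halfSq u = u ^ 2 / 2 := by rw [halfSq, max_eq_left h]

lemma halfSq_of_nonpos {u : ℝ} (h : u ≤ 0) : halfSq u = 0 := by rw [halfSq, max_eq_right h]; simp

lemma halfSq_nonneg (u : ℝ) : 0 ≤ halfSq u := by unfold halfSq; positivity

lemma halfSq_le {u b : ℝ} (hb : 0 ≤ b) (h : u ≤ b) : halfSq u ≤ b ^ 2 / 2 := by
  unfold halfSq
  gcongr
  exact max_le h hb

lemma hasDerivAt_halfSq (u : ℝ) : HasDerivAt halfSq (max u 0) u := by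
  have hr : ∀ u : ℝ, 0 ≤ u → HasDerivWithinAt halfSq (max u 0) (Ici 0) u := fun u hu => by
    have h1 : HasDerivAt (fun x : ℝ => x ^ 2 / 2) u u := by
      have := (hasDerivAt_pow 2 u).div_const 2
      simpa using this
    rw [max_eq_left hu]
    exact h1.hasDerivWithinAt.congr (fun x hx => halfSq_of_nonneg hx) (halfSq_of_nonneg hu)
  have hl : ∀ u : ℝ, u ≤ 0 → HasDerivWithinAt halfSq (max u 0) (Iic 0) u := fun u hu => by
    rw [max_eq_right hu]
    exact (hasDerivWithinAt_const u _ (0 : ℝ)).congr (fun x hx => halfSq_of_nonpos hx)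
      (halfSq_of_nonpos hu)
  rcases lt_trichotomy u 0 with h | h | h
  · exact (hl u h.le).hasDerivAt (Iic_mem_nhds h)
  · have := (hl u h.le).union (hr u h.ge)
    rwa [Iic_union_Ici, hasDerivWithinAt_univ] at this
  · exact (hr u h.le).hasDerivAt (Ici_mem_nhds h)

/-- A derivative with Lipschitz constant A and sup bound Ah is (β-1)-Hölder by interpolation: A = M
(2h)^{β-2} makes both estimates yield the constant M, with |x - y| = 2h as the crossover. -/
lemma mem_convClass_inter_lipClass {f φ : ℝ → ℝ} {β M A h : ℝ} (hβ : 1 ≤ β) (hβ2 : β ≤ 2)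
    (hh : 0 < h) (hA : A = M * (2 * h) ^ (β - 2)) (hM : 0 < M)
    (hf : ∀ x, HasDerivAt f (φ x) x) (hφc : Continuous φ) (hφm : Monotone φ)
    (hφL : ∀ x y, x ≤ y → φ y - φ x ≤ A * (y - x)) (hφb : ∀ x, |φ x| ≤ A * h) :
    f ∈ convClass ∩ lipClass β M := by
  have hderiv : deriv f = φ := funext fun x => (hf x).deriv
  have hdiff : Differentiable ℝ f := fun x => (hf x).differentiableAt
  have hh2 : 0 < 2 * h := by linarith
  refine ⟨?_, ?_⟩
  · have : ConvexOn ℝ univ f := Monotone.convexOn_univ_of_deriv hdiff (by rwa [hderiv])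
    exact this.subset (subset_univ _) (convex_Icc _ _)
  · rw [lipClass, mem_ofPred_eq]
    split_ifs with h1
    · have hb : β = 1 := le_antisymm h1 hβ
      subst hb
      intro x _ y _
      rw [Real.rpow_one]
      have := Convex.norm_image_sub_le_of_norm_deriv_le (f := f) (C := M) (s := univ) (x := x)
        (y := y) (fun x _ => hdiff x) (fun x _ => by
          rw [hderiv, Real.norm_eq_abs]
          refine (hφb x).trans ?_
          rw [hA, show (1 - 2 : ℝ) = -1 by norm_num, Real.rpow_neg_one]
          field_simp
          linarith) convex_univ (mem_univ _) (mem_univ _)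
      simpa using this
    · have hb : 1 < β := not_le.1 h1
      have hfl : lowerFloor β = 1 := by
        have : ⌈β⌉₊ = 2 := by
          rw [Nat.ceil_eq_iff (by norm_num)]
          norm_num
          exact ⟨hb, hβ2⟩
        rw [lowerFloor, this]
      rw [hfl]
      have hC1 : ContDiff ℝ 1 f := contDiff_one_iff_deriv.2 ⟨hdiff, by rwa [hderiv]⟩
      refine ⟨by simpa using hC1.contDiffOn, fun x hx y hy => ?_⟩
      have hu : UniqueDiffOn ℝ unitInt := uniqueDiffOn_Icc (by norm_num)
      rw [iteratedDerivWithin_one,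
        (hf x).hasDerivWithinAt.derivWithin (hu x hx), (hf y).hasDerivWithinAt.derivWithin (hu y hy)]
      simp only [Nat.cast_one]
      have habs : |φ x - φ y| ≤ A * |x - y| := by
        rcases le_total x y with hxy | hxy
        · rw [abs_sub_comm, abs_sub_comm x, abs_of_nonneg (sub_nonneg.2 (hφm hxy)),
            abs_of_nonneg (sub_nonneg.2 hxy)]
          exact hφL x y hxy
        · rw [abs_of_nonneg (sub_nonneg.2 (hφm hxy)), abs_of_nonneg (sub_nonneg.2 hxy)]
          exact hφL y x hxy
      rcases eq_or_ne x y with rfl | hne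
      · simp only [sub_self, abs_zero]; positivity
      have hu0 : 0 < |x - y| := abs_pos.2 (sub_ne_zero.2 hne)
      rcases le_total |x - y| (2 * h) with hle | hle
      · refine habs.trans ?_
        have e1 : |x - y| = |x - y| ^ (2 - β) * |x - y| ^ (β - 1) := by
          rw [← Real.rpow_add hu0]; norm_num
        have e2 : (2 * h) ^ (β - 2) * (2 * h) ^ (2 - β) = 1 := by
          rw [← Real.rpow_add hh2]; norm_num
        calc A * |x - y| = A * (|x - y| ^ (2 - β) * |x - y| ^ (β - 1)) := by rw [← e1]
          _ ≤ A * ((2 * h) ^ (2 - β) * |x - y| ^ (β - 1)) := by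
              rw [hA]
              gcongr
          _ = M * ((2 * h) ^ (β - 2) * (2 * h) ^ (2 - β)) * |x - y| ^ (β - 1) := by rw [hA]; ring
          _ = M * |x - y| ^ (β - 1) := by rw [e2, mul_one]
      · calc |φ x - φ y| ≤ |φ x| + |φ y| := abs_sub _ _
          _ ≤ A * h + A * h := add_le_add (hφb x) (hφb y)
          _ = M * ((2 * h) ^ (β - 2) * (2 * h) ^ (1 : ℝ)) := by rw [hA, Real.rpow_one]; ring
          _ = M * (2 * h) ^ (β - 1) := by rw [← Real.rpow_add hh2]; congr 2; ring
          _ ≤ M * |x - y| ^ (β - 1) := by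
              gcongr

/-- The convex function with derivative `x` truncated to `[-h, h]`. -/
def huber (h x : ℝ) : ℝ := halfSq (x + h) - halfSq (x - h) - h * x

/-- A convex function that agrees with `huber h` outside `[-2h, 2h]` and is larger at `0`. -/
def huberFlat (h x : ℝ) : ℝ :=
  halfSq (x + 2 * h) - halfSq (x + h) + halfSq (x - h) - halfSq (x - 2 * h) - h * x

lemma huber_mem {β M A h : ℝ} (hβ : 1 ≤ β) (hβ2 : β ≤ 2)
    (hh : 0 < h) (hA : A = M * (2 * h) ^ (β - 2)) (hM : 0 < M) :
    (fun x => A * huber h x) ∈ convClass ∩ lipClass β M := by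
  have hA0 : 0 < A := by rw [hA]; positivity
  refine mem_convClass_inter_lipClass (φ := fun x => A * (max (x + h) 0 - max (x - h) 0 - h))
    hβ hβ2 hh hA hM (fun x => ?_) (by fun_prop) ?_ ?_ ?_
  · have h1 := (hasDerivAt_halfSq (x + h)).comp_add_const x h
    have h2 := (hasDerivAt_halfSq (x - h)).comp_sub_const x h
    have h3 : HasDerivAt (fun x => h * x) h x := by simpa using (hasDerivAt_id x).const_mul h
    exact ((h1.sub h2).sub h3).const_mul A
  · intro x y hxy
    exact mul_le_mul_of_nonneg_left (by simp only [max_def]; split_ifs <;> linarith) hA0.le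
  · intro x y hxy
    rw [← mul_sub]
    exact mul_le_mul_of_nonneg_left (by simp only [max_def]; split_ifs <;> linarith) hA0.le
  · intro x
    rw [abs_mul, abs_of_pos hA0]
    gcongr
    rw [abs_le]
    constructor <;> simp only [max_def] <;> split_ifs <;> linarith

lemma huberFlat_mem {β M A h : ℝ} (hβ : 1 ≤ β) (hβ2 : β ≤ 2)
    (hh : 0 < h) (hA : A = M * (2 * h) ^ (β - 2)) (hM : 0 < M) :
    (fun x => A * huberFlat h x) ∈ convClass ∩ lipClass β M := by
  have hA0 : 0 < A := by rw [hA]; positivity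
  refine mem_convClass_inter_lipClass (φ := fun x => A * (max (x + 2 * h) 0 - max (x + h) 0
    + max (x - h) 0 - max (x - 2 * h) 0 - h))
    hβ hβ2 hh hA hM (fun x => ?_) (by fun_prop) ?_ ?_ ?_
  · have h1 := (hasDerivAt_halfSq (x + 2 * h)).comp_add_const x (2 * h)
    have h2 := (hasDerivAt_halfSq (x + h)).comp_add_const x h
    have h3 := (hasDerivAt_halfSq (x - h)).comp_sub_const x h
    have h4 := (hasDerivAt_halfSq (x - 2 * h)).comp_sub_const x (2 * h)
    have h5 : HasDerivAt (fun x => h * x) h x := by simpa using (hasDerivAt_id x).const_mul h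
    exact ((((h1.sub h2).add h3).sub h4).sub h5).const_mul A
  · intro x y hxy
    exact mul_le_mul_of_nonneg_left (by simp only [max_def]; split_ifs <;> linarith) hA0.le
  · intro x y hxy
    rw [← mul_sub]
    exact mul_le_mul_of_nonneg_left (by simp only [max_def]; split_ifs <;> linarith) hA0.le
  · intro x
    rw [abs_mul, abs_of_pos hA0]
    gcongr
    rw [abs_le]
    constructor <;> simp only [max_def] <;> split_ifs <;> linarith

/-- The derivative of `huberFlat h` vanishes on [-h, h] and climbs to ±h on h ≤ |x| ≤ 2h. Its
difference from the derivative of `huber h` is odd and supported in [-2h, 2h], so it integrates to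
zero. -/
lemma huber_eq_huberFlat {h x : ℝ} (hh : 0 < h) (hx : 2 * h < |x|) : huber h x = huberFlat h x := by
  unfold huber huberFlat
  rcases lt_abs.1 hx with hx | hx
  · rw [halfSq_of_nonneg (by linarith), halfSq_of_nonneg (by linarith),
      halfSq_of_nonneg (by linarith), halfSq_of_nonneg (by linarith)]
    ring
  · rw [halfSq_of_nonpos (by linarith), halfSq_of_nonpos (by linarith),
      halfSq_of_nonpos (by linarith), halfSq_of_nonpos (by linarith)]
    ring

lemma abs_huber_sub_le {h : ℝ} (hh : 0 < h) (x : ℝ) :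
    |huber h x - huberFlat h x| ≤ 24 * h ^ 2 := by
  rcases lt_or_ge (2 * h) |x| with hx | hx
  · rw [huber_eq_huberFlat hh hx, sub_self, abs_zero]; positivity
  obtain ⟨h1, h2⟩ := abs_le.1 hx
  unfold huber huberFlat
  have hb : ∀ u, u ≤ 4 * h → halfSq u ≤ 8 * h ^ 2 := fun u hu =>
    (halfSq_le (by linarith) hu).trans (by nlinarith)
  have a1 := hb (x + 2 * h) (by linarith)
  have a2 := hb (x + h) (by linarith)
  have a3 := hb (x - h) (by linarith)
  have a4 := hb (x - 2 * h) (by linarith)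
  have b1 := halfSq_nonneg (x + 2 * h)
  have b2 := halfSq_nonneg (x + h)
  have b3 := halfSq_nonneg (x - h)
  have b4 := halfSq_nonneg (x - 2 * h)
  rw [abs_le]
  constructor <;> linarith

lemma le_minimaxLength_conv {Ω : Type*} {mΩ : MeasurableSpace Ω} {P : Measure Ω}
    {B : ℝ≥0 → Ω → ℝ} (hB : ∀ t, Measurable (B t)) (hP : IsPreBrownianReal B P)
    {n α β M : ℝ} (hn : 0 < n) (hα : α ≤ 1 / 5) (hβ : 1 ≤ β) (hβ2 : β ≤ 2) (hM : 0 < M) :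
    ENNReal.ofReal (rate β M n / 400000) ≤ minimaxLength P B n α (convClass ∩ lipClass β M) := by
  -- The sup difference 24 A h² on a window of length 4h, with A h² ≤ M h^β, gives energy at most
  -- 24² · 4 κ = 2304 κ, which is below 1/10. The gap at 0 is A h² ≥ M h^β / 4.
  obtain ⟨h, hh, h1, h2⟩ := exists_bandwidth (β := β) (κ := 1 / 25000) (by linarith) hM hn
    (by norm_num) (by norm_num)
  set A := M * (2 * h) ^ (β - 2) with hA
  have hA0 : 0 < A := by positivity
  have hAh : A * h ^ 2 = M * h ^ β * 2 ^ (β - 2) := by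
    rw [hA, Real.mul_rpow (by norm_num) hh.le]
    have : h ^ (β - 2) * h ^ 2 = h ^ β := by
      rw [← Real.rpow_two, ← Real.rpow_add hh]; norm_num
    rw [← this]; ring
  have hp1 : (2 : ℝ) ^ (β - 2) ≤ 1 := Real.rpow_le_one_of_one_le_of_nonpos (by norm_num) (by linarith)
  have hp2 : (1 / 4 : ℝ) ≤ 2 ^ (β - 2) := by
    have : (2 : ℝ) ^ (-2 : ℝ) ≤ 2 ^ (β - 2) :=
      Real.rpow_le_rpow_of_exponent_le (by norm_num) (by linarith)
    refine le_trans (le_of_eq ?_) this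
    rw [Real.rpow_neg (by norm_num), Real.rpow_two]; norm_num
  have hD0 : 0 < M * h ^ β := by positivity
  have hu : A * h ^ 2 ≤ M * h ^ β := by rw [hAh]; exact mul_le_of_le_one_right hD0.le hp1
  have hl : M * h ^ β / 4 ≤ A * h ^ 2 := by rw [hAh]; nlinarith
  have hcont : Continuous halfSq :=
    continuous_iff_continuousAt.2 fun u => (hasDerivAt_halfSq u).continuousAt
  have hc1 : Continuous (huber h) := by
    unfold huber
    fun_prop
  have hc2 : Continuous (huberFlat h) := by
    unfold huberFlat
    fun_prop
  have hmain := le_minimaxLength (α := α) hB hP hn (f := fun x => A * huber h x)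
    (g := fun x => A * huberFlat h x) (A := 24 * (A * h ^ 2)) (w := 2 * h)
    (by fun_prop) (by fun_prop) (by linarith)
    (fun x => by
      rw [← mul_sub, abs_mul, abs_of_pos hA0]
      calc A * |huber h x - huberFlat h x| ≤ A * (24 * h ^ 2) := by
            gcongr
            exact abs_huber_sub_le hh x
        _ = _ := by ring)
    (fun x hx => by rw [huber_eq_huberFlat hh hx])
    (by
      have h3 : (A * h ^ 2) ^ 2 ≤ (M * h ^ β) ^ 2 := by gcongr
      have h4 : n * (A * h ^ 2) ^ 2 * h ≤ n * (M * h ^ β) ^ 2 * h := by gcongr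
      rw [h1] at h4
      linarith) hα (huber_mem hβ hβ2 hh hA hM) (huberFlat_mem hβ hβ2 hh hA hM)
  refine le_trans (ENNReal.ofReal_le_ofReal ?_) hmain
  have h0 : A * huber h 0 - A * huberFlat h 0 = -(A * h ^ 2) := by
    unfold huber huberFlat
    rw [halfSq_of_nonneg (u := 0 + h) (by linarith), halfSq_of_nonneg (u := 0 + 2 * h) (by linarith),
      halfSq_of_nonpos (u := 0 - h) (by linarith), halfSq_of_nonpos (u := 0 - 2 * h) (by linarith)]
    ring
  rw [h0, abs_neg, abs_of_pos (by positivity)]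
  linarith

end Convex

/-! ### The scales `σ_j` -/

section Scales

lemma sig_pos {n : ℝ} (hn : 0 < n) (j : ℕ) : 0 < sig n j := Real.sqrt_pos.2 (by positivity)

lemma sig_sq {n : ℝ} (hn : 0 ≤ n) (j : ℕ) : sig n j ^ 2 = 2 ^ ((j : ℤ) - 1) / n :=
  Real.sq_sqrt (div_nonneg (by positivity) hn)

lemma sig_succ {n : ℝ} (hn : 0 < n) (j : ℕ) : sig n (j + 1) = Real.sqrt 2 * sig n j := by
  rw [sig, sig, ← Real.sqrt_mul (by norm_num)]
  congr 1
  rw [show (((j + 1 : ℕ) : ℤ) - 1) = ((j : ℤ) - 1) + 1 by push_cast; ring,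
    zpow_add₀ (by norm_num), zpow_one]
  ring

lemma sqrt_two_bounds : 7 / 5 ≤ Real.sqrt 2 ∧ Real.sqrt 2 ≤ 3 / 2 :=
  ⟨Real.le_sqrt_of_sq_le (by norm_num), Real.sqrt_le_iff.2 ⟨by norm_num, by norm_num⟩⟩

lemma sig_mono {n : ℝ} (hn : 0 < n) : Monotone (sig n) := monotone_nat_of_le_succ fun j => by
  rw [sig_succ hn]
  nlinarith [sqrt_two_bounds.1, sig_pos hn j]

lemma dy_pos (j : ℕ) : 0 < dy j := by unfold dy; positivity

lemma two_pow_mul_dy (j : ℕ) : (2 : ℝ) ^ j * dy j = 1 := by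
  rw [dy, zpow_neg, zpow_natCast]; field_simp

lemma dy_succ (j : ℕ) : 2 * dy (j + 1) = dy j := by
  rw [dy, dy, zpow_neg, zpow_neg, zpow_natCast, zpow_natCast, pow_succ]; field_simp

lemma dy_anti : Antitone dy := antitone_nat_of_succ_le fun j => by
  have := dy_pos (j + 1)
  rw [← dy_succ j]; linarith

lemma dy_one : dy 1 = 1 / 2 := by norm_num [dy]

lemma dy_two : dy 2 = 1 / 4 := by norm_num [dy]

lemma zpow_sub_one_mul_dy (j : ℕ) : (2 : ℝ) ^ ((j : ℤ) - 1) * dy j = 1 / 2 := by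
  rw [dy, ← zpow_add₀ (by norm_num), show ((j : ℤ) - 1 + -(j : ℤ)) = -1 by ring]
  norm_num

lemma sig_sq_mul {n : ℝ} (hn : 0 < n) (j : ℕ) : 2 * n * sig n j ^ 2 * dy j = 1 := by
  rw [sig_sq hn.le]
  have := zpow_sub_one_mul_dy j
  field_simp
  linarith

lemma sum_sig_le {n : ℝ} (hn : 0 < n) (J : ℕ) :
    ∑ j ∈ Finset.range J, sig n j ≤ 3 * sig n J := by
  induction J with
  | zero => simpa using (sig_pos hn 0).le
  | succ J ih =>
    rw [Finset.sum_range_succ, sig_succ hn]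
    nlinarith [sqrt_two_bounds.1, sig_pos hn J]

lemma sig_add_le {n : ℝ} (hn : 0 < n) (J k : ℕ) :
    sig n (J + k) ≤ (3 / 2) ^ k * sig n J := by
  induction k with
  | zero => simp
  | succ k ih =>
    rw [← add_assoc, sig_succ hn, pow_succ]
    have := sig_pos hn (J + k)
    have h2 := sqrt_two_bounds.2
    have h3 := sig_pos hn J
    calc Real.sqrt 2 * sig n (J + k) ≤ 3 / 2 * ((3 / 2) ^ k * sig n J) := by gcongr
      _ = _ := by ring

lemma sig_mul_le_geometric {n : ℝ} (hn : 0 < n) {p : ℕ → ℝ≥0∞} (J : ℕ)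
    (h2 : ∀ k, p (J + k) ≤ ENNReal.ofReal ((1 / 2) ^ k)) (k : ℕ) :
    ENNReal.ofReal (sig n (k + J)) * p (k + J)
      ≤ ENNReal.ofReal (sig n J) * ENNReal.ofReal (3 / 4) ^ k := by
  have hJ := sig_pos hn J
  rw [add_comm k J]
  have e : sig n J * (3 / 4) ^ k = (3 / 2) ^ k * sig n J * (1 / 2) ^ k := by
    rw [mul_comm _ (sig n J), mul_assoc, ← mul_pow]
    norm_num
  rw [← ENNReal.ofReal_pow (by norm_num), ← ENNReal.ofReal_mul hJ.le, e,
    ENNReal.ofReal_mul (by positivity)]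
  gcongr
  · exact sig_add_le hn J k
  · exact h2 k

lemma tsum_mul_geometric {s : ℝ} (hs : 0 ≤ s) :
    ∑' k : ℕ, ENNReal.ofReal s * ENNReal.ofReal (3 / 4) ^ k = ENNReal.ofReal (4 * s) := by
  rw [ENNReal.tsum_mul_left, ENNReal.tsum_geometric, ← ENNReal.ofReal_one,
    ← ENNReal.ofReal_sub _ (by norm_num), ← ENNReal.ofReal_inv_of_pos (by norm_num),
    ← ENNReal.ofReal_mul hs]
  congr 1
  ring

lemma sum_sig_mul_le {n : ℝ} (hn : 0 < n) {p : ℕ → ℝ≥0∞} (J : ℕ) (h1 : ∀ j, p j ≤ 1) :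
    ∑ j ∈ Finset.range J, ENNReal.ofReal (sig n j) * p j ≤ ENNReal.ofReal (3 * sig n J) := by
  have h : ∀ j ∈ Finset.range J, ENNReal.ofReal (sig n j) * p j ≤ ENNReal.ofReal (sig n j) := by
    intro j _
    calc ENNReal.ofReal (sig n j) * p j ≤ ENNReal.ofReal (sig n j) * 1 := by gcongr; exact h1 j
      _ = _ := mul_one _
  refine (Finset.sum_le_sum h).trans ?_
  rw [← ENNReal.ofReal_sum_of_nonneg fun j _ => (sig_pos hn j).le]
  exact ENNReal.ofReal_le_ofReal (sum_sig_le hn J)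

/-- Before J the scales are a geometric sum dominated by its end, at most 3 σ_J. After J the growth
(√2)^k ≤ (3/2)^k loses against 2^{-k}, and the ratio 3/4 contributes 4 σ_J. -/
lemma tsum_sig_mul_le {n : ℝ} (hn : 0 < n) {p : ℕ → ℝ≥0∞} (J : ℕ) (h1 : ∀ j, p j ≤ 1)
    (h2 : ∀ k, p (J + k) ≤ ENNReal.ofReal ((1 / 2) ^ k)) :
    ∑' j, ENNReal.ofReal (sig n j) * p j ≤ ENNReal.ofReal (7 * sig n J) := by
  have hJ := sig_pos hn J
  have h7 : ENNReal.ofReal (7 * sig n J)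
      = ENNReal.ofReal (3 * sig n J) + ENNReal.ofReal (4 * sig n J) := by
    rw [← ENNReal.ofReal_add (by positivity) (by positivity)]
    congr 1
    ring
  have htail : ∑' k, ENNReal.ofReal (sig n (k + J)) * p (k + J)
      ≤ ENNReal.ofReal (4 * sig n J) := by
    rw [← tsum_mul_geometric hJ.le]
    exact ENNReal.tsum_le_tsum fun k => sig_mul_le_geometric hn J h2 k
  generalize hg : (fun j => ENNReal.ofReal (sig n j) * p j) = g
  have hsplit : ∑ j ∈ Finset.range J, g j + ∑' k, g (k + J) = ∑' j, g j :=
    ENNReal.summable.sum_add_tsum_nat_add'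
  rw [← hsplit, h7]
  subst hg
  exact add_le_add (sum_sig_mul_le hn J h1) htail

/-- The rate is never faster than parametric, as β/(1+2β) ≤ 1/2. This is where n ≥ 1 and M > 1
enter; it covers functions so smooth that the coarsest level is already good. -/
lemma inv_sqrt_le_rate {β M n : ℝ} (hβ : 0 ≤ β) (hM : 1 < M) (hn : 1 ≤ n) :
    (Real.sqrt n)⁻¹ ≤ rate β M n := by
  have hd : 0 < 1 + 2 * β := by linarith
  have h1 : (1 : ℝ) ≤ M ^ (1 / (1 + 2 * β)) := Real.one_le_rpow hM.le (by positivity)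
  have h2 : (Real.sqrt n)⁻¹ ≤ n ^ (-(β / (1 + 2 * β))) := by
    rw [Real.sqrt_eq_rpow, ← Real.rpow_neg (by linarith)]
    refine Real.rpow_le_rpow_of_exponent_le hn ?_
    rw [neg_le_neg_iff, div_le_div_iff₀ hd (by norm_num)]
    linarith
  calc (Real.sqrt n)⁻¹ = 1 * (Real.sqrt n)⁻¹ := (one_mul _).symm
    _ ≤ _ := by rw [rate]; gcongr

/-- J is the first level at which the bias bound is below the threshold; it stays below, since
2^{-j} decreases and σ_j increases. The factor 3 is generous, so that one lemma serves both
procedures. -/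
lemma exists_level {β M n τ : ℝ} (hβ : 0 ≤ β) (hM : 1 < M) (hn : 1 ≤ n) (hτ : 0 < τ) {j₀ : ℕ}
    (hj₀ : j₀ ≤ 2) :
    ∃ J, j₀ ≤ J ∧ (∀ i, J ≤ i → 3 * M * dy i ^ β ≤ τ * sig n i) ∧
      sig n J ≤ 2 * (1 + 3 / τ) * rate β M n := by
  have hn0 : 0 < n := by linarith
  have hM0 : 0 < M := by linarith
  have hd : 0 < 1 + 2 * β := by linarith
  have hr0 : 0 < rate β M n := by unfold rate; positivity
  set p : ℕ → Prop := fun j => j₀ ≤ j ∧ 3 * M * dy j ^ β ≤ τ * sig n j with hp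
  have hdb : ∀ i, dy i ^ β ≤ 1 := fun i => Real.rpow_le_one (dy_pos i).le
    ((dy_anti (Nat.zero_le i)).trans (by norm_num [dy])) hβ
  have hex : ∃ j, p j := by
    obtain ⟨k, hk⟩ := pow_unbounded_of_one_lt (3 * M / (τ * sig n j₀)) (by norm_num : (1 : ℝ) < 7 / 5)
    refine ⟨j₀ + k, by omega, ?_⟩
    have hs := sig_pos hn0 j₀
    have hgrow : ∀ k, (7 / 5 : ℝ) ^ k * sig n j₀ ≤ sig n (j₀ + k) := by
      intro k
      induction k with
      | zero => simp
      | succ k ih =>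
        rw [← add_assoc, sig_succ hn0, pow_succ]
        calc (7 / 5 : ℝ) ^ k * (7 / 5) * sig n j₀ = 7 / 5 * ((7 / 5 : ℝ) ^ k * sig n j₀) := by ring
          _ ≤ _ := mul_le_mul sqrt_two_bounds.1 ih (by positivity) (by positivity)
    rw [div_lt_iff₀ (by positivity)] at hk
    calc 3 * M * dy (j₀ + k) ^ β ≤ 3 * M * 1 := by gcongr; exact hdb _
      _ ≤ (7 / 5) ^ k * (τ * sig n j₀) := by linarith
      _ = τ * ((7 / 5) ^ k * sig n j₀) := by ring
      _ ≤ _ := by gcongr; exact hgrow k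
  classical
  obtain ⟨hJ0, hJ1⟩ := Nat.find_spec hex
  set J := Nat.find hex
  refine ⟨J, hJ0, fun i hi => ?_, ?_⟩
  · calc 3 * M * dy i ^ β ≤ 3 * M * dy J ^ β := by
          have := dy_pos i
          gcongr
          exact dy_anti hi
      _ ≤ τ * sig n J := hJ1
      _ ≤ τ * sig n i := by gcongr; exact sig_mono hn0 hi
  · have h3τ : 0 < 3 / τ := by positivity
    rcases Nat.eq_or_lt_of_le hJ0 with hJ | hJ
    · have h2 : sig n 2 ≤ 2 * (Real.sqrt n)⁻¹ := by
        rw [sig, Real.sqrt_div (by positivity), div_eq_mul_inv]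
        gcongr
        exact Real.sqrt_le_iff.2 ⟨by norm_num, by norm_num⟩
      calc sig n J ≤ sig n 2 := sig_mono hn0 (by omega)
        _ ≤ 2 * rate β M n := h2.trans (by gcongr; exact inv_sqrt_le_rate hβ hM hn)
        _ ≤ 2 * (1 + 3 / τ) * rate β M n := by gcongr; linarith
    -- At the preceding level the inequality fails by minimality. Inserting 2^{-i} = (2 n σ_i²)^{-1}
    -- turns the failure into σ_i^{1+2β} ≤ (3/τ) M n^{-β}, and σ_J = √2 σ_i.
    · obtain ⟨i, hi⟩ : ∃ i, J = i + 1 := ⟨J - 1, by omega⟩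
      have hnot := Nat.find_min hex (m := i) (by omega)
      rw [hp] at hnot
      simp only [not_and, not_le] at hnot
      have hlt := hnot (by omega)
      set s := sig n i with hs
      have hs0 : 0 < s := sig_pos hn0 i
      have hdy : dy i = (2 * n * s ^ 2)⁻¹ := eq_inv_of_mul_eq_one_right (sig_sq_mul hn0 i)
      have hdyb : dy i ^ β ≤ n ^ (-β) * s ^ (-(2 * β)) := by
        have h2 : (1 : ℝ) ≤ 2 ^ β := Real.one_le_rpow (by norm_num) hβ
        rw [hdy, Real.inv_rpow (by positivity), Real.mul_rpow (by positivity) (by positivity),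
          Real.mul_rpow (by positivity) hn0.le, Real.rpow_neg hn0.le, Real.rpow_neg hs0.le,
          ← mul_inv, ← Real.rpow_two, ← Real.rpow_mul hs0.le]
        apply inv_anti₀ (by positivity)
        calc n ^ β * s ^ (2 * β) = 1 * n ^ β * s ^ (2 * β) := by ring
          _ ≤ _ := by gcongr
      have hs1 : s ^ (1 + 2 * β) ≤ 3 / τ * (M * n ^ (-β)) := by
        have h4 : τ * s ≤ 3 * M * (n ^ (-β) * s ^ (-(2 * β))) := hlt.le.trans (by gcongr)
        have h5 : s ^ (-(2 * β)) * s ^ (2 * β) = 1 := by rw [← Real.rpow_add hs0]; simp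
        rw [Real.rpow_add hs0, Real.rpow_one]
        have h6 : 0 < s ^ (2 * β) := by positivity
        rw [div_mul_eq_mul_div, le_div_iff₀ hτ]
        calc s * s ^ (2 * β) * τ = τ * s * s ^ (2 * β) := by ring
          _ ≤ 3 * M * (n ^ (-β) * s ^ (-(2 * β))) * s ^ (2 * β) := by gcongr
          _ = 3 * (M * n ^ (-β)) * (s ^ (-(2 * β)) * s ^ (2 * β)) := by ring
          _ = _ := by rw [h5, mul_one]
      have hs2 : s ≤ (1 + 3 / τ) * rate β M n := by
        have h7 : s = (s ^ (1 + 2 * β)) ^ (1 / (1 + 2 * β)) := by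
          rw [← Real.rpow_mul hs0.le, mul_one_div_cancel hd.ne', Real.rpow_one]
        have h8 : (3 / τ) ^ (1 / (1 + 2 * β)) ≤ 1 + 3 / τ := by
          calc (3 / τ) ^ (1 / (1 + 2 * β)) ≤ (1 + 3 / τ) ^ (1 / (1 + 2 * β)) := by gcongr; linarith
            _ ≤ (1 + 3 / τ) ^ (1 : ℝ) := by
                refine Real.rpow_le_rpow_of_exponent_le (by linarith) ?_
                rw [div_le_one hd]; linarith
            _ = _ := Real.rpow_one _
        have h9 : rate β M n = (M * n ^ (-β)) ^ (1 / (1 + 2 * β)) := by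
          rw [Real.mul_rpow hM0.le (by positivity), ← Real.rpow_mul hn0.le, rate]
          congr 2
          ring
        rw [h7, h9]
        calc (s ^ (1 + 2 * β)) ^ (1 / (1 + 2 * β))
            ≤ (3 / τ * (M * n ^ (-β))) ^ (1 / (1 + 2 * β)) := by gcongr
          _ = (3 / τ) ^ (1 / (1 + 2 * β)) * (M * n ^ (-β)) ^ (1 / (1 + 2 * β)) :=
              Real.mul_rpow (by positivity) (by positivity)
          _ ≤ _ := by gcongr
      rw [hi, sig_succ hn0]
      calc Real.sqrt 2 * s ≤ 2 * ((1 + 3 / τ) * rate β M n) := by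
            gcongr
            linarith [sqrt_two_bounds.2]
        _ = _ := by ring

end Scales

/-! ### Sequential selection of a level -/

section Selection

variable {Ω : Type*} {mΩ : MeasurableSpace Ω} {P : Measure Ω} {B : ℝ≥0 → Ω → ℝ}
  {X : ℕ → Ω → ℝ} {t : ℕ → ℝ} {j₀ : ℕ}

/-- The event that no level in `[j₀, j)` is selected. -/
def surv (X : ℕ → Ω → ℝ) (t : ℕ → ℝ) (j₀ j : ℕ) : Set Ω :=
  {ω | ∀ i, j₀ ≤ i → i < j → t i < X i ω}

/-- The event that the level `j` is selected. -/
def sel (X : ℕ → Ω → ℝ) (t : ℕ → ℝ) (j₀ j : ℕ) : Set Ω :=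
  {ω | j₀ ≤ j ∧ ω ∈ surv X t j₀ j ∧ X j ω ≤ t j}

lemma sel_subset_surv (j : ℕ) : sel X t j₀ j ⊆ surv X t j₀ j := fun _ h => h.2.1

lemma surv_anti {i j : ℕ} (h : i ≤ j) : surv X t j₀ j ⊆ surv X t j₀ i :=
  fun _ hω k hk hki => hω k hk (hki.trans_le h)

lemma surv_succ {j : ℕ} (hj : j₀ ≤ j) :
    surv X t j₀ (j + 1) = surv X t j₀ j ∩ {ω | t j < X j ω} := by
  ext ω
  constructor
  · exact fun h => ⟨fun i hi hij => h i hi (by omega), h j hj (by omega)⟩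
  · rintro ⟨h1, h2⟩ i hi hij
    rcases Nat.lt_succ_iff_lt_or_eq.1 hij with h | rfl
    · exact h1 i hi h
    · exact h2

lemma sInf_eq_of_mem_sel {j : ℕ} {ω : Ω} (h : ω ∈ sel X t j₀ j) :
    sInf {i : ℕ | j₀ ≤ i ∧ X i ω ≤ t i} = j := by
  refine IsLeast.csInf_eq ⟨⟨h.1, h.2.2⟩, fun i hi => ?_⟩
  by_contra! hlt
  exact absurd hi.2 (not_le.2 (h.2.1 i hi.1 hlt))

lemma pairwise_disjoint_sel : Pairwise (Function.onFun Disjoint (sel X t j₀)) := by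
  intro i j hij
  rw [Function.onFun, Set.disjoint_left]
  intro ω hi hj
  exact hij ((sInf_eq_of_mem_sel hi).symm.trans (sInf_eq_of_mem_sel hj))

lemma compl_iUnion_sel_subset (j : ℕ) : (⋃ i, sel X t j₀ i)ᶜ ⊆ surv X t j₀ j := by
  intro ω hω
  simp only [mem_compl_iff, mem_iUnion, not_exists] at hω
  induction j using Nat.strong_induction_on with
  | _ j ih =>
    intro i hi hij
    by_contra! hle
    exact hω i ⟨hi, ih i hij, hle⟩

lemma measurableSet_surv (hX : ∀ j, Measurable (X j)) (j : ℕ) : MeasurableSet (surv X t j₀ j) := by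
  have : surv X t j₀ j = ⋂ i, ⋂ (_ : j₀ ≤ i), ⋂ (_ : i < j), {ω | t i < X i ω} := by
    ext ω; simp [surv]
  rw [this]
  exact MeasurableSet.iInter fun i => MeasurableSet.iInter fun _ => MeasurableSet.iInter fun _ =>
    measurableSet_lt measurable_const (hX i)

lemma measurableSet_sel (hX : ∀ j, Measurable (X j)) (j : ℕ) : MeasurableSet (sel X t j₀ j) := by
  by_cases h : j₀ ≤ j
  · have : sel X t j₀ j = surv X t j₀ j ∩ {ω | X j ω ≤ t j} := by ext ω; simp [sel, h]
    rw [this]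
    exact (measurableSet_surv hX j).inter (measurableSet_le (hX j) measurable_const)
  · have : sel X t j₀ j = ∅ := by ext ω; simp [sel, h]
    rw [this]
    exact MeasurableSet.empty

lemma measure_iUnion_sel_compl (h : ∃ J, ∀ k, P (surv X t j₀ (J + k)) ≤ ENNReal.ofReal ((1 / 2) ^ k)) :
    P (⋃ i, sel X t j₀ i)ᶜ = 0 := by
  obtain ⟨J, hJ⟩ := h
  have h0 : Filter.Tendsto (fun k : ℕ => ENNReal.ofReal ((1 / 2 : ℝ) ^ k)) Filter.atTop (nhds 0) := by
    rw [← ENNReal.ofReal_zero]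
    exact ENNReal.tendsto_ofReal (tendsto_pow_atTop_nhds_zero_of_lt_one (by norm_num) (by norm_num))
  refine le_antisymm (ge_of_tendsto' h0 fun k => ?_) zero_le
  exact (measure_mono (compl_iUnion_sel_subset (J + k))).trans (hJ k)

variable {μ : ℕ → ℝ} {c : ℕ → ℝ≥0 →₀ ℝ}

/-- The survival event as an event for the noise of the earlier levels. -/
lemma surv_eq_preimage (hX : ∀ j, j₀ ≤ j → ∀ ω, X j ω = μ j + noise B (c j) ω) (j : ℕ) :
    ∃ S : Set ({i // j₀ ≤ i ∧ i < j} → ℝ), MeasurableSet S ∧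
      surv X t j₀ j = (fun ω (i : {i // j₀ ≤ i ∧ i < j}) => noise B (c i) ω) ⁻¹' S := by
  refine ⟨⋂ i : {i // j₀ ≤ i ∧ i < j}, {x : {i // j₀ ≤ i ∧ i < j} → ℝ | t i < μ i + x i}, MeasurableSet.iInter fun i =>
    measurableSet_lt measurable_const ((measurable_pi_apply _).const_add _), ?_⟩
  ext ω
  simp only [surv, mem_ofPred_eq, mem_preimage, mem_iInter, Subtype.forall]
  constructor
  · intro h i hi
    rw [← hX i hi.1]
    exact h i hi.1 hi.2
  · intro h i hi hij
    rw [hX i hi]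
    exact h i ⟨hi, hij⟩

lemma sel_eq_preimage (hX : ∀ j, j₀ ≤ j → ∀ ω, X j ω = μ j + noise B (c j) ω) (j : ℕ) :
    ∃ S : Set ({i // j₀ ≤ i ∧ i ≤ j} → ℝ), MeasurableSet S ∧
      sel X t j₀ j = (fun ω (i : {i // j₀ ≤ i ∧ i ≤ j}) => noise B (c i) ω) ⁻¹' S := by
  by_cases hj : j₀ ≤ j
  · refine ⟨(⋂ i : {i // j₀ ≤ i ∧ i ≤ j}, {x | (i : ℕ) < j → t i < μ i + x i})
      ∩ {x | μ j + x ⟨j, hj, le_rfl⟩ ≤ t j}, ?_, ?_⟩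
    · refine (MeasurableSet.iInter fun i => ?_).inter
        (measurableSet_le ((measurable_pi_apply _).const_add _) measurable_const)
      by_cases hi : (i : ℕ) < j
      · simp only [hi, forall_const]
        exact measurableSet_lt measurable_const ((measurable_pi_apply _).const_add _)
      · simp [hi]
    · ext ω
      simp only [sel, surv, mem_ofPred_eq, mem_preimage, mem_iInter, mem_inter_iff, Subtype.forall]
      rw [← hX j hj]
      constructor
      · rintro ⟨-, h1, h2⟩
        refine ⟨fun i hi hij => ?_, h2⟩
        rw [← hX i hi.1]
        exact h1 i hi.1 hij
      · rintro ⟨h1, h2⟩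
        refine ⟨hj, fun i hi hij => ?_, h2⟩
        rw [hX i hi]
        exact h1 i ⟨hi, hij.le⟩ hij
  · exact ⟨∅, MeasurableSet.empty, by ext ω; simp [sel, hj]⟩

lemma measure_surv_inter (hB : ∀ t, Measurable (B t)) (hP : IsPreBrownianReal B P)
    (hX : ∀ j, j₀ ≤ j → ∀ ω, X j ω = μ j + noise B (c j) ω)
    (hcov : ∀ i j, j₀ ≤ i → i < j → cov[noise B (c i), noise B (c j); P] = 0)
    {j : ℕ} (hj : j₀ ≤ j) :
    P (surv X t j₀ (j + 1)) = P (surv X t j₀ j) * P {ω | t j < X j ω} := by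
  obtain ⟨S, hS, hSe⟩ := surv_eq_preimage (t := t) hX j
  have hind := indepFun_noise hB hP (fun i : {i // j₀ ≤ i ∧ i < j} => c i) (fun _ : Unit => c j)
    fun i _ => hcov i j i.2.1 i.2.2
  have h2 : {ω | t j < X j ω}
      = (fun ω (_ : Unit) => noise B (c j) ω) ⁻¹' {x : Unit → ℝ | t j < μ j + x ()} := by
    ext ω; simp [hX j hj]
  rw [surv_succ hj, hSe, h2]
  exact (indepFun_iff_measure_inter_preimage_eq_mul.1 hind) S _ hS
    (measurableSet_lt measurable_const ((measurable_pi_apply _).const_add _))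

lemma measure_stat_gt (hP : IsPreBrownianReal B P)
    (hX : ∀ j, j₀ ≤ j → ∀ ω, X j ω = μ j + noise B (c j) ω) {j : ℕ} (hj : j₀ ≤ j) {s : ℝ}
    (hs : 0 < s) (hvar : cov[noise B (c j), noise B (c j); P] = s ^ 2) {x : ℝ}
    (hx : μ j + s * x ≤ t j) :
    P {ω | t j < X j ω} ≤ ENNReal.ofReal (gtail x) := by
  rw [← measure_noise_gt hP hs hvar x]
  refine measure_mono fun ω hω => ?_
  have : t j < μ j + noise B (c j) ω := by rw [← hX j hj]; exact hω
  change s * x < noise B (c j) ω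
  linarith

lemma measure_stat_le (hP : IsPreBrownianReal B P)
    (hX : ∀ j, j₀ ≤ j → ∀ ω, X j ω = μ j + noise B (c j) ω) {j : ℕ} (hj : j₀ ≤ j) {s : ℝ}
    (hs : 0 < s) (hvar : cov[noise B (c j), noise B (c j); P] = s ^ 2) {x : ℝ}
    (hx : t j < μ j - s * x) :
    P {ω | X j ω ≤ t j} ≤ ENNReal.ofReal (gtail x) := by
  rw [← measure_noise_lt hP hs hvar x]
  refine measure_mono fun ω hω => ?_
  have : μ j + noise B (c j) ω ≤ t j := by rw [← hX j hj]; exact hω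
  change noise B (c j) ω < -(s * x)
  linarith

/-- Once the mean is below the threshold, a symmetric noise exceeds the remaining margin with
probability at most 1/2, independently at each level. -/
lemma measure_surv_le (hB : ∀ t, Measurable (B t)) (hP : IsPreBrownianReal B P)
    (hX : ∀ j, j₀ ≤ j → ∀ ω, X j ω = μ j + noise B (c j) ω)
    (hcov : ∀ i j, j₀ ≤ i → i < j → cov[noise B (c i), noise B (c j); P] = 0) {s : ℕ → ℝ}
    (hs : ∀ j, 0 < s j)
    (hvar : ∀ j, j₀ ≤ j → cov[noise B (c j), noise B (c j); P] = s j ^ 2) {J : ℕ} (hJ : j₀ ≤ J)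
    (hμ : ∀ i, J ≤ i → μ i ≤ t i) (k : ℕ) :
    P (surv X t j₀ (J + k)) ≤ ENNReal.ofReal ((1 / 2) ^ k) := by
  have hprob := hP.isGaussianProcess.isProbabilityMeasure
  induction k with
  | zero => simpa using prob_le_one
  | succ k ih =>
    rw [← add_assoc, measure_surv_inter hB hP hX hcov (by omega), pow_succ,
      ENNReal.ofReal_mul (by positivity)]
    gcongr
    rw [← gtail_zero]
    exact measure_stat_gt hP hX (by omega) (hs _) (hvar _ (by omega))
      (by rw [mul_zero, add_zero]; exact hμ _ (by omega))

/-- Expected value of a quantity that is controlled, on the event that the level `j` is selected,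
by `σ_j` and by a noise variable that is uncorrelated with the earlier levels. -/
lemma lintegral_le_of_sel (hB : ∀ t, Measurable (B t)) (hP : IsPreBrownianReal B P) {n : ℝ}
    (hn : 0 < n) (hXm : ∀ j, Measurable (X j))
    (hX : ∀ j, j₀ ≤ j → ∀ ω, X j ω = μ j + noise B (c j) ω)
    (hcov : ∀ i j, j₀ ≤ i → i < j → cov[noise B (c i), noise B (c j); P] = 0)
    (hvar : ∀ j, j₀ ≤ j → cov[noise B (c j), noise B (c j); P] = sig n j ^ 2) {J : ℕ} (hJ : j₀ ≤ J)
    (hμ : ∀ i, J ≤ i → μ i ≤ t i) {d : ℕ → ℝ≥0 →₀ ℝ} {K K' : ℝ} (hK : 0 ≤ K) (hK' : 0 ≤ K')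
    (hd : ∀ i j, j₀ ≤ i → i < j → cov[noise B (c i), noise B (d j); P] = 0)
    (hdv : ∀ j, j₀ ≤ j → cov[noise B (d j), noise B (d j); P] = (K' * sig n j) ^ 2)
    {L : Ω → ℝ≥0∞}
    (hL : ∀ j, ∀ ω ∈ sel X t j₀ j,
      L ω ≤ ENNReal.ofReal (K * sig n j) + ENNReal.ofReal |noise B (d j) ω|) :
    ∫⁻ ω, L ω ∂P ≤ ENNReal.ofReal (7 * (K + K') * sig n J) := by
  have hprob := hP.isGaussianProcess.isProbabilityMeasure
  have hsurv := measure_surv_le (t := t) hB hP hX hcov (sig_pos hn) hvar hJ hμ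
  have hnull := measure_iUnion_sel_compl ⟨J, hsurv⟩
  have hterm : ∀ j, ∫⁻ ω in sel X t j₀ j, L ω ∂P
      ≤ ENNReal.ofReal (K + K') * (ENNReal.ofReal (sig n j) * P (surv X t j₀ j)) := by
    intro j
    by_cases hj : j₀ ≤ j
    swap
    · have : sel X t j₀ j = ∅ := by ext ω; simp [sel, hj]
      simp [this]
    have hs := sig_pos hn j
    obtain ⟨S, hS, hSe⟩ := surv_eq_preimage (t := t) hX j
    have hind := indepFun_noise hB hP (fun i : {i // j₀ ≤ i ∧ i < j} => c i) (fun _ : Unit => d j)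
      fun i _ => hd i j i.2.1 i.2.2
    calc ∫⁻ ω in sel X t j₀ j, L ω ∂P
        ≤ ∫⁻ ω in sel X t j₀ j, (ENNReal.ofReal (K * sig n j) + ENNReal.ofReal |noise B (d j) ω|) ∂P :=
          setLIntegral_mono' (measurableSet_sel hXm j) (hL j)
      -- Enlarging selection at j to mere survival up to j drops the j-th test from the event, so `d
      -- j` need only be uncorrelated with strictly earlier levels and may involve `c j`.
      _ ≤ ∫⁻ ω in surv X t j₀ j,
            (ENNReal.ofReal (K * sig n j) + ENNReal.ofReal |noise B (d j) ω|) ∂P :=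
          lintegral_mono_set (sel_subset_surv j)
      _ = P (surv X t j₀ j)
            * ∫⁻ ω, (ENNReal.ofReal (K * sig n j) + ENNReal.ofReal |noise B (d j) ω|) ∂P := by
          rw [hSe]
          exact setLIntegral_eq_of_indepFun
            (measurable_pi_lambda _ fun i => measurable_noise hB _)
            (measurable_pi_lambda _ fun i => measurable_noise hB _) hind hS
            (g := fun x : Unit → ℝ => ENNReal.ofReal (K * sig n j) + ENNReal.ofReal |x ()|)
            (by fun_prop)
      _ ≤ P (surv X t j₀ j) * (ENNReal.ofReal (K * sig n j) + ENNReal.ofReal (K' * sig n j)) := by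
          gcongr
          rw [lintegral_add_left measurable_const, lintegral_const, measure_univ, mul_one]
          gcongr
          exact lintegral_abs_noise_le hP (by positivity) (hdv j hj)
      _ = _ := by
          rw [← ENNReal.ofReal_add (by positivity) (by positivity), ← add_mul,
            ENNReal.ofReal_mul (by positivity)]
          ring
  calc ∫⁻ ω, L ω ∂P = ∫⁻ ω in ⋃ j, sel X t j₀ j, L ω ∂P := by
        rw [← setLIntegral_univ]
        refine setLIntegral_congr ?_
        refine (ae_eq_univ.2 hnull).symm
    _ ≤ ∑' j, ∫⁻ ω in sel X t j₀ j, L ω ∂P := lintegral_iUnion_le _ _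
    _ ≤ ∑' j, ENNReal.ofReal (K + K') * (ENNReal.ofReal (sig n j) * P (surv X t j₀ j)) :=
        ENNReal.tsum_le_tsum hterm
    _ = ENNReal.ofReal (K + K') * ∑' j, ENNReal.ofReal (sig n j) * P (surv X t j₀ j) :=
        ENNReal.tsum_mul_left
    _ ≤ ENNReal.ofReal (K + K') * ENNReal.ofReal (7 * sig n J) := by
        gcongr
        exact tsum_sig_mul_le hn J (fun j => prob_le_one) hsurv
    _ = _ := by
        rw [← ENNReal.ofReal_mul (by positivity)]
        congr 1
        ring

end Selection

/-! ### Statistics of the selected level -/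

section Level

variable {Ω : Type*} {mΩ : MeasurableSpace Ω} {P : Measure Ω} {B : ℝ≥0 → Ω → ℝ}
  {X : ℕ → Ω → ℝ} {t : ℕ → ℝ} {j₀ : ℕ}

lemma measurable_sInf_level (hX : ∀ j, Measurable (X j)) :
    Measurable fun ω => sInf {i : ℕ | j₀ ≤ i ∧ X i ω ≤ t i} := by
  refine measurable_to_countable' fun k => ?_
  -- When no level is selected the infimum is that of the empty set, namely 0, so the event of no
  -- selection has to be added to the fibre over 0.
  have : (fun ω => sInf {i : ℕ | j₀ ≤ i ∧ X i ω ≤ t i}) ⁻¹' {k}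
      = sel X t j₀ k ∪ ({_ω | k = 0} ∩ (⋃ i, sel X t j₀ i)ᶜ) := by
    ext ω
    by_cases h : ∃ i, ω ∈ sel X t j₀ i
    · obtain ⟨i, hi⟩ := h
      have h1 : ω ∈ ⋃ i, sel X t j₀ i := mem_iUnion.2 ⟨i, hi⟩
      simp only [mem_preimage, mem_singleton_iff, sInf_eq_of_mem_sel hi, mem_union, mem_inter_iff,
        mem_compl_iff, h1, not_true, and_false, or_false]
      exact ⟨fun h => h ▸ hi, fun hk =>
        (sInf_eq_of_mem_sel hi).symm.trans (sInf_eq_of_mem_sel hk)⟩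
    · have h1 : ω ∈ (⋃ i, sel X t j₀ i)ᶜ := by simpa using h
      have h2 : {i : ℕ | j₀ ≤ i ∧ X i ω ≤ t i} = ∅ := by
        ext i
        simp only [mem_ofPred_eq, mem_empty_iff_false, iff_false, not_and, not_le]
        exact fun hi => compl_iUnion_sel_subset (i + 1) h1 i hi (by omega)
      have h3 : ω ∉ sel X t j₀ k := fun hk => h ⟨k, hk⟩
      rw [mem_preimage, h2, Nat.sInf_empty]
      simp only [mem_singleton_iff, mem_union, h3, mem_inter_iff, mem_ofPred_eq, h1, and_true,
        false_or]
      exact eq_comm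
  rw [this]
  refine (measurableSet_sel hX k).union (MeasurableSet.inter ?_
    (MeasurableSet.iUnion fun i => measurableSet_sel hX i).compl)
  exact MeasurableSet.const _

lemma measurable_level {h : ℕ → Ω → ℝ} {J : Ω → ℕ} (hh : ∀ j, Measurable (h j))
    (hJ : Measurable J) : Measurable fun ω => h (J ω) ω := by
  have : Measurable fun p : ℕ × Ω => h p.1 p.2 := measurable_from_prod_countable_right hh
  exact this.comp (hJ.prodMk measurable_id)

/-- Selection of j depends on the tests up to and including j, so here the noise must be
uncorrelated with level j as well. -/
lemma measure_sel_inter (hB : ∀ t, Measurable (B t)) (hP : IsPreBrownianReal B P)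
    {μ : ℕ → ℝ} {c : ℕ → ℝ≥0 →₀ ℝ}
    (hX : ∀ j, j₀ ≤ j → ∀ ω, X j ω = μ j + noise B (c j) ω) {j : ℕ} {d : ℝ≥0 →₀ ℝ}
    (hd : ∀ i, j₀ ≤ i → i ≤ j → cov[noise B (c i), noise B d; P] = 0) {E : Set ℝ}
    (hE : MeasurableSet E) :
    P (sel X t j₀ j ∩ noise B d ⁻¹' E) = P (sel X t j₀ j) * P (noise B d ⁻¹' E) := by
  obtain ⟨S, hS, hSe⟩ := sel_eq_preimage (t := t) hX j
  have hind := indepFun_noise hB hP (fun i : {i // j₀ ≤ i ∧ i ≤ j} => c i) (fun _ : Unit => d)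
    fun i _ => hd i i.2.1 i.2.2
  have h2 : noise B d ⁻¹' E = (fun ω (_ : Unit) => noise B d ω) ⁻¹' ((fun x => x ()) ⁻¹' E) := rfl
  rw [hSe, h2]
  exact (indepFun_iff_measure_inter_preimage_eq_mul.1 hind) S _ hS (measurable_pi_apply _ hE)

lemma measure_iUnion_sel_inter_le [IsProbabilityMeasure P] (hXm : ∀ j, Measurable (X j)) {ε : ℝ≥0∞}
    {miss : ℕ → Set Ω} (h : ∀ j, j₀ ≤ j → P (sel X t j₀ j ∩ miss j) ≤ P (sel X t j₀ j) * ε) :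
    P (⋃ j, sel X t j₀ j ∩ miss j) ≤ ε := by
  calc P (⋃ j, sel X t j₀ j ∩ miss j) ≤ ∑' j, P (sel X t j₀ j ∩ miss j) := measure_iUnion_le _
    _ ≤ ∑' j, P (sel X t j₀ j) * ε := ENNReal.tsum_le_tsum fun j => by
        by_cases hj : j₀ ≤ j
        · exact h j hj
        · have : sel X t j₀ j = ∅ := by ext ω; simp [sel, hj]
          simp [this]
    _ = P (⋃ j, sel X t j₀ j) * ε := by
        rw [ENNReal.tsum_mul_right, measure_iUnion pairwise_disjoint_sel (measurableSet_sel hXm)]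
    _ ≤ 1 * ε := by gcongr; exact prob_le_one
    _ = ε := one_mul _

lemma ofReal_one_sub_le [IsProbabilityMeasure P] {A : Set Ω} {α : ℝ} (hα : 0 ≤ α)
    (h : P Aᶜ ≤ ENNReal.ofReal α) : ENNReal.ofReal (1 - α) ≤ P A := by
  have h1 : 1 ≤ P A + P Aᶜ := by
    rw [← measure_univ (μ := P), ← union_compl_self A]
    exact measure_union_le _ _
  rw [ENNReal.ofReal_sub _ hα, ENNReal.ofReal_one, tsub_le_iff_right]
  exact h1.trans (by gcongr)

lemma cov_smul_self (a : ℝ) (c : ℝ≥0 →₀ ℝ) :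
    cov[noise B (a • c), noise B (a • c); P] = a ^ 2 * cov[noise B c, noise B c; P] := by
  rw [cov_noise_smul_left, cov_noise_smul_right]
  ring

lemma inv_sqrt_sq {n : ℝ} (hn : 0 < n) : (Real.sqrt n)⁻¹ ^ 2 = n⁻¹ := by
  rw [inv_pow, Real.sq_sqrt hn.le]

lemma two_zpow_sub_one (j : ℕ) : (2 : ℝ) ^ j = 2 * 2 ^ ((j : ℤ) - 1) := by
  rw [zpow_sub_one₀ (by norm_num), zpow_natCast]
  ring

end Level

/-! ### The monotone procedure -/

section Monotone

variable {Ω : Type*} {mΩ : MeasurableSpace Ω} {P : Measure Ω} {B : ℝ≥0 → Ω → ℝ}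

lemma dy_le_half {j : ℕ} (hj : 1 ≤ j) : dy j ≤ 1 / 2 := by
  rw [← dy_one]; exact dy_anti hj

lemma dy_le_quarter {j : ℕ} (hj : 2 ≤ j) : dy j ≤ 1 / 4 := by
  rw [← dy_two]; exact dy_anti hj

/-- The noise functional of `δ_j^R`. -/
def noiseR (n : ℝ) (j : ℕ) : ℝ≥0 →₀ ℝ := ((Real.sqrt n)⁻¹ * 2 ^ j) • inc 0 (dy j)

/-- The noise functional of `δ_j^L`. -/
def noiseL (n : ℝ) (j : ℕ) : ℝ≥0 →₀ ℝ := ((Real.sqrt n)⁻¹ * 2 ^ j) • inc (-dy j) 0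

/-- The noise functional of `ξ_j`. -/
def noiseXi (n : ℝ) (j : ℕ) : ℝ≥0 →₀ ℝ :=
  ((Real.sqrt n)⁻¹ * 2 ^ ((j : ℤ) - 1)) • (inc (dy j) (2 * dy j) - inc (-(2 * dy j)) (-dy j))

/-- The expected value of `ξ_j`. -/
def meanXi (f : ℝ → ℝ) (j : ℕ) : ℝ :=
  2 ^ ((j : ℤ) - 1) * ((∫ x in dy j..2 * dy j, f x) - ∫ x in -(2 * dy j)..-dy j, f x)

/-- ξ_j uses only the dyadic shell 2^{-j} ≤ |t| ≤ 2^{-j+1}, and shells of different levels do not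
overlap. -/
lemma cov_noiseXi_noiseXi (hP : IsPreBrownianReal B P) (n : ℝ) {i j : ℕ} (hi : 2 ≤ i)
    (hij : i < j) : cov[noise B (noiseXi n i), noise B (noiseXi n j); P] = 0 := by
  have h1 := dy_pos j
  have h2 : 2 * dy j ≤ dy i := by
    obtain ⟨k, rfl⟩ : ∃ k, j = k + 1 := ⟨j - 1, by omega⟩
    rw [dy_succ]
    exact dy_anti (by omega)
  have h3 := dy_le_quarter hi
  rw [noiseXi, noiseXi, cov_noise_smul_left, cov_noise_smul_right, cov_noise_sub_left,
    cov_noise_sub_right, cov_noise_sub_right,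
    cov_inc_disjoint' hP (by linarith) (by linarith) h2 (by linarith),
    cov_inc_disjoint' hP (by linarith) (by linarith) (by linarith) (by linarith),
    cov_inc_disjoint hP (by linarith) (by linarith) (by linarith) (by linarith),
    cov_inc_disjoint hP (by linarith) (by linarith) (by linarith) (by linarith)]
  all_goals first | exact hP | ring

lemma cov_noiseXi_noiseR (hP : IsPreBrownianReal B P) (n : ℝ) {i j : ℕ} (hi : 2 ≤ i)
    (hij : i ≤ j) : cov[noise B (noiseXi n i), noise B (noiseR n j); P] = 0 := by
  have h1 := dy_pos j
  have h2 : dy j ≤ dy i := dy_anti hij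
  have h3 := dy_le_quarter hi
  rw [noiseXi, noiseR, cov_noise_smul_left, cov_noise_smul_right, cov_noise_sub_left hP,
    cov_inc_disjoint' hP (by linarith) (by linarith) h2 (by linarith),
    cov_inc_disjoint hP (by linarith) (by linarith) (by linarith) (by linarith)]
  ring

lemma cov_noiseXi_noiseL (hP : IsPreBrownianReal B P) (n : ℝ) {i j : ℕ} (hi : 2 ≤ i)
    (hij : i ≤ j) : cov[noise B (noiseXi n i), noise B (noiseL n j); P] = 0 := by
  have h1 := dy_pos j
  have h2 : dy j ≤ dy i := dy_anti hij
  have h3 := dy_le_quarter hi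
  rw [noiseXi, noiseL, cov_noise_smul_left, cov_noise_smul_right, cov_noise_sub_left hP,
    cov_inc_disjoint' hP (by linarith) (by linarith) (by linarith) (by linarith),
    cov_inc_disjoint hP (by linarith) (by linarith) (by linarith) (by linarith)]
  ring

lemma cov_noiseXi_self (hP : IsPreBrownianReal B P) {n : ℝ} (hn : 0 < n) {j : ℕ} (hj : 2 ≤ j) :
    cov[noise B (noiseXi n j), noise B (noiseXi n j); P] = sig n j ^ 2 := by
  have h1 := dy_pos j
  have h3 := dy_le_quarter hj
  have h4 := zpow_sub_one_mul_dy j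
  rw [noiseXi, cov_smul_self, cov_noise_sub_left hP, cov_noise_sub_right hP,
    cov_noise_sub_right hP, cov_inc_self hP (by linarith) (by linarith),
    cov_inc_self hP (by linarith) (by linarith),
    cov_inc_disjoint' hP (by linarith) (by linarith) (by linarith) (by linarith),
    cov_inc_disjoint hP (by linarith) (by linarith) (by linarith) (by linarith),
    mul_pow, inv_sqrt_sq hn, sig_sq hn.le]
  field_simp
  linear_combination 2 * h4

lemma cov_noiseR_self (hP : IsPreBrownianReal B P) {n : ℝ} (hn : 0 < n) (j : ℕ) :
    cov[noise B (noiseR n j), noise B (noiseR n j); P] = (Real.sqrt 2 * sig n j) ^ 2 := by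
  have h1 := dy_pos j
  have h4 := zpow_sub_one_mul_dy j
  rw [noiseR, cov_smul_self, cov_inc_self hP (by norm_num) h1.le, mul_pow, inv_sqrt_sq hn, mul_pow,
    Real.sq_sqrt (by norm_num), sig_sq hn.le, two_zpow_sub_one]
  field_simp
  linear_combination 2 * h4

lemma cov_noiseL_self (hP : IsPreBrownianReal B P) {n : ℝ} (hn : 0 < n) {j : ℕ} (hj : 1 ≤ j) :
    cov[noise B (noiseL n j), noise B (noiseL n j); P] = (Real.sqrt 2 * sig n j) ^ 2 := by
  have h1 := dy_pos j
  have h2 := dy_le_half hj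
  have h4 := zpow_sub_one_mul_dy j
  rw [noiseL, cov_smul_self, cov_inc_self hP (by linarith) (by linarith), mul_pow, inv_sqrt_sq hn,
    mul_pow, Real.sq_sqrt (by norm_num), sig_sq hn.le, two_zpow_sub_one]
  field_simp
  linear_combination 2 * h4

lemma cov_noiseR_noiseL (hP : IsPreBrownianReal B P) (n : ℝ) {j : ℕ} (hj : 1 ≤ j) :
    cov[noise B (noiseR n j), noise B (noiseL n j); P] = 0 := by
  have h1 := dy_pos j
  have h2 := dy_le_half hj
  rw [noiseR, noiseL, cov_noise_smul_left, cov_noise_smul_right,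
    cov_inc_disjoint' hP (by linarith) (by linarith) (by linarith) (by linarith)]
  ring

/-! ### Means of the monotone statistics. -/

lemma intervalIntegrable_of_mem_monoClass {f : ℝ → ℝ} (hf : f ∈ monoClass) :
    IntervalIntegrable f volume (-(1 / 2)) (1 / 2) := by
  refine MonotoneOn.intervalIntegrable ?_
  rw [uIcc_of_le (by norm_num)]
  exact hf

lemma intervalIntegrable_sub {f : ℝ → ℝ} (hf : IntervalIntegrable f volume (-(1 / 2)) (1 / 2))
    {a b : ℝ} (ha : a ∈ unitInt) (hb : b ∈ unitInt) : IntervalIntegrable f volume a b := by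
  refine hf.mono_set ?_
  rw [uIcc_of_le (by norm_num : (-(1 / 2) : ℝ) ≤ 1 / 2)]
  exact uIcc_subset_Icc ha hb

lemma integral_bounds_of_mem_monoClass {f : ℝ → ℝ} (hf : f ∈ monoClass) {a b : ℝ}
    (ha : -(1 / 2) ≤ a) (hab : a ≤ b) (hb : b ≤ 1 / 2) :
    (b - a) * f a ≤ ∫ x in a..b, f x ∧ ∫ x in a..b, f x ≤ (b - a) * f b := by
  have ha' : a ∈ unitInt := ⟨ha, by linarith⟩
  have hb' : b ∈ unitInt := ⟨by linarith, hb⟩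
  have hi := intervalIntegrable_sub (intervalIntegrable_of_mem_monoClass hf) ha' hb'
  have hm : ∀ x ∈ Icc a b, x ∈ unitInt := fun x hx => ⟨by linarith [hx.1], by linarith [hx.2]⟩
  constructor
  · rw [← smul_eq_mul, ← intervalIntegral.integral_const]
    exact intervalIntegral.integral_mono_on hab intervalIntegrable_const hi
      fun x hx => hf ha' (hm x hx) hx.1
  · rw [← smul_eq_mul, ← intervalIntegral.integral_const]
    exact intervalIntegral.integral_mono_on hab hi intervalIntegrable_const
      fun x hx => hf (hm x hx) hb' hx.2

lemma deltaR_whiteNoise {f : ℝ → ℝ} (hf : IntervalIntegrable f volume (-(1 / 2)) (1 / 2)) (n : ℝ)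
    {j : ℕ} (hj : 1 ≤ j) (ω : Ω) :
    deltaR (whiteNoise n B f ω) j = 2 ^ j * (∫ x in 0..dy j, f x) + noise B (noiseR n j) ω := by
  have h1 := dy_pos j
  have h2 := dy_le_half hj
  rw [deltaR, val_whiteNoise_sub n B ω hf ⟨by norm_num, by norm_num⟩ ⟨by linarith, h2⟩, noiseR,
    map_smul, Pi.smul_apply, smul_eq_mul]
  ring

lemma deltaL_whiteNoise {f : ℝ → ℝ} (hf : IntervalIntegrable f volume (-(1 / 2)) (1 / 2)) (n : ℝ)
    {j : ℕ} (hj : 1 ≤ j) (ω : Ω) :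
    deltaL (whiteNoise n B f ω) j = 2 ^ j * (∫ x in -dy j..0, f x) + noise B (noiseL n j) ω := by
  have h1 := dy_pos j
  have h2 := dy_le_half hj
  rw [deltaL, val_whiteNoise_sub n B ω hf ⟨by linarith, by linarith⟩ ⟨by norm_num, by norm_num⟩,
    noiseL, map_smul, Pi.smul_apply, smul_eq_mul]
  ring

lemma xi_whiteNoise {f : ℝ → ℝ} (hf : IntervalIntegrable f volume (-(1 / 2)) (1 / 2)) (n : ℝ)
    {j : ℕ} (hj : 2 ≤ j) (ω : Ω) :
    xi (whiteNoise n B f ω) j = meanXi f j + noise B (noiseXi n j) ω := by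
  have h1 := dy_pos j
  have h2 := dy_le_quarter hj
  rw [xi, val_whiteNoise_sub n B ω hf ⟨by linarith, by linarith⟩ ⟨by linarith, by linarith⟩,
    val_whiteNoise_sub n B ω hf ⟨by linarith, by linarith⟩ ⟨by linarith, by linarith⟩, noiseXi,
    map_smul, map_sub, Pi.smul_apply, Pi.sub_apply, smul_eq_mul, meanXi]
  ring

lemma le_mean_deltaR {f : ℝ → ℝ} (hf : f ∈ monoClass) {j : ℕ} (hj : 1 ≤ j) :
    f 0 ≤ 2 ^ j * ∫ x in 0..dy j, f x := by
  have h1 := (integral_bounds_of_mem_monoClass hf (a := 0) (by norm_num) (dy_pos j).le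
    (dy_le_half hj)).1
  calc f 0 = 2 ^ j * ((dy j - 0) * f 0) := by
        rw [sub_zero, ← mul_assoc, two_pow_mul_dy, one_mul]
    _ ≤ _ := by gcongr

lemma mean_deltaL_le {f : ℝ → ℝ} (hf : f ∈ monoClass) {j : ℕ} (hj : 1 ≤ j) :
    2 ^ j * ∫ x in -dy j..0, f x ≤ f 0 := by
  have h0 := dy_pos j
  have h2 := dy_le_half hj
  have h1 := (integral_bounds_of_mem_monoClass hf (a := -dy j) (b := 0) (by linarith) (by linarith)
    (by norm_num)).2
  calc 2 ^ j * ∫ x in -dy j..0, f x ≤ 2 ^ j * ((0 - -dy j) * f 0) := by gcongr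
    _ = f 0 := by rw [zero_sub, neg_neg, ← mul_assoc, two_pow_mul_dy, one_mul]

/-- By monotonicity the average over (0, 2^{-j}) is at most that over (2^{-j}, 2^{-j+1}), and the
opposite holds on the left. Thus the shell statistic bounds the bias of the end points; the 2
compares the factors 2^j and 2^{j-1}. -/
lemma mean_diff_le {f : ℝ → ℝ} (hf : f ∈ monoClass) {j : ℕ} (hj : 2 ≤ j) :
    2 ^ j * (∫ x in 0..dy j, f x) - 2 ^ j * (∫ x in -dy j..0, f x) ≤ 2 * meanXi f j := by
  have h0 := dy_pos j
  have h2 := dy_le_quarter hj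
  have h3 := (integral_bounds_of_mem_monoClass hf (a := 0) (b := dy j) (by linarith) (by linarith)
    (by linarith)).2
  have h4 := (integral_bounds_of_mem_monoClass hf (a := dy j) (b := 2 * dy j) (by linarith)
    (by linarith) (by linarith)).1
  have h5 := (integral_bounds_of_mem_monoClass hf (a := -dy j) (b := 0) (by linarith) (by linarith)
    (by linarith)).1
  have h6 := (integral_bounds_of_mem_monoClass hf (a := -(2 * dy j)) (b := -dy j) (by linarith)
    (by linarith) (by linarith)).2
  have hp : (0 : ℝ) < 2 ^ ((j : ℤ) - 1) := by positivity
  rw [meanXi, two_zpow_sub_one]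
  nlinarith

lemma meanXi_le {f : ℝ → ℝ} (hf : f ∈ monoClass) {j : ℕ} (hj : 2 ≤ j) :
    meanXi f j ≤ (f (2 * dy j) - f (-(2 * dy j))) / 2 := by
  have h0 := dy_pos j
  have h2 := dy_le_quarter hj
  have h4 := (integral_bounds_of_mem_monoClass hf (a := dy j) (b := 2 * dy j) (by linarith)
    (by linarith) (by linarith)).2
  have h6 := (integral_bounds_of_mem_monoClass hf (a := -(2 * dy j)) (b := -dy j) (by linarith)
    (by linarith) (by linarith)).1
  calc meanXi f j ≤ 2 ^ ((j : ℤ) - 1) * ((2 * dy j - dy j) * f (2 * dy j)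
        - (-dy j - -(2 * dy j)) * f (-(2 * dy j))) := by rw [meanXi]; gcongr
    _ = 2 ^ ((j : ℤ) - 1) * dy j * (f (2 * dy j) - f (-(2 * dy j))) := by ring
    _ = _ := by rw [zpow_sub_one_mul_dy]; ring

lemma meanXi_le_const {f : ℝ → ℝ} (hf : f ∈ monoClass) {j : ℕ} (hj : 2 ≤ j) :
    meanXi f j ≤ (f (1 / 2) - f (-(1 / 2))) / 2 := by
  have h0 := dy_pos j
  have h2 := dy_le_quarter hj
  have h3 : f (2 * dy j) ≤ f (1 / 2) := hf ⟨by linarith, by linarith⟩ ⟨by norm_num, by norm_num⟩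
    (by linarith)
  have h4 : f (-(1 / 2)) ≤ f (-(2 * dy j)) := hf ⟨by norm_num, by norm_num⟩
    ⟨by linarith, by linarith⟩ (by linarith)
  linarith [meanXi_le hf hj]

lemma meanXi_le_of_mem_lipClass {f : ℝ → ℝ} {β M : ℝ} (hf : f ∈ monoClass) (hl : f ∈ lipClass β M)
    (hβ1 : β ≤ 1) (hM : 0 < M) {j : ℕ} (hj : 2 ≤ j) :
    meanXi f j ≤ 3 * M * dy j ^ β := by
  have h0 := dy_pos j
  have h2 := dy_le_quarter hj
  simp only [lipClass, mem_ofPred_eq, if_pos hβ1] at hl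
  have h3 := hl (-(2 * dy j)) ⟨by linarith, by linarith⟩ (2 * dy j) ⟨by linarith, by linarith⟩
  have h4 : |2 * dy j - -(2 * dy j)| ^ β ≤ 4 * dy j ^ β := by
    rw [abs_of_pos (by linarith), show 2 * dy j - -(2 * dy j) = 4 * dy j by ring,
      Real.mul_rpow (by norm_num) h0.le]
    gcongr
    calc (4 : ℝ) ^ β ≤ 4 ^ (1 : ℝ) := Real.rpow_le_rpow_of_exponent_le (by norm_num) hβ1
      _ = 4 := Real.rpow_one _
  have h5 : 0 < M * dy j ^ β := by positivity
  have h6 : M * |2 * dy j - -(2 * dy j)| ^ β ≤ M * (4 * dy j ^ β) := by gcongr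
  linarith [meanXi_le hf hj, le_abs_self (f (2 * dy j) - f (-(2 * dy j)))]

/-! ### Coverage and length of the monotone procedure. -/

lemma measurable_xi (j : ℕ) : Measurable fun y => xi y j := by
  unfold xi
  exact (((measurable_val _).sub (measurable_val _)).const_mul _).sub
    (((measurable_val _).sub (measurable_val _)).const_mul _)

lemma measurable_monoJ (n α : ℝ) : Measurable (monoJ n α) :=
  measurable_sInf_level (X := fun j y => xi y j) (t := fun j => 3 / 2 * zq α * sig n j) measurable_xi

lemma measurable_monoCI_lower (n α : ℝ) : Measurable (monoCI n α).lower :=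
  measurable_level (h := fun j => (monoCIj n α j).lower)
    (fun _ => (((measurable_val _).sub (measurable_val _)).const_mul _).sub_const _)
    (measurable_monoJ n α)

lemma measurable_monoCI_upper (n α : ℝ) : Measurable (monoCI n α).upper :=
  measurable_level (h := fun j => (monoCIj n α j).upper)
    (fun _ => (((measurable_val _).sub (measurable_val _)).const_mul _).add_const _)
    (measurable_monoJ n α)

lemma monoJ_eq_of_mem_sel {n α : ℝ} {f : ℝ → ℝ} {ω : Ω} {j : ℕ}
    (h : ω ∈ sel (fun j ω => xi (whiteNoise n B f ω) j) (fun j => 3 / 2 * zq α * sig n j) 2 j) :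
    monoJ n α (whiteNoise n B f ω) = j := sInf_eq_of_mem_sel h

/-- The case β = 0 of `exists_level`. Since no smoothness is assumed for coverage, this is what
makes the procedures stop almost surely. -/
lemma exists_const_le {n τ : ℝ} (hn : 1 ≤ n) (hτ : 0 < τ) (D : ℝ) :
    ∃ J, 2 ≤ J ∧ ∀ i, J ≤ i → D ≤ τ * sig n i := by
  obtain ⟨J, hJ, hJ', -⟩ := exists_level (β := 0) (M := 2 + |D|) le_rfl
    (by linarith [abs_nonneg D]) hn hτ (le_refl 2)
  refine ⟨J, hJ, fun i hi => le_trans ?_ (hJ' i hi)⟩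
  rw [Real.rpow_zero]
  linarith [le_abs_self D, abs_nonneg D]

theorem monoCI_mem_guaranteed (hB : ∀ t, Measurable (B t)) (hP : IsPreBrownianReal B P) {n α : ℝ}
    (hn : 1 ≤ n) (hα : 0 < α) (hα' : α ≤ 1 / 5) :
    monoCI n α ∈ guaranteed P B n α monoClass := by
  have hprob := hP.isGaussianProcess.isProbabilityMeasure
  have hn0 : 0 < n := by linarith
  have hz : 0 < zq α := zq_pos hα (by linarith)
  refine ⟨measurable_monoCI_lower n α, measurable_monoCI_upper n α, fun f hf => ?_⟩
  refine ofReal_one_sub_le hα.le ?_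
  have hfi := intervalIntegrable_of_mem_monoClass hf
  set X : ℕ → Ω → ℝ := fun j ω => xi (whiteNoise n B f ω) j with hXdef
  set t : ℕ → ℝ := fun j => 3 / 2 * zq α * sig n j with ht
  have hX : ∀ j, 2 ≤ j → ∀ ω, X j ω = meanXi f j + noise B (noiseXi n j) ω :=
    fun j hj ω => xi_whiteNoise hfi n hj ω
  have hXm : ∀ j, Measurable (X j) := fun j => (measurable_xi j).comp (measurable_whiteNoise n hB f)
  have hcov : ∀ i j, 2 ≤ i → i < j → cov[noise B (noiseXi n i), noise B (noiseXi n j); P] = 0 :=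
    fun i j hi hij => cov_noiseXi_noiseXi hP n hi hij
  obtain ⟨J, hJ, hJ'⟩ := exists_const_le hn (by positivity : 0 < 3 / 2 * zq α)
    ((f (1 / 2) - f (-(1 / 2))) / 2)
  have hnull := measure_iUnion_sel_compl ⟨J, measure_surv_le (t := t) hB hP hX hcov (sig_pos hn0)
    (fun j hj => cov_noiseXi_self hP hn0 hj) hJ
    fun i hi => (meanXi_le_const hf (hJ.trans hi)).trans (hJ' i hi)⟩
  set ER : ℕ → Set Ω := fun j =>
    noise B (noiseR n j) ⁻¹' Iio (-(Real.sqrt 2 * sig n j * zq (α / 2))) with hER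
  set EL : ℕ → Set Ω := fun j =>
    noise B (noiseL n j) ⁻¹' Ioi (Real.sqrt 2 * sig n j * zq (α / 2)) with hEL
  have hmiss : P (⋃ j, sel X t 2 j ∩ (ER j ∪ EL j)) ≤ ENNReal.ofReal α := by
    refine measure_iUnion_sel_inter_le hXm fun j hj => ?_
    have hs : 0 < Real.sqrt 2 * sig n j := mul_pos (by positivity) (sig_pos hn0 j)
    have hq : gtail (zq (α / 2)) ≤ α / 2 := gtail_zq_le (by linarith)
    have h1 : P (sel X t 2 j ∩ ER j) ≤ P (sel X t 2 j) * ENNReal.ofReal (α / 2) := by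
      rw [hER, measure_sel_inter hB hP hX (fun i hi hij => cov_noiseXi_noiseR hP n hi hij)
        measurableSet_Iio]
      gcongr
      exact (measure_noise_lt hP hs (cov_noiseR_self hP hn0 j) (zq (α / 2))).le.trans
        (ENNReal.ofReal_le_ofReal hq)
    have h2 : P (sel X t 2 j ∩ EL j) ≤ P (sel X t 2 j) * ENNReal.ofReal (α / 2) := by
      rw [hEL, measure_sel_inter hB hP hX (fun i hi hij => cov_noiseXi_noiseL hP n hi hij)
        measurableSet_Ioi]
      gcongr
      exact (measure_noise_gt hP hs (cov_noiseL_self hP hn0 (by omega)) (zq (α / 2))).le.trans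
        (ENNReal.ofReal_le_ofReal hq)
    calc P (sel X t 2 j ∩ (ER j ∪ EL j)) ≤ P (sel X t 2 j ∩ ER j) + P (sel X t 2 j ∩ EL j) := by
          rw [inter_union_distrib_left]
          exact measure_union_le _ _
      _ ≤ _ := add_le_add h1 h2
      _ = P (sel X t 2 j) * ENNReal.ofReal α := by
          rw [← mul_add, ← ENNReal.ofReal_add (by positivity) (by positivity), add_halves]
  refine (measure_mono ?_).trans ((measure_union_le ((⋃ i, sel X t 2 i)ᶜ)
    (⋃ j, sel X t 2 j ∩ (ER j ∪ EL j))).trans (by rw [hnull, zero_add]; exact hmiss))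
  intro ω hω
  by_contra hcon
  rw [mem_union, not_or, mem_compl_iff, not_not, mem_iUnion, mem_iUnion, not_exists] at hcon
  obtain ⟨⟨j, hj⟩, hno⟩ := hcon
  have hno' := hno j
  simp only [mem_inter_iff, hj, true_and, mem_union, not_or, hER, hEL, mem_preimage, mem_Iio,
    mem_Ioi, not_lt] at hno'
  refine hω ?_
  have hj2 : 1 ≤ j := by have := hj.1; omega
  change f 0 ∈ Icc ((monoCIj n α (monoJ n α (whiteNoise n B f ω))).lower (whiteNoise n B f ω))
    ((monoCIj n α (monoJ n α (whiteNoise n B f ω))).upper (whiteNoise n B f ω))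
  rw [monoJ_eq_of_mem_sel hj]
  refine ⟨?_, ?_⟩
  · change deltaL _ j - _ ≤ _
    rw [deltaL_whiteNoise hfi n hj2]
    linarith [mean_deltaL_le hf hj2, hno'.2]
  · change _ ≤ deltaR _ j + _
    rw [deltaR_whiteNoise hfi n hj2]
    linarith [le_mean_deltaR hf hj2, hno'.1]

/-- The noise functional that dominates the length of the interval at level `j`. -/
def noiseLen (n : ℝ) (j : ℕ) : ℝ≥0 →₀ ℝ := (noiseR n j - noiseL n j) - (2 : ℝ) • noiseXi n j

lemma cov_noiseXi_noiseLen (hP : IsPreBrownianReal B P) (n : ℝ) {i j : ℕ} (hi : 2 ≤ i)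
    (hij : i < j) : cov[noise B (noiseXi n i), noise B (noiseLen n j); P] = 0 := by
  rw [noiseLen, cov_noise_sub_right hP, cov_noise_sub_right hP, cov_noise_smul_right,
    cov_noiseXi_noiseR hP n hi hij.le, cov_noiseXi_noiseL hP n hi hij.le,
    cov_noiseXi_noiseXi hP n hi hij]
  ring

lemma cov_noiseLen_self (hP : IsPreBrownianReal B P) {n : ℝ} (hn : 0 < n) {j : ℕ} (hj : 2 ≤ j) :
    cov[noise B (noiseLen n j), noise B (noiseLen n j); P] = (2 * Real.sqrt 2 * sig n j) ^ 2 := by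
  have hj1 : 1 ≤ j := by omega
  have e1 := cov_noiseXi_noiseR hP n hj le_rfl
  have e2 := cov_noiseXi_noiseL hP n hj le_rfl
  have e3 := cov_noiseR_noiseL hP n hj1
  have e1' := e1
  have e2' := e2
  have e3' := e3
  rw [covariance_comm] at e1' e2' e3'
  have h2 : Real.sqrt 2 ^ 2 = 2 := Real.sq_sqrt (by norm_num)
  rw [noiseLen]
  simp only [cov_noise_sub_right hP, cov_noise_sub_left hP, cov_noise_smul_right,
    cov_noise_smul_left, e1, e2, e3, e1', e2', e3', cov_noiseR_self hP hn, cov_noiseL_self hP hn hj1,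
    cov_noiseXi_self hP hn hj, mul_pow, h2]
  ring

theorem maxExpLength_monoCI_le (hB : ∀ t, Measurable (B t)) (hP : IsPreBrownianReal B P)
    {n α β M : ℝ} (hn : 1 ≤ n) (hα : 0 < α) (hα' : α ≤ 1 / 5) (hβ0 : 0 ≤ β) (hβ1 : β ≤ 1)
    (hM : 1 < M) :
    maxExpLength P B n (monoCI n α) (monoClass ∩ lipClass β M)
      ≤ ENNReal.ofReal (7 * (3 * zq α + 2 * Real.sqrt 2 * zq (α / 2) + 2 * Real.sqrt 2)
        * (2 * (1 + 3 / (3 / 2 * zq α))) * rate β M n) := by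
  have hn0 : 0 < n := by linarith
  have hz : 0 < zq α := zq_pos hα (by linarith)
  have hz2 : 0 < zq (α / 2) := zq_pos (by linarith) (by linarith)
  refine iSup₂_le fun f hf => ?_
  obtain ⟨hf, hl⟩ := hf
  have hfi := intervalIntegrable_of_mem_monoClass hf
  set X : ℕ → Ω → ℝ := fun j ω => xi (whiteNoise n B f ω) j with hXdef
  set t : ℕ → ℝ := fun j => 3 / 2 * zq α * sig n j with ht
  have hX : ∀ j, 2 ≤ j → ∀ ω, X j ω = meanXi f j + noise B (noiseXi n j) ω :=
    fun j hj ω => xi_whiteNoise hfi n hj ω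
  have hXm : ∀ j, Measurable (X j) := fun j => (measurable_xi j).comp (measurable_whiteNoise n hB f)
  obtain ⟨J, hJ, hJ', hJr⟩ := exists_level hβ0 hM hn (by positivity : 0 < 3 / 2 * zq α) (le_refl 2)
  -- The bias of the length is at most twice the mean of ξ_j, and acceptance bounds that mean by the
  -- threshold minus the noise of ξ_j. This gives 3 z_α σ_j plus the noise of δ^R - δ^L - 2ξ, whose
  -- variance is (2 + 2 + 4) σ_j².
  have hL := lintegral_le_of_sel (t := t) (L := fun ω => (monoCI n α).length (whiteNoise n B f ω))
    (K := 3 * zq α + 2 * Real.sqrt 2 * zq (α / 2)) (K' := 2 * Real.sqrt 2)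
    hB hP hn0 hXm hX (fun i j hi hij => cov_noiseXi_noiseXi hP n hi hij)
    (fun j hj => cov_noiseXi_self hP hn0 hj) hJ
    (fun i hi => (meanXi_le_of_mem_lipClass hf hl hβ1 (by linarith) (hJ.trans hi)).trans
      (hJ' i hi)) (by positivity) (by positivity)
    (fun i j hi hij => cov_noiseXi_noiseLen hP n hi hij) (fun j hj => cov_noiseLen_self hP hn0 hj) ?_
  · refine hL.trans (ENNReal.ofReal_le_ofReal ?_)
    rw [mul_assoc (7 * _) (2 * _)]
    gcongr
  · intro j ω hω
    have hj : 2 ≤ j := hω.1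
    have hs := sig_pos hn0 j
    have hXle : X j ω ≤ t j := hω.2.2
    rw [hX j hj] at hXle
    have hlen : (monoCI n α).upper (whiteNoise n B f ω) - (monoCI n α).lower (whiteNoise n B f ω)
        ≤ (3 * zq α + 2 * Real.sqrt 2 * zq (α / 2)) * sig n j + |noise B (noiseLen n j) ω| := by
      change (monoCIj n α (monoJ n α (whiteNoise n B f ω))).upper (whiteNoise n B f ω)
        - (monoCIj n α (monoJ n α (whiteNoise n B f ω))).lower (whiteNoise n B f ω) ≤ _
      rw [monoJ_eq_of_mem_sel hω]
      change deltaR _ j + _ - (deltaL _ j - _) ≤ _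
      rw [deltaL_whiteNoise hfi n (by omega), deltaR_whiteNoise hfi n (by omega)]
      have h1 := mean_diff_le hf hj
      have h2 := le_abs_self (noise B (noiseLen n j) ω)
      have h3 : noise B (noiseLen n j) ω = noise B (noiseR n j) ω - noise B (noiseL n j) ω
          - 2 * noise B (noiseXi n j) ω := by
        simp [noiseLen]
      simp only [ht] at hXle
      linarith
    rw [← ENNReal.ofReal_add (by positivity) (abs_nonneg _)]
    exact ENNReal.ofReal_le_ofReal hlen

end Monotone

/-! ### Symmetric averages of convex functions -/

section SymAvg

variable {f : ℝ → ℝ}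

/-- The average of `f` over `[-h, h]`. -/
def symAvg (f : ℝ → ℝ) (h : ℝ) : ℝ := 1 / 2 * ∫ u in (0 : ℝ)..1, (f (h * u) + f (-(h * u)))

lemma le_of_mem_convClass (hf : f ∈ convClass) {x y a : ℝ} (hx : x ∈ unitInt) (hy : y ∈ unitInt)
    (ha0 : 0 ≤ a) (ha1 : a ≤ 1) : f (a * x + (1 - a) * y) ≤ a * f x + (1 - a) * f y :=
  hf.2 hx hy ha0 (by linarith) (by ring)

lemma neg_mem_unitInt {x : ℝ} (hx : x ∈ unitInt) : -x ∈ unitInt :=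
  ⟨by linarith [hx.2], by linarith [hx.1]⟩

lemma two_mul_le_of_mem_convClass (hf : f ∈ convClass) {x : ℝ} (hx : x ∈ unitInt) :
    2 * f 0 ≤ f x + f (-x) := by
  have h := le_of_mem_convClass hf hx (neg_mem_unitInt hx) (a := 1 / 2) (by norm_num) (by norm_num)
  rw [show 1 / 2 * x + (1 - 1 / 2) * -x = 0 by ring] at h
  linarith

lemma symm_half_le_of_mem_convClass (hf : f ∈ convClass) {x : ℝ} (hx : x ∈ unitInt) :
    f (x / 2) + f (-(x / 2)) ≤ f x + f (-x) := by
  have h1 := le_of_mem_convClass hf hx (neg_mem_unitInt hx) (a := 3 / 4) (by norm_num) (by norm_num)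
  have h2 := le_of_mem_convClass hf hx (neg_mem_unitInt hx) (a := 1 / 4) (by norm_num) (by norm_num)
  rw [show 3 / 4 * x + (1 - 3 / 4) * -x = x / 2 by ring] at h1
  rw [show 1 / 4 * x + (1 - 1 / 4) * -x = -(x / 2) by ring] at h2
  linarith

lemma symm_half_le_zero_of_mem_convClass (hf : f ∈ convClass) {x : ℝ} (hx : x ∈ unitInt) :
    2 * (f (x / 2) + f (-(x / 2))) ≤ (f x + f (-x)) + 2 * f 0 := by
  have h0 : (0 : ℝ) ∈ unitInt := ⟨by norm_num, by norm_num⟩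
  have h1 := le_of_mem_convClass hf hx h0 (a := 1 / 2) (by norm_num) (by norm_num)
  have h2 := le_of_mem_convClass hf (neg_mem_unitInt hx) h0 (a := 1 / 2) (by norm_num) (by norm_num)
  rw [show 1 / 2 * x + (1 - 1 / 2) * 0 = x / 2 by ring] at h1
  rw [show 1 / 2 * -x + (1 - 1 / 2) * 0 = -(x / 2) by ring] at h2
  linarith

/-- Convexity at x/2 = (1/3) x + (2/3)(x/4): the drop of the symmetrization from x to x/2 is at
least twice the drop from x/2 to x/4. -/
lemma symm_half_le_quarter_of_mem_convClass (hf : f ∈ convClass) {x : ℝ} (hx : x ∈ unitInt) :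
    3 * (f (x / 2) + f (-(x / 2))) ≤ (f x + f (-x)) + 2 * (f (x / 2 / 2) + f (-(x / 2 / 2))) := by
  have h0 : x / 2 / 2 ∈ unitInt := ⟨by linarith [hx.1, hx.2], by linarith [hx.1, hx.2]⟩
  have h1 := le_of_mem_convClass hf hx h0 (a := 1 / 3) (by norm_num) (by norm_num)
  have h2 := le_of_mem_convClass hf (neg_mem_unitInt hx) (neg_mem_unitInt h0) (a := 1 / 3)
    (by norm_num) (by norm_num)
  rw [show 1 / 3 * x + (1 - 1 / 3) * (x / 2 / 2) = x / 2 by ring] at h1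
  rw [show 1 / 3 * -x + (1 - 1 / 3) * -(x / 2 / 2) = -(x / 2) by ring] at h2
  linarith

/-- A convex function may jump at the end points but is continuous inside. It is bounded above by
its end values and below by reflection, f(x) ≥ 2f(0) - f(-x). -/
lemma intervalIntegrable_of_mem_convClass (hf : f ∈ convClass) :
    IntervalIntegrable f volume (-(1 / 2)) (1 / 2) := by
  rw [intervalIntegrable_iff_integrableOn_Ioo_of_le (by norm_num)]
  have hl : (-(1 / 2) : ℝ) ∈ unitInt := ⟨le_rfl, by norm_num⟩
  have hr : (1 / 2 : ℝ) ∈ unitInt := ⟨by norm_num, le_rfl⟩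
  have hub : ∀ x ∈ unitInt, f x ≤ max (f (-(1 / 2))) (f (1 / 2)) := fun x hx =>
    hf.le_max_of_mem_Icc hl hr hx
  refine IntegrableOn.of_bound measure_Ioo_lt_top ?_
    (|max (f (-(1 / 2))) (f (1 / 2))| + |2 * f 0|) ?_
  · refine ContinuousOn.aestronglyMeasurable ?_ measurableSet_Ioo
    have h := hf.continuousOn_interior
    rwa [interior_Icc] at h
  · refine (ae_restrict_iff' measurableSet_Ioo).2 (ae_of_all _ fun x hx => ?_)
    have hx' : x ∈ unitInt := Ioo_subset_Icc_self hx
    have h1 := hub x hx'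
    have h2 := hub (-x) (neg_mem_unitInt hx')
    have h3 := two_mul_le_of_mem_convClass hf hx'
    have h4 := le_abs_self (max (f (-(1 / 2))) (f (1 / 2)))
    rw [Real.norm_eq_abs, abs_le]
    constructor
    · linarith [neg_abs_le (2 * f 0)]
    · linarith [abs_nonneg (2 * f 0)]

lemma intervalIntegrable_symm (hf : IntervalIntegrable f volume (-(1 / 2)) (1 / 2)) {h : ℝ}
    (hh : 0 < h) (hh' : h ≤ 1 / 2) :
    IntervalIntegrable (fun u => f (h * u)) volume 0 1 ∧
      IntervalIntegrable (fun u => f (-(h * u))) volume 0 1 := by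
  have h0 : (0 : ℝ) ∈ unitInt := ⟨by norm_num, by norm_num⟩
  have h1 := (intervalIntegrable_sub hf h0 (b := h) ⟨by linarith, hh'⟩).comp_mul_left (c := h)
  have h2 := (intervalIntegrable_sub hf h0 (b := -h) ⟨by linarith, by linarith⟩).comp_mul_left
    (c := -h)
  rw [zero_div, div_self hh.ne'] at h1
  rw [zero_div, div_self (neg_ne_zero.2 hh.ne')] at h2
  simp only [neg_mul] at h2
  exact ⟨h1, h2⟩

lemma integral_eq_symAvg (hf : IntervalIntegrable f volume (-(1 / 2)) (1 / 2)) {h : ℝ}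
    (hh : 0 < h) (hh' : h ≤ 1 / 2) : ∫ x in -h..h, f x = 2 * h * symAvg f h := by
  have h0 : (0 : ℝ) ∈ unitInt := ⟨by norm_num, by norm_num⟩
  obtain ⟨h1, h2⟩ := intervalIntegrable_symm hf hh hh'
  have h3 : ∫ u in (0 : ℝ)..1, f (h * u) = h⁻¹ * ∫ x in 0..h, f x := by
    rw [intervalIntegral.integral_comp_mul_left f hh.ne', mul_zero, mul_one, smul_eq_mul]
  have h4 : ∫ u in (0 : ℝ)..1, f (-(h * u)) = h⁻¹ * ∫ x in -h..0, f x := by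
    have := intervalIntegral.integral_comp_mul_left (a := 0) (b := 1) f (neg_ne_zero.2 hh.ne')
    simp only [neg_mul, mul_zero, mul_one, smul_eq_mul] at this
    rw [this, intervalIntegral.integral_symm, inv_neg]
    ring
  rw [symAvg, intervalIntegral.integral_add h1 h2, h3, h4,
    ← intervalIntegral.integral_add_adjacent_intervals
      (intervalIntegrable_sub hf (a := -h) (b := 0) ⟨by linarith, by linarith⟩ h0)
      (intervalIntegrable_sub hf (a := 0) (b := h) h0 ⟨by linarith, hh'⟩)]
  field_simp
  ring

lemma dy_mul_mem_unitInt {j : ℕ} (hj : 1 ≤ j) {u : ℝ} (hu : u ∈ Icc (0 : ℝ) 1) :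
    dy j * u ∈ unitInt := by
  have h1 := dy_pos j
  have h2 := dy_le_half hj
  have h3 := mul_nonneg h1.le hu.1
  have h4 := mul_le_of_le_one_right h1.le hu.2
  exact ⟨by linarith, by linarith⟩

lemma dy_succ_mul (j : ℕ) (u : ℝ) : dy (j + 1) * u = dy j * u / 2 := by
  rw [← dy_succ j]; ring

lemma intervalIntegrable_symAvg (hf : f ∈ convClass) {j : ℕ} (hj : 1 ≤ j) :
    IntervalIntegrable (fun u => f (dy j * u) + f (-(dy j * u))) volume 0 1 :=
  have h := intervalIntegrable_symm (intervalIntegrable_of_mem_convClass hf) (dy_pos j)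
    (dy_le_half hj)
  h.1.add h.2

lemma le_symAvg (hf : f ∈ convClass) {j : ℕ} (hj : 1 ≤ j) : f 0 ≤ symAvg f (dy j) := by
  have h := intervalIntegral.integral_mono_on (by norm_num) (intervalIntegrable_const (c := 2 * f 0))
    (intervalIntegrable_symAvg hf hj)
    fun u hu => two_mul_le_of_mem_convClass hf (dy_mul_mem_unitInt hj hu)
  rw [intervalIntegral.integral_const, smul_eq_mul] at h
  rw [symAvg]
  linarith

/-- Linear extrapolation of the averages to width 0 underestimates f(0); this gives the lower end
point 2δ_{j+1} - δ_j a bias of the safe sign. -/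
lemma two_mul_symAvg_le (hf : f ∈ convClass) {j : ℕ} (hj : 1 ≤ j) :
    2 * symAvg f (dy (j + 1)) ≤ symAvg f (dy j) + f 0 := by
  have h := intervalIntegral.integral_mono_on (by norm_num)
    ((intervalIntegrable_symAvg hf (j := j + 1) (by omega)).const_mul 2)
    ((intervalIntegrable_symAvg hf hj).add (intervalIntegrable_const (c := 2 * f 0)))
    fun u hu => by
      rw [dy_succ_mul]
      exact symm_half_le_zero_of_mem_convClass hf (dy_mul_mem_unitInt hj hu)
  rw [intervalIntegral.integral_const_mul, intervalIntegral.integral_add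
    (intervalIntegrable_symAvg hf hj) intervalIntegrable_const, intervalIntegral.integral_const,
    smul_eq_mul] at h
  rw [symAvg, symAvg]
  linarith

/-- The expected value of `δ_j - δ_{j+1}`. -/
def meanT (f : ℝ → ℝ) (j : ℕ) : ℝ := symAvg f (dy j) - symAvg f (dy (j + 1))

lemma meanT_nonneg (hf : f ∈ convClass) {j : ℕ} (hj : 1 ≤ j) : 0 ≤ meanT f j := by
  have h := intervalIntegral.integral_mono_on (by norm_num)
    (intervalIntegrable_symAvg hf (j := j + 1) (by omega)) (intervalIntegrable_symAvg hf hj)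
    fun u hu => by
      rw [dy_succ_mul]
      exact symm_half_le_of_mem_convClass hf (dy_mul_mem_unitInt hj hu)
  rw [meanT, symAvg, symAvg]
  linarith

/-- The means at least halve per level while σ_j grows by √2, so the signal-to-noise ratio of the
tests changes by a fixed factor per level. This confines stopping to a few levels around the ideal
one. -/
lemma two_mul_meanT_succ_le (hf : f ∈ convClass) {j : ℕ} (hj : 1 ≤ j) :
    2 * meanT f (j + 1) ≤ meanT f j := by
  have i0 := intervalIntegrable_symAvg hf hj
  have i1 := intervalIntegrable_symAvg hf (j := j + 1) (by omega)
  have i2 := intervalIntegrable_symAvg hf (j := j + 1 + 1) (by omega)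
  have h := intervalIntegral.integral_mono_on (by norm_num) (i1.const_mul 3)
    (i0.add (i2.const_mul 2)) fun u hu => by
      rw [dy_succ_mul (j + 1), dy_succ_mul]
      exact symm_half_le_quarter_of_mem_convClass hf (dy_mul_mem_unitInt hj hu)
  rw [intervalIntegral.integral_const_mul, intervalIntegral.integral_add i0 (i2.const_mul 2),
    intervalIntegral.integral_const_mul] at h
  rw [meanT, meanT, symAvg, symAvg, symAvg]
  linarith

lemma two_pow_mul_meanT_le (hf : f ∈ convClass) {j : ℕ} (hj : 1 ≤ j) (k : ℕ) :
    2 ^ k * meanT f (j + k) ≤ meanT f j := by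
  induction k with
  | zero => simp
  | succ k ih =>
    have h := two_mul_meanT_succ_le hf (j := j + k) (by omega)
    have h2 : (0 : ℝ) < 2 ^ k := by positivity
    rw [pow_succ, ← add_assoc]
    nlinarith

lemma meanT_le_one (hf : f ∈ convClass) {j : ℕ} (hj : 1 ≤ j) : meanT f j ≤ meanT f 1 := by
  obtain ⟨k, rfl⟩ : ∃ k, j = 1 + k := ⟨j - 1, by omega⟩
  have h := two_pow_mul_meanT_le hf le_rfl k
  have h1 : (1 : ℝ) ≤ 2 ^ k := one_le_pow₀ (by norm_num)
  nlinarith [meanT_nonneg hf hj]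

/-- For β > 1 the mean value theorem on [x/2, x] and [-x, -x/2] writes the difference as (f'(c) -
f'(d)) x/2 with |c - d| ≤ 2x; then 2^{β-1} ≤ 2. -/
lemma symm_sub_half_le_of_mem_lipClass {β M : ℝ} (hl : f ∈ lipClass β M) (hβ1 : 1 ≤ β)
    (hβ2 : β ≤ 2) (hM : 0 < M) {x : ℝ} (hx0 : 0 ≤ x) (hx : x ≤ 1 / 2) :
    (f x + f (-x)) - (f (x / 2) + f (-(x / 2))) ≤ M * x ^ β := by
  rcases hx0.eq_or_lt with rfl | hx0
  · simp [Real.zero_rpow (by linarith : β ≠ 0)]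
  rcases hβ1.eq_or_lt with rfl | hβ1
  · simp only [lipClass, mem_ofPred_eq, le_refl, if_true, Real.rpow_one] at hl
    have h1 := hl (x / 2) ⟨by linarith, by linarith⟩ x ⟨by linarith, by linarith⟩
    have h2 := hl (-(x / 2)) ⟨by linarith, by linarith⟩ (-x) ⟨by linarith, by linarith⟩
    rw [show x - x / 2 = x / 2 by ring, abs_of_pos (by linarith : 0 < x / 2)] at h1
    rw [show -x - -(x / 2) = -(x / 2) by ring, abs_neg, abs_of_pos (by linarith : 0 < x / 2)] at h2
    rw [Real.rpow_one]
    linarith [le_abs_self (f x - f (x / 2)), le_abs_self (f (-x) - f (-(x / 2)))]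
  · have hfl : lowerFloor β = 1 := by
      have : ⌈β⌉₊ = 2 := by
        rw [Nat.ceil_eq_iff (by norm_num)]
        exact ⟨by norm_num; exact hβ1, by exact_mod_cast hβ2⟩
      rw [lowerFloor, this]
    simp only [lipClass, mem_ofPred_eq, if_neg (not_le.2 hβ1), hfl, iteratedDerivWithin_one,
      Nat.cast_one] at hl
    obtain ⟨hc, hd⟩ := hl
    have hdiff : DifferentiableOn ℝ f unitInt := hc.differentiableOn one_ne_zero
    have hderiv : ∀ y ∈ Ioo (-(1 / 2) : ℝ) (1 / 2), HasDerivAt f (derivWithin f unitInt y) y :=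
      fun y hy => (hdiff y (Ioo_subset_Icc_self hy)).hasDerivWithinAt.hasDerivAt
        (Icc_mem_nhds hy.1 hy.2)
    have hmvt : ∀ a b : ℝ, -(1 / 2) ≤ a → a < b → b ≤ 1 / 2 →
        ∃ c ∈ Ioo a b, derivWithin f unitInt c * (b - a) = f b - f a := by
      intro a b ha hab hb
      obtain ⟨c, hc, hce⟩ := exists_hasDerivAt_eq_slope f (derivWithin f unitInt) hab
        (hdiff.continuousOn.mono (Icc_subset_Icc ha hb))
        fun y hy => hderiv y ⟨by linarith [hy.1], by linarith [hy.2]⟩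
      refine ⟨c, hc, ?_⟩
      rw [hce]
      field_simp [sub_ne_zero.2 hab.ne']
    obtain ⟨c, hc1, hc2⟩ := hmvt (x / 2) x (by linarith) (by linarith) hx
    obtain ⟨d, hd1, hd2⟩ := hmvt (-x) (-(x / 2)) (by linarith) (by linarith) (by linarith)
    have h3 := hd c ⟨by linarith [hc1.1], by linarith [hc1.2]⟩ d
      ⟨by linarith [hd1.1], by linarith [hd1.2]⟩
    have h4 : |c - d| ≤ 2 * x := by
      rw [abs_le]
      constructor <;> linarith [hc1.1, hc1.2, hd1.1, hd1.2]
    have h5 : |c - d| ^ (β - 1) ≤ 2 * x ^ (β - 1) := by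
      calc |c - d| ^ (β - 1) ≤ (2 * x) ^ (β - 1) := by gcongr
        _ = 2 ^ (β - 1) * x ^ (β - 1) := Real.mul_rpow (by norm_num) hx0.le
        _ ≤ 2 ^ (1 : ℝ) * x ^ (β - 1) := by
            gcongr
            · norm_num
            · linarith
        _ = _ := by rw [Real.rpow_one]
    have h6 : x * x ^ (β - 1) = x ^ β := by
      rw [← Real.rpow_one_add' hx0.le (by linarith)]
      ring_nf
    calc (f x + f (-x)) - (f (x / 2) + f (-(x / 2)))
        = (derivWithin f unitInt c - derivWithin f unitInt d) * (x / 2) := by linarith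
      _ ≤ (M * (2 * x ^ (β - 1))) * (x / 2) := by
          gcongr
          exact (le_abs_self _).trans (h3.trans (by gcongr))
      _ = M * (x * x ^ (β - 1)) := by ring
      _ = _ := by rw [h6]

lemma meanT_le_of_mem_lipClass {β M : ℝ} (hf : f ∈ convClass) (hl : f ∈ lipClass β M)
    (hβ1 : 1 ≤ β) (hβ2 : β ≤ 2) (hM : 0 < M) {j : ℕ} (hj : 1 ≤ j) :
    meanT f j ≤ 3 * M * dy j ^ β := by
  have h0 := dy_pos j
  have i0 := intervalIntegrable_symAvg hf hj
  have i1 := intervalIntegrable_symAvg hf (j := j + 1) (by omega)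
  have h := intervalIntegral.integral_mono_on (by norm_num) i0
    (i1.add (intervalIntegrable_const (c := M * dy j ^ β))) fun u hu => by
      have h3 := mul_nonneg h0.le hu.1
      have h4 := mul_le_of_le_one_right h0.le hu.2
      have h1 := symm_sub_half_le_of_mem_lipClass hl hβ1 hβ2 hM h3 (h4.trans (dy_le_half hj))
      have h2 : M * (dy j * u) ^ β ≤ M * dy j ^ β := by gcongr
      rw [dy_succ_mul]
      linarith
  rw [intervalIntegral.integral_add i1 intervalIntegrable_const, intervalIntegral.integral_const,
    smul_eq_mul] at h
  have h5 : 0 < M * dy j ^ β := by positivity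
  rw [meanT, symAvg, symAvg]
  linarith

end SymAvg

/-! ### The convex procedure -/

section Convex

variable {Ω : Type*} {mΩ : MeasurableSpace Ω} {P : Measure Ω} {B : ℝ≥0 → Ω → ℝ} {f : ℝ → ℝ}

/-- The noise functional of `δ_j`. -/
def noiseD (n : ℝ) (j : ℕ) : ℝ≥0 →₀ ℝ :=
  ((Real.sqrt n)⁻¹ * 2 ^ ((j : ℤ) - 1)) • inc (-dy j) (dy j)

/-- The noise functional of `δ_j - δ_{j+1}`. -/
def noiseT (n : ℝ) (j : ℕ) : ℝ≥0 →₀ ℝ := noiseD n j - noiseD n (j + 1)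

/-- The covariance depends only on the coarser level, as for a Brownian motion at the times σ_j².
The differences T_j are therefore its independent increments, of variance σ_{j+1}² - σ_j² = σ_j². -/
lemma cov_noiseD (hP : IsPreBrownianReal B P) {n : ℝ} (hn : 0 < n) {i j : ℕ} (hi : 1 ≤ i)
    (hij : i ≤ j) : cov[noise B (noiseD n i), noise B (noiseD n j); P] = sig n i ^ 2 := by
  have h1 := dy_pos j
  have h2 : dy j ≤ dy i := dy_anti hij
  have h3 := dy_le_half hi
  have h4 := zpow_sub_one_mul_dy j
  have h5 := inv_sqrt_sq hn
  rw [noiseD, noiseD, cov_noise_smul_left, cov_noise_smul_right,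
    cov_inc hP (by linarith) (by linarith) (by linarith) (by linarith), min_eq_right h2,
    min_eq_right (by linarith), min_eq_left (by linarith), min_eq_left (by linarith), sig_sq hn.le,
    div_eq_mul_inv, ← h5]
  linear_combination 2 * (Real.sqrt n)⁻¹ ^ 2 * 2 ^ ((i : ℤ) - 1) * h4

lemma cov_noiseD' (hP : IsPreBrownianReal B P) {n : ℝ} (hn : 0 < n) {i j : ℕ} (hi : 1 ≤ i)
    (hij : i ≤ j) : cov[noise B (noiseD n j), noise B (noiseD n i); P] = sig n i ^ 2 := by
  rw [covariance_comm, cov_noiseD hP hn hi hij]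

lemma cov_noiseT_noiseT (hP : IsPreBrownianReal B P) {n : ℝ} (hn : 0 < n) {i j : ℕ} (hi : 1 ≤ i)
    (hij : i < j) : cov[noise B (noiseT n i), noise B (noiseT n j); P] = 0 := by
  rw [noiseT, noiseT, cov_noise_sub_left hP, cov_noise_sub_right hP, cov_noise_sub_right hP,
    cov_noiseD hP hn hi hij.le, cov_noiseD hP hn hi (by omega), cov_noiseD hP hn (by omega) hij,
    cov_noiseD hP hn (by omega) (by omega)]
  ring

lemma sig_succ_sq {n : ℝ} (hn : 0 < n) (j : ℕ) : sig n (j + 1) ^ 2 = 2 * sig n j ^ 2 := by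
  rw [sig_succ hn, mul_pow, Real.sq_sqrt (by norm_num)]

lemma cov_noiseT_self (hP : IsPreBrownianReal B P) {n : ℝ} (hn : 0 < n) {j : ℕ} (hj : 1 ≤ j) :
    cov[noise B (noiseT n j), noise B (noiseT n j); P] = sig n j ^ 2 := by
  rw [noiseT, cov_noise_sub_left hP, cov_noise_sub_right hP, cov_noise_sub_right hP,
    cov_noiseD hP hn hj le_rfl, cov_noiseD hP hn hj (by omega), cov_noiseD' hP hn hj (by omega),
    cov_noiseD hP hn (by omega) le_rfl, sig_succ_sq hn]
  ring

lemma cov_noise_lower (hP : IsPreBrownianReal B P) {n : ℝ} (hn : 0 < n) {j : ℕ} (hj : 1 ≤ j) :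
    cov[noise B ((2 : ℝ) • noiseD n (j + 1) - noiseD n j),
      noise B ((2 : ℝ) • noiseD n (j + 1) - noiseD n j); P] = (Real.sqrt 5 * sig n j) ^ 2 := by
  rw [cov_noise_sub_left hP, cov_noise_sub_right hP, cov_noise_sub_right hP, cov_smul_self,
    cov_noise_smul_left, cov_noise_smul_right, cov_noiseD hP hn hj le_rfl,
    cov_noiseD hP hn hj (by omega), cov_noiseD' hP hn hj (by omega),
    cov_noiseD hP hn (by omega) le_rfl, sig_succ_sq hn, mul_pow, Real.sq_sqrt (by norm_num)]
  ring

lemma delta_whiteNoise (hf : f ∈ convClass) (n : ℝ) {j : ℕ} (hj : 1 ≤ j) (ω : Ω) :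
    delta (whiteNoise n B f ω) j = symAvg f (dy j) + noise B (noiseD n j) ω := by
  have h1 := dy_pos j
  have h2 := dy_le_half hj
  have hfi := intervalIntegrable_of_mem_convClass hf
  rw [delta, val_whiteNoise_sub n B ω hfi ⟨by linarith, by linarith⟩ ⟨by linarith, h2⟩, noiseD,
    integral_eq_symAvg hfi h1 h2, map_smul, Pi.smul_apply, smul_eq_mul]
  linear_combination 2 * symAvg f (dy j) * zpow_sub_one_mul_dy j

lemma delta_sub_whiteNoise (hf : f ∈ convClass) (n : ℝ) {j : ℕ} (hj : 1 ≤ j) (ω : Ω) :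
    delta (whiteNoise n B f ω) j - delta (whiteNoise n B f ω) (j + 1)
      = meanT f j + noise B (noiseT n j) ω := by
  rw [delta_whiteNoise hf n hj, delta_whiteNoise hf n (by omega), meanT, noiseT, map_sub,
    Pi.sub_apply]
  ring

lemma measurable_delta (j : ℕ) : Measurable fun y => delta y j :=
  ((measurable_val _).sub (measurable_val _)).const_mul _

lemma measurable_convJ (n α : ℝ) : Measurable (convJ n α) :=
  measurable_sInf_level (X := fun j y => delta y j - delta y (j + 1))
    (t := fun j => zq α * sig n j) fun j => (measurable_delta j).sub (measurable_delta (j + 1))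

lemma measurable_convCI_lower (n α : ℝ) : Measurable (convCI n α).lower :=
  measurable_level (h := fun j => (convCIj n (α / 6) j).lower)
    (fun j => (((measurable_delta (j + 1)).const_mul 2).sub (measurable_delta j)).sub_const _)
    (measurable_convJ n α)

lemma measurable_convCI_upper (n α : ℝ) : Measurable (convCI n α).upper :=
  measurable_level (h := fun j => (convCIj n (α / 6) j).upper)
    (fun j => (measurable_delta (j + 1)).add_const _)
    (measurable_convJ n α)

/-- The statistics that select the level of the convex procedure. -/
def convStat (B : ℝ≥0 → Ω → ℝ) (n : ℝ) (f : ℝ → ℝ) (j : ℕ) (ω : Ω) : ℝ :=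
  delta (whiteNoise n B f ω) j - delta (whiteNoise n B f ω) (j + 1)

lemma measurable_convStat (hB : ∀ t, Measurable (B t)) (n : ℝ) (f : ℝ → ℝ) (j : ℕ) :
    Measurable (convStat B n f j) :=
  ((measurable_delta j).sub (measurable_delta (j + 1))).comp (measurable_whiteNoise n hB f)

lemma convJ_eq_of_mem_sel {n α : ℝ} {ω : Ω} {j : ℕ}
    (h : ω ∈ sel (convStat B n f) (fun j => zq α * sig n j) 1 j) :
    convJ n α (whiteNoise n B f ω) = j := sInf_eq_of_mem_sel h

/-- The event that a noise variable of the interval at level `j` exceeds its threshold. -/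
def convMiss (B : ℝ≥0 → Ω → ℝ) (n z : ℝ) (j : ℕ) : Set Ω :=
  {ω | Real.sqrt 5 * sig n j * z < noise B ((2 : ℝ) • noiseD n (j + 1) - noiseD n j) ω} ∪
    {ω | noise B (noiseD n (j + 1)) ω < -(sig n (j + 1) * z)}

lemma measure_convMiss_le (hP : IsPreBrownianReal B P) {n ε z : ℝ} (hn : 0 < n) (hε : 0 ≤ ε)
    (hz : gtail z ≤ ε) {j : ℕ} (hj : 1 ≤ j) :
    P (convMiss B n z j) ≤ ENNReal.ofReal (2 * ε) := by
  refine (measure_union_le _ _).trans ?_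
  have hs : 0 < Real.sqrt 5 * sig n j := mul_pos (by positivity) (sig_pos hn j)
  rw [measure_noise_gt hP hs (cov_noise_lower hP hn hj),
    measure_noise_lt hP (sig_pos hn _) (cov_noiseD hP hn (by omega) le_rfl), two_mul,
    ENNReal.ofReal_add hε hε]
  gcongr

lemma mem_convCI_of_mem_sel (hf : f ∈ convClass) {n α : ℝ} {ω : Ω} {j : ℕ}
    (h : ω ∈ sel (convStat B n f) (fun j => zq α * sig n j) 1 j)
    (hω : ω ∉ convMiss B n (zq (α / 6 / 2)) j) :
    f 0 ∈ (convCI n α).toSet (whiteNoise n B f ω) := by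
  have hj : 1 ≤ j := h.1
  simp only [convMiss, mem_union, mem_ofPred_eq, not_or, not_lt] at hω
  change f 0 ∈ Icc ((convCIj n (α / 6) (convJ n α (whiteNoise n B f ω))).lower (whiteNoise n B f ω))
    ((convCIj n (α / 6) (convJ n α (whiteNoise n B f ω))).upper (whiteNoise n B f ω))
  rw [convJ_eq_of_mem_sel h]
  refine ⟨?_, ?_⟩
  · change 2 * delta _ (j + 1) - delta _ j - _ ≤ _
    rw [delta_whiteNoise hf n hj, delta_whiteNoise hf n (by omega)]
    have h1 := two_mul_symAvg_le hf hj
    have h2 : noise B ((2 : ℝ) • noiseD n (j + 1) - noiseD n j) ω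
        = 2 * noise B (noiseD n (j + 1)) ω - noise B (noiseD n j) ω := by simp
    linarith [hω.1]
  · change _ ≤ delta _ (j + 1) + _
    rw [delta_whiteNoise hf n (by omega)]
    linarith [hω.2, le_symAvg hf (j := j + 1) (by omega)]

lemma measure_iUnion_sel_compl_conv (hB : ∀ t, Measurable (B t)) (hP : IsPreBrownianReal B P)
    (hf : f ∈ convClass) {n τ : ℝ} (hn : 1 ≤ n) (hτ : 0 < τ) :
    P (⋃ i, sel (convStat B n f) (fun j => τ * sig n j) 1 i)ᶜ = 0 := by
  have hn0 : 0 < n := by linarith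
  obtain ⟨J, hJ, hJ'⟩ := exists_const_le hn hτ (meanT f 1)
  exact measure_iUnion_sel_compl ⟨J, measure_surv_le hB hP
    (fun j hj ω => delta_sub_whiteNoise hf n hj ω) (fun i j => cov_noiseT_noiseT hP hn0)
    (sig_pos hn0) (fun j => cov_noiseT_self hP hn0) (by omega)
    fun i hi => (meanT_le_one hf (by omega)).trans (hJ' i hi)⟩

/-- At a level with a small bias, the procedure selects one of the next few levels. -/
lemma measure_surv_conv_le (hB : ∀ t, Measurable (B t)) (hP : IsPreBrownianReal B P)
    (hf : f ∈ convClass) {n α z : ℝ} (hn : 0 < n) (hα' : α ≤ 1 / 5) (hz : 0 < z) (h : gtail z ≤ α)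
    {J : ℕ} (hJ1 : 1 ≤ J) (hJ : meanT f J ≤ 3 / 5 * z * sig n J) :
    P (surv (convStat B n f) (fun j => z * sig n j) 1 (J + 3)) ≤ ENNReal.ofReal (2 / 15 * α) := by
  have hprob := hP.isGaussianProcess.isProbabilityMeasure
  have hX : ∀ j, 1 ≤ j → ∀ ω, convStat B n f j ω = meanT f j + noise B (noiseT n j) ω :=
    fun j hj ω => delta_sub_whiteNoise hf n hj ω
  have hcov : ∀ i j, 1 ≤ i → i < j → cov[noise B (noiseT n i), noise B (noiseT n j); P] = 0 :=
    fun i j => cov_noiseT_noiseT hP hn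
  have hs := sig_pos hn J
  have hs1 := sig_succ hn J
  have hs2 : sig n (J + 2) = 2 * sig n J := by
    rw [show J + 2 = J + 1 + 1 by ring, sig_succ hn, sig_succ hn, ← mul_assoc,
      Real.mul_self_sqrt (by norm_num)]
  -- In units of z σ the means at J, J+1, J+2 are at most 3/5, 3/(10√2) and 3/40, leaving the
  -- margins 2/5, 1969/2500 (hence this bound on √2) and 37/40.
  have hr2 : 1413 / 1000 ≤ Real.sqrt 2 := Real.le_sqrt_of_sq_le (by norm_num)
  have ht1 := two_pow_mul_meanT_le hf hJ1 1
  have ht2 := two_pow_mul_meanT_le hf hJ1 2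
  have hzs : 0 < z * sig n J := by positivity
  have h0 := measure_stat_gt (t := fun j => z * sig n j) hP hX hJ1 hs (cov_noiseT_self hP hn hJ1)
    (x := 2 / 5 * z) (by linarith)
  have h1 := measure_stat_gt (t := fun j => z * sig n j) hP hX (j := J + 1) (by omega) (sig_pos hn _)
    (cov_noiseT_self hP hn (by omega)) (x := 1969 / 2500 * z) (by
      simp only [hs1]
      nlinarith)
  have h2 := measure_stat_gt (t := fun j => z * sig n j) hP hX (j := J + 2) (by omega) (sig_pos hn _)
    (cov_noiseT_self hP hn (by omega)) (x := 37 / 40 * z) (by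
      simp only [hs2]
      linarith)
  rw [show J + 3 = J + 1 + 1 + 1 by ring, measure_surv_inter hB hP hX hcov (by omega),
    measure_surv_inter hB hP hX hcov (by omega), measure_surv_inter hB hP hX hcov hJ1]
  calc _ ≤ 1 * ENNReal.ofReal (gtail (2 / 5 * z)) * ENNReal.ofReal (gtail (1969 / 2500 * z))
        * ENNReal.ofReal (gtail (37 / 40 * z)) := by
        gcongr
        exact prob_le_one
    _ = ENNReal.ofReal (gtail (2 / 5 * z) * gtail (1969 / 2500 * z) * gtail (37 / 40 * z)) := by
        rw [one_mul, ← ENNReal.ofReal_mul (gtail_nonneg _),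
          ← ENNReal.ofReal_mul (mul_nonneg (gtail_nonneg _) (gtail_nonneg _))]
    _ ≤ _ := ENNReal.ofReal_le_ofReal (gtail_triple_le hα' hz h)

lemma sig_add_two_le {n : ℝ} (hn : 0 < n) (j m : ℕ) :
    2 * sig n j ≤ sig n (j + (m + 2)) := by
  have h2 : sig n (j + 2) = 2 * sig n j := by
    rw [show j + 2 = j + 1 + 1 by ring, sig_succ hn, sig_succ hn, ← mul_assoc,
      Real.mul_self_sqrt (by norm_num)]
  rw [← h2]
  exact sig_mono hn (by omega)

/-- The probability that the procedure stops at a level whose bias is large. -/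
lemma measure_sel_conv_le (hP : IsPreBrownianReal B P) (hf : f ∈ convClass) {n z : ℝ} (hn : 0 < n)
    (hz : 0 < z) {j m : ℕ} (hj : 1 ≤ j)
    (hJ : 3 / 5 * z * sig n (j + (m + 2)) < meanT f (j + (m + 2))) :
    P (sel (convStat B n f) (fun j => z * sig n j) 1 j)
      ≤ ENNReal.ofReal (gtail ((24 / 5 * 2 ^ m - 1) * z)) := by
  have hX : ∀ j, 1 ≤ j → ∀ ω, convStat B n f j ω = meanT f j + noise B (noiseT n j) ω :=
    fun j hj ω => delta_sub_whiteNoise hf n hj ω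
  have hsub : sel (convStat B n f) (fun j => z * sig n j) 1 j
      ⊆ {ω | convStat B n f j ω ≤ (fun j => z * sig n j) j} := fun ω hω => hω.2.2
  refine (measure_mono hsub).trans (measure_stat_le (t := fun j => z * sig n j) hP hX hj
    (sig_pos hn j) (cov_noiseT_self hP hn hj) ?_)
  -- The mean at j is at least 2^{m+2} times that at j+m+2, which exceeds (3/5) z · 2σ_j. So it is
  -- above (24/5) 2^m z σ_j, and acceptance needs noise below -((24/5) 2^m - 1) z σ_j.
  have h1 := two_pow_mul_meanT_le hf hj (m + 2)
  have h2 : 3 / 5 * z * (2 * sig n j) < meanT f (j + (m + 2)) :=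
    lt_of_le_of_lt (by gcongr; exact sig_add_two_le hn j m) hJ
  have h3 : (2 : ℝ) ^ (m + 2) * (3 / 5 * z * (2 * sig n j)) < 2 ^ (m + 2) * meanT f (j + (m + 2)) := by
    gcongr
  rw [pow_add] at h1 h3
  linarith

theorem convCI_mem_guaranteed (hB : ∀ t, Measurable (B t)) (hP : IsPreBrownianReal B P) {n α : ℝ}
    (hn : 1 ≤ n) (hα : 0 < α) (hα' : α ≤ 1 / 5) :
    convCI n α ∈ guaranteed P B n α convClass := by
  have hprob := hP.isGaussianProcess.isProbabilityMeasure
  have hn0 : 0 < n := by linarith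
  refine ⟨measurable_convCI_lower n α, measurable_convCI_upper n α, fun f hf => ?_⟩
  refine ofReal_one_sub_le hα.le ?_
  set z := zq α with hzdef
  have hz34 : 3 / 4 ≤ z := by
    have := half_sub_le_zq hα (by linarith)
    linarith
  have hz : 0 < z := by linarith
  have hq : gtail z ≤ α := gtail_zq_le hα
  have hq' : gtail (zq (α / 6 / 2)) ≤ α / 12 := by
    have := gtail_zq_le (α := α / 6 / 2) (by positivity)
    linarith
  set S := sel (convStat B n f) (fun j => z * sig n j) 1 with hS
  set E := convMiss B n (zq (α / 6 / 2)) with hE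
  have hex : ∃ j, 1 ≤ j ∧ meanT f j ≤ 3 / 5 * z * sig n j := by
    obtain ⟨J, hJ, hJ'⟩ := exists_const_le hn (by positivity : 0 < 3 / 5 * z) (meanT f 1)
    exact ⟨J, by omega, (meanT_le_one hf (by omega)).trans (hJ' J le_rfl)⟩
  classical
  obtain ⟨hJ1, hJ⟩ := Nat.find_spec hex
  have hmin : ∀ i, 1 ≤ i → i < Nat.find hex → 3 / 5 * z * sig n i < meanT f i := by
    intro i hi hlt
    have := Nat.find_min hex hlt
    simp only [not_and, not_le] at this
    exact this hi
  set J := Nat.find hex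
  -- The levels J-2, …, J+2. When the truncated index falls to 0 the selection event is empty, since
  -- levels start at 1.
  have hnear : P (⋃ k ∈ Finset.range 5, S (J + k - 2) ∩ E (J + k - 2))
      ≤ ENNReal.ofReal (5 * (α / 6)) := by
    calc P (⋃ k ∈ Finset.range 5, S (J + k - 2) ∩ E (J + k - 2))
        ≤ ∑ k ∈ Finset.range 5, P (S (J + k - 2) ∩ E (J + k - 2)) := measure_biUnion_finset_le _ _
      _ ≤ ∑ k ∈ Finset.range 5, ENNReal.ofReal (α / 6) := by
          refine Finset.sum_le_sum fun k _ => ?_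
          by_cases hk : 1 ≤ J + k - 2
          · refine (measure_mono inter_subset_right).trans
              ((measure_convMiss_le hP hn0 (by positivity) hq' hk).trans
                (ENNReal.ofReal_le_ofReal (by linarith)))
          · have : S (J + k - 2) = ∅ := by
              ext ω
              simp [hS, sel, hk]
            simp [this]
      _ = _ := by
          rw [Finset.sum_const, Finset.card_range, nsmul_eq_mul, ENNReal.ofReal_mul (by norm_num)]
          norm_num
  -- The levels below J-2, indexed by distance; the side condition keeps the truncated subtraction
  -- at a genuine level. Level J-1, whose mean is large by minimality of J, is then j + (m + 2).
  have hfar : P (⋃ m ∈ Finset.range J, S (J - 3 - m) ∩ {_ω | m + 4 ≤ J})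
      ≤ ENNReal.ofReal (α / 30) := by
    calc P (⋃ m ∈ Finset.range J, S (J - 3 - m) ∩ {_ω | m + 4 ≤ J})
        ≤ ∑ m ∈ Finset.range J, P (S (J - 3 - m) ∩ {_ω | m + 4 ≤ J}) :=
          measure_biUnion_finset_le _ _
      _ ≤ ∑ m ∈ Finset.range J, ENNReal.ofReal (gtail ((24 / 5 * 2 ^ m - 1) * z)) := by
          refine Finset.sum_le_sum fun m _ => ?_
          by_cases hm : m + 4 ≤ J
          · refine (measure_mono inter_subset_left).trans
              (measure_sel_conv_le hP hf hn0 hz (by omega) ?_)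
            exact hmin _ (by omega) (by omega)
          · simp [hm]
      _ = ENNReal.ofReal (∑ m ∈ Finset.range J, gtail ((24 / 5 * 2 ^ m - 1) * z)) :=
          (ENNReal.ofReal_sum_of_nonneg fun m _ => gtail_nonneg _).symm
      _ ≤ _ := ENNReal.ofReal_le_ofReal (sum_gtail_le hα.le hz34 hq J)
  have hlate := measure_surv_conv_le hB hP hf hn0 hα' hz hq hJ1 hJ
  have hnull := measure_iUnion_sel_compl_conv hB hP hf hn hz
  set N := (⋃ i, S i)ᶜ
  set A := ⋃ k ∈ Finset.range 5, S (J + k - 2) ∩ E (J + k - 2)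
  set F := ⋃ m ∈ Finset.range J, S (J - 3 - m) ∩ {_ω | m + 4 ≤ J}
  set V := surv (convStat B n f) (fun j => z * sig n j) 1 (J + 3)
  have hsub : {ω | f 0 ∈ (convCI n α).toSet (whiteNoise n B f ω)}ᶜ ⊆ N ∪ (A ∪ (F ∪ V)) := by
    intro ω hω
    by_contra hcon
    simp only [mem_union, not_or] at hcon
    obtain ⟨hN, hA, hF, hV⟩ := hcon
    rw [mem_compl_iff, not_not, mem_iUnion] at hN
    obtain ⟨j, hj⟩ := hN
    have hj1 : 1 ≤ j := hj.1
    refine hω (mem_convCI_of_mem_sel hf hj fun hmiss => ?_)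
    rcases Nat.lt_or_ge (j + 2) J with h1 | h1
    · refine hF (mem_biUnion (x := J - 3 - j) (Finset.mem_coe.2 (Finset.mem_range.2 (by omega))) ?_)
      rw [show J - 3 - (J - 3 - j) = j by omega]
      exact ⟨hj, by change J - 3 - j + 4 ≤ J; omega⟩
    · rcases Nat.lt_or_ge (J + 2) j with h2 | h2
      · exact hV (surv_anti (by omega) hj.2.1)
      · refine hA (mem_biUnion (x := j + 2 - J) (Finset.mem_coe.2 (Finset.mem_range.2 (by omega))) ?_)
        rw [show J + (j + 2 - J) - 2 = j by omega]
        exact ⟨hj, hmiss⟩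
  calc P {ω | f 0 ∈ (convCI n α).toSet (whiteNoise n B f ω)}ᶜ ≤ P (N ∪ (A ∪ (F ∪ V))) :=
        measure_mono hsub
    _ ≤ P N + (P A + (P F + P V)) := (measure_union_le _ _).trans (add_le_add le_rfl
        ((measure_union_le _ _).trans (add_le_add le_rfl (measure_union_le _ _))))
    _ ≤ 0 + (ENNReal.ofReal (5 * (α / 6)) + (ENNReal.ofReal (α / 30)
        + ENNReal.ofReal (2 / 15 * α))) := by
        gcongr
        exact hnull.le
    _ = ENNReal.ofReal α := by
        rw [zero_add, ← ENNReal.ofReal_add (by positivity) (by positivity),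
          ← ENNReal.ofReal_add (by positivity) (by positivity)]
        congr 1
        ring

theorem maxExpLength_convCI_le (hB : ∀ t, Measurable (B t)) (hP : IsPreBrownianReal B P)
    {n α β M : ℝ} (hn : 1 ≤ n) (hα : 0 < α) (hα' : α ≤ 1 / 5) (hβ1 : 1 ≤ β) (hβ2 : β ≤ 2)
    (hM : 1 < M) :
    maxExpLength P B n (convCI n α) (convClass ∩ lipClass β M)
      ≤ ENNReal.ofReal (7 * (zq α + zq (α / 6 / 2) * (Real.sqrt 5 + Real.sqrt 2))
        * (2 * (1 + 3 / zq α)) * rate β M n) := by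
  have hn0 : 0 < n := by linarith
  have hz : 0 < zq α := zq_pos hα (by linarith)
  have hz2 : 0 < zq (α / 6 / 2) := zq_pos (by linarith) (by linarith)
  refine iSup₂_le fun f hf => ?_
  obtain ⟨hf, hl⟩ := hf
  have hX : ∀ j, 1 ≤ j → ∀ ω, convStat B n f j ω = meanT f j + noise B (noiseT n j) ω :=
    fun j hj ω => delta_sub_whiteNoise hf n hj ω
  obtain ⟨J, hJ, hJ', hJr⟩ := exists_level (β := β) (by linarith) hM hn hz (by norm_num : 1 ≤ 2)
  -- The length at level j is T_j plus a fixed multiple of σ_j, and acceptance bounds T_j itself, so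
  -- no extra noise term is needed.
  have hL := lintegral_le_of_sel (t := fun j => zq α * sig n j)
    (L := fun ω => (convCI n α).length (whiteNoise n B f ω))
    (K := zq α + zq (α / 6 / 2) * (Real.sqrt 5 + Real.sqrt 2)) (K' := 0) (d := 0)
    hB hP hn0 (measurable_convStat hB n f) hX (fun i j => cov_noiseT_noiseT hP hn0)
    (fun j => cov_noiseT_self hP hn0) hJ
    (fun i hi => (meanT_le_of_mem_lipClass hf hl hβ1 hβ2 (by linarith) (hJ.trans hi)).trans
      (hJ' i hi)) (by positivity) le_rfl (by simp) (by simp) ?_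
  · refine hL.trans (ENNReal.ofReal_le_ofReal ?_)
    rw [add_zero, mul_assoc (7 * _) (2 * _)]
    gcongr
  · intro j ω hω
    have hj : 1 ≤ j := hω.1
    have hXle : convStat B n f j ω ≤ zq α * sig n j := hω.2.2
    refine le_add_right (ENNReal.ofReal_le_ofReal ?_)
    change (convCIj n (α / 6) (convJ n α (whiteNoise n B f ω))).upper (whiteNoise n B f ω)
      - (convCIj n (α / 6) (convJ n α (whiteNoise n B f ω))).lower (whiteNoise n B f ω) ≤ _
    rw [convJ_eq_of_mem_sel hω]
    change delta _ (j + 1) + _ * sig n (j + 1)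
      - (2 * delta _ (j + 1) - delta _ j - _) ≤ _
    rw [sig_succ hn0]
    rw [convStat] at hXle
    linarith

end Convex

/-! ### Upper and lower bounds combined. -/

lemma le_ofReal_mul_of_le_rate {L m : ℝ≥0∞} {C K r : ℝ} (hC : 0 ≤ C) (hK : 0 < K)
    (hL : L ≤ ENNReal.ofReal (C * r)) (hm : ENNReal.ofReal (r / K) ≤ m) :
    L ≤ ENNReal.ofReal (K * C) * m := by
  calc L ≤ ENNReal.ofReal (K * C * (r / K)) := by
        refine hL.trans_eq ?_
        congr 1
        field_simp
    _ = ENNReal.ofReal (K * C) * ENNReal.ofReal (r / K) := ENNReal.ofReal_mul (by positivity)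
    _ ≤ _ := by gcongr

end WhiteNoiseCI

end

theorem mainTheorem9 (α : ℝ) (hα : 0 < α) (hα' : α ≤ 1 / 5) :
    (∃ C₁ > (0 : ℝ), ∃ D₁ > (0 : ℝ),
      ∀ (Ω : Type*) [MeasurableSpace Ω] (P : Measure Ω) [IsProbabilityMeasure P]
        (B : ℝ≥0 → Ω → ℝ), (∀ t, Measurable (B t)) → IsBrownianReal B P →
      ∀ n : ℝ, 1 ≤ n →
        WhiteNoiseCI.monoCI n α ∈ WhiteNoiseCI.guaranteed P B n α WhiteNoiseCI.monoClass ∧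
        ∀ β M : ℝ, 0 ≤ β → β ≤ 1 → 1 < M →
          WhiteNoiseCI.maxExpLength P B n (WhiteNoiseCI.monoCI n α)
              (WhiteNoiseCI.monoClass ∩ WhiteNoiseCI.lipClass β M)
            ≤ ENNReal.ofReal (C₁ * M ^ (1 / (1 + 2 * β)) * n ^ (-(β / (1 + 2 * β)))) ∧
          WhiteNoiseCI.maxExpLength P B n (WhiteNoiseCI.monoCI n α)
              (WhiteNoiseCI.monoClass ∩ WhiteNoiseCI.lipClass β M)
            ≤ ENNReal.ofReal D₁ * WhiteNoiseCI.minimaxLength P B n α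
                (WhiteNoiseCI.monoClass ∩ WhiteNoiseCI.lipClass β M)) ∧
    (∃ C₂ > (0 : ℝ), ∃ D₂ > (0 : ℝ),
      ∀ (Ω : Type*) [MeasurableSpace Ω] (P : Measure Ω) [IsProbabilityMeasure P]
        (B : ℝ≥0 → Ω → ℝ), (∀ t, Measurable (B t)) → IsBrownianReal B P →
      ∀ n : ℝ, 1 ≤ n →
        WhiteNoiseCI.convCI n α ∈ WhiteNoiseCI.guaranteed P B n α WhiteNoiseCI.convClass ∧
        ∀ β M : ℝ, 1 ≤ β → β ≤ 2 → 1 < M →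
          WhiteNoiseCI.maxExpLength P B n (WhiteNoiseCI.convCI n α)
              (WhiteNoiseCI.convClass ∩ WhiteNoiseCI.lipClass β M)
            ≤ ENNReal.ofReal (C₂ * M ^ (1 / (1 + 2 * β)) * n ^ (-(β / (1 + 2 * β)))) ∧
          WhiteNoiseCI.maxExpLength P B n (WhiteNoiseCI.convCI n α)
              (WhiteNoiseCI.convClass ∩ WhiteNoiseCI.lipClass β M)
            ≤ ENNReal.ofReal D₂ * WhiteNoiseCI.minimaxLength P B n α
                (WhiteNoiseCI.convClass ∩ WhiteNoiseCI.lipClass β M)) := by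
  have hz : 0 < WhiteNoiseCI.zq α := WhiteNoiseCI.zq_pos hα (by linarith)
  have hz2 : 0 < WhiteNoiseCI.zq (α / 2) := WhiteNoiseCI.zq_pos (by linarith) (by linarith)
  have hz12 : 0 < WhiteNoiseCI.zq (α / 6 / 2) :=
    WhiteNoiseCI.zq_pos (by linarith) (by linarith)
  constructor
  · obtain ⟨C, hC, hCeq⟩ : ∃ C > (0 : ℝ), C = 7 * (3 * WhiteNoiseCI.zq α
        + 2 * Real.sqrt 2 * WhiteNoiseCI.zq (α / 2) + 2 * Real.sqrt 2)
        * (2 * (1 + 3 / (3 / 2 * WhiteNoiseCI.zq α))) := ⟨_, by positivity, rfl⟩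
    refine ⟨C, hC, 80 * C, by positivity, ?_⟩
    intro Ω _ P _ B hB hBr n hn
    have hP := hBr.toIsPreBrownianReal
    refine ⟨WhiteNoiseCI.monoCI_mem_guaranteed hB hP hn hα hα', fun β M hβ0 hβ1 hM => ?_⟩
    have h := WhiteNoiseCI.maxExpLength_monoCI_le hB hP hn hα hα' hβ0 hβ1 hM
    rw [← hCeq] at h
    refine ⟨?_, WhiteNoiseCI.le_ofReal_mul_of_le_rate hC.le (by norm_num) h
      (WhiteNoiseCI.le_minimaxLength_mono hB hP (by linarith) hα' hβ0 hβ1 (by linarith))⟩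
    rw [mul_assoc]
    exact h
  · obtain ⟨C, hC, hCeq⟩ : ∃ C > (0 : ℝ), C = 7 * (WhiteNoiseCI.zq α
        + WhiteNoiseCI.zq (α / 6 / 2) * (Real.sqrt 5 + Real.sqrt 2))
        * (2 * (1 + 3 / WhiteNoiseCI.zq α)) := ⟨_, by positivity, rfl⟩
    refine ⟨C, hC, 400000 * C, by positivity, ?_⟩
    intro Ω _ P _ B hB hBr n hn
    have hP := hBr.toIsPreBrownianReal
    refine ⟨WhiteNoiseCI.convCI_mem_guaranteed hB hP hn hα hα', fun β M hβ1 hβ2 hM => ?_⟩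
    have h := WhiteNoiseCI.maxExpLength_convCI_le hB hP hn hα hα' hβ1 hβ2 hM
    rw [← hCeq] at h
    refine ⟨?_, WhiteNoiseCI.le_ofReal_mul_of_le_rate hC.le (by norm_num) h
      (WhiteNoiseCI.le_minimaxLength_conv hB hP (by linarith) hα' hβ1 hβ2 (by linarith))⟩
    rw [mul_assoc]
    exact h
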